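/- Let $n\ge 1$ be an integer, $\tau$ in the upper half-plane, $p^{\lambda}=e^{\pi i\tau\lambda}$, $z=(z_1,\dots,z_{2n})\in\mathbb C^{2n}$, $x_j=e^{\pi i z_j}$, $X=x_1\cdots x_{2n}$, $\Delta(y)=\prod_{i<j}(y_i-y_j)$, and write $y^k=(y_1^k,\dots,y_{2n}^k)$. Let $\theta(x;q)=\prod_{j\ge 0}(1-xq^j)(1-q^{j+1}/x)$, $\theta(x_1,\dots,x_m;q)=\prod_k\theta(x_k;q)$, and $\operatorname{pf}_{1\le i,j\le 2n}(a_{ij})=\frac1{2^nn!}\sum_{s\in S_{2n}}\operatorname{sgn}(s)\prod_{k=1}^n a_{s(2k-1)s(2k)}$. For a partition $\lambda$ with at most $2n$ parts let $s_\lambda$ be the Schur polynomial in $2n$ variables, $\Delta(y)s_\lambda(y)=\det(y_i^{\lambda_j+2n-j})$, and let $e_n$ be the $n$-th elementary symmetric polynomial. For $\sigma\in\{0,1,2,3,4,6\}$ put $$P_n^{(0)}=\prod_{i<j}\theta(p^{1/3}x_i^2/x_j^2;p^{2/3})\,\operatorname{pf}\left(\frac{x_j^2\,\theta(x_i^2/x_j^2,-x_i^2/x_j^2,px_i^2/x_j^2;p^2)}{x_i^2\,\theta(p^{1/3}x_i^2/x_j^2;p^{2/3})}\right),$$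 $$P_n^{(1)}=\prod_{i<j}\frac{x_j^3}{x_i^3}\theta(-x_i^6/x_j^6;p^6)\,\operatorname{pf}\left(\frac{x_i\,\theta(x_i^2/x_j^2,-x_i^2/x_j^2,px_i^2/x_j^2;p^2)}{x_j\,\theta(-x_i^6/x_j^6;p^6)}\right),$$ $$P_n^{(2)}=\prod_{i<j}\theta(p^3x_i^6/x_j^6;p^6)\,\operatorname{pf}\left(\frac{x_j\,\theta(x_i^2/x_j^2,px_i^2/x_j^2,-px_i^2/x_j^2;p^2)}{x_i\,\theta(p^3x_i^6/x_j^6;p^6)}\right),$$ $$P_n^{(3)}=\prod_{i<j}\frac{x_j}{x_i}\theta(-x_i^2/x_j^2;p^{2/3})\,\operatorname{pf}\left(\frac{x_j\,\theta(x_i^2/x_j^2,-x_i^2/x_j^2,px_i^2/x_j^2;p^2)}{x_i\,\theta(-x_i^2/x_j^2;p^{2/3})}\right),$$ $$P_n^{(4)}=\prod_{i<j}\theta(p^3x_i^6/x_j^6;p^6)\,\operatorname{pf}\left(\frac{x_j^2\,\theta(x_i^2/x_j^2,-x_i^2/x_j^2,px_i^2/x_j^2;p^2)}{x_i^2\,\theta(p^3x_i^6/x_j^6;p^6)}\right),$$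 $$P_n^{(6)}=\prod_{i<j}\theta(p^{1/3}x_i^2/x_j^2;p^{2/3})\,\operatorname{pf}\left(\frac{x_j\,\theta(x_i^2/x_j^2,px_i^2/x_j^2,-px_i^2/x_j^2;p^2)}{x_i\,\theta(p^{1/3}x_i^2/x_j^2;p^{2/3})}\right),$$ with products over $1\le i<j\le 2n$ and pfaffians over $1\le i,j\le 2n$; the denominators cancel against the product in front, and each $P_n^{(\sigma)}$ denotes the resulting function, holomorphic in all variables. Then each $P_n^{(\sigma)}$ has a Taylor expansion $P_n^{(\sigma)}(z;\tau)=\sum_{k\ge0}c_k(z)\,p^{k/3}$, valid for all $z\in\mathbb C^{2n}$ and all $\tau$ in the upper half-plane. Its leading term $\pi_n^{(\sigma)}$, that is, $c_k(z)p^{k/3}$ for the smallest $k$ such that $c_k$ is not identically zero as a function of $z$, is $$\pi_n^{(0)}=(-1)^n p^{\frac{n(n-1)}6}X^{-2n}\Delta(x^2)\,e_n(x^2),$$ $$\pi_n^{(1)}=(-1)^nX^{4-6n}\Delta(x^4)\,s_{n-1,n-1,\dots,1,1,0,0}(x^4),$$ $$\pi_n^{(2)}=\begin{cases}(-1)^{\frac{n+1}2}p^{\frac{(n-1)(3n+1)}4}X^{2-3n}\Delta(x^2)\,s_{n-1,n-1,\dots,1,1,0,0}(x^2),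 & n\text{ odd},\\ (-1)^{\frac n2}p^{\frac{n(3n-2)}4}X^{1-3n}\Delta(x^2)\,s_{n,n-1,n-1,\dots,1,1,0}(x^2), & n\text{ even},\end{cases}$$ $$\pi_n^{(3)}=(-1)^{\frac{n(n+1)}2}p^{\frac{n(n-1)}3}X^{2-4n}\Delta(x^4),$$ $$\pi_n^{(4)}=\begin{cases}(-1)^{\frac{n+1}2}p^{\frac{(n-1)(3n-1)}4}X^{1-3n}\Delta(x^2)\,s_{n,n-1,n-1,\dots,1,1,0}(x^2), & n\text{ odd},\\ (-1)^{\frac n2}p^{\frac{n(3n-4)}4}X^{2-3n}\Delta(x^2)\,s_{n-1,n-1,\dots,1,1,0,0}(x^2), & n\text{ even},\end{cases}$$ $$\pi_n^{(6)}=(-1)^np^{\frac{n(n-1)}6}X^{1-2n}\Delta(x^2).$$ -/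

import Mathlib

open scoped UpperHalfPlane

noncomputable section

namespace EllipticPfaffian

/-! ### Theta functions -/

/-- The infinite shifted factorial `(a; q)_∞ = ∏_{j ≥ 0} (1 - a q^j)`, for `|q| < 1`. -/
def qPoch (a q : ℂ) : ℂ := ∏' j : ℕ, (1 - a * q ^ j)

/-- The theta function `θ(x; q) = (x; q)_∞ (q/x; q)_∞`, for `|q| < 1` and `x ≠ 0`. -/
def theta (x q : ℂ) : ℂ := qPoch x q * qPoch (q / x) q

/-- `p^a = e^{π i τ a}`, where `p = e^{π i τ}`. -/
def nomePow (τ : ℍ) (a : ℚ) : ℂ := Complex.exp (Real.pi * Complex.I * (τ : ℂ) * (a : ℂ))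

/-- The multiplicative variables `x_j = e^{π i z_j}`. -/
def mulVar {m : ℕ} (z : Fin m → ℂ) (j : Fin m) : ℂ := Complex.exp (Real.pi * Complex.I * z j)

/-! ### Pfaffians -/

/-- The (zero-based) position `2k`; it is the `(2k-1)`-st position in one-based numbering. -/
def evenPos {n : ℕ} (k : Fin n) : Fin (2 * n) := ⟨2 * (k : ℕ), by omega⟩

/-- The (zero-based) position `2k+1`; it is the `2k`-th position in one-based numbering. -/
def oddPos {n : ℕ} (k : Fin n) : Fin (2 * n) := ⟨2 * (k : ℕ) + 1, by omega⟩

/-- The pfaffian of a `2n × 2n` skew-symmetric matrix,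
`(1 / (2^n n!)) ∑_s sgn(s) ∏_k A_{s(2k-1), s(2k)}`. -/
def pfaffian {n : ℕ} (A : Matrix (Fin (2 * n)) (Fin (2 * n)) ℂ) : ℂ :=
  (1 / (2 ^ n * (n.factorial : ℂ))) *
    ∑ s : Equiv.Perm (Fin (2 * n)),
      ((Equiv.Perm.sign s : ℤ) : ℂ) * ∏ k : Fin n, A (s (evenPos k)) (s (oddPos k))

/-- `i` and `j` form one of the pairs `{s(2k-1), s(2k)}` of the pairing attached to `s`. -/
def IsPaired {n : ℕ} (s : Equiv.Perm (Fin (2 * n))) (i j : Fin (2 * n)) : Prop :=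
  ∃ k : Fin n, (s (evenPos k) = i ∧ s (oddPos k) = j) ∨ (s (evenPos k) = j ∧ s (oddPos k) = i)

/-! ### The functions `P_n^{(σ)}` -/

/-- The six labels `σ = 0, 1, 2, 3, 4, 6`. -/
inductive Label
  | zero
  | one
  | two
  | three
  | four
  | six

/-- The factor with indices `i < j` in the product in front of the pfaffian that defines
`P_n^{(σ)}`. -/
def prefactor (σ : Label) {m : ℕ} (z : Fin m → ℂ) (τ : ℍ) (i j : Fin m) : ℂ :=
  let x := mulVar z
  let p := nomePow τ
  match σ with
  | .zero => theta (p (1 / 3) * (x i ^ 2 / x j ^ 2)) (p (2 / 3))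
  | .one => x j ^ 3 / x i ^ 3 * theta (-(x i ^ 6 / x j ^ 6)) (p 6)
  | .two => theta (p 3 * (x i ^ 6 / x j ^ 6)) (p 6)
  | .three => x j / x i * theta (-(x i ^ 2 / x j ^ 2)) (p (2 / 3))
  | .four => theta (p 3 * (x i ^ 6 / x j ^ 6)) (p 6)
  | .six => theta (p (1 / 3) * (x i ^ 2 / x j ^ 2)) (p (2 / 3))

/-- `θ(y, -y, p y; p²) = θ(y; p²) θ(-y; p²) θ(p y; p²)`. -/
def tripleA (τ : ℍ) (y : ℂ) : ℂ :=
  theta y (nomePow τ 2) * theta (-y) (nomePow τ 2) * theta (nomePow τ 1 * y) (nomePow τ 2)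

/-- `θ(y, p y, -p y; p²) = θ(y; p²) θ(p y; p²) θ(-p y; p²)`. -/
def tripleB (τ : ℍ) (y : ℂ) : ℂ :=
  theta y (nomePow τ 2) * theta (nomePow τ 1 * y) (nomePow τ 2) *
    theta (-(nomePow τ 1 * y)) (nomePow τ 2)

/-- The matrix in the pfaffian that defines `P_n^{(σ)}`. -/
def entry (σ : Label) {m : ℕ} (z : Fin m → ℂ) (τ : ℍ) (i j : Fin m) : ℂ :=
  let x := mulVar z
  let p := nomePow τ
  match σ with
  | .zero => (x j ^ 2 * tripleA τ (x i ^ 2 / x j ^ 2)) /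
      (x i ^ 2 * theta (p (1 / 3) * (x i ^ 2 / x j ^ 2)) (p (2 / 3)))
  | .one => (x i * tripleA τ (x i ^ 2 / x j ^ 2)) /
      (x j * theta (-(x i ^ 6 / x j ^ 6)) (p 6))
  | .two => (x j * tripleB τ (x i ^ 2 / x j ^ 2)) /
      (x i * theta (p 3 * (x i ^ 6 / x j ^ 6)) (p 6))
  | .three => (x j * tripleA τ (x i ^ 2 / x j ^ 2)) /
      (x i * theta (-(x i ^ 2 / x j ^ 2)) (p (2 / 3)))
  | .four => (x j ^ 2 * tripleA τ (x i ^ 2 / x j ^ 2)) /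
      (x i ^ 2 * theta (p 3 * (x i ^ 6 / x j ^ 6)) (p 6))
  | .six => (x j * tripleB τ (x i ^ 2 / x j ^ 2)) /
      (x i * theta (p (1 / 3) * (x i ^ 2 / x j ^ 2)) (p (2 / 3)))

/-- The defining formula of `P_n^{(σ)}`: `∏_{i<j} (prefactor) * pfaffian (entries)`. It is
meaningful where no denominator vanishes. -/
def formulaP (σ : Label) (n : ℕ) (z : Fin (2 * n) → ℂ) (τ : ℍ) : ℂ :=
  (∏ i : Fin (2 * n), ∏ j ∈ Finset.Ioi i, prefactor σ z τ i j) *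
    pfaffian (Matrix.of fun i j => entry σ z τ i j)

/-- The entry of the matrix multiplied by the prefactor with the same indices. -/
def numer (σ : Label) {m : ℕ} (z : Fin m → ℂ) (τ : ℍ) (i j : Fin m) : ℂ :=
  let x := mulVar z
  match σ with
  | .zero => x j ^ 2 / x i ^ 2 * tripleA τ (x i ^ 2 / x j ^ 2)
  | .one => x j ^ 2 / x i ^ 2 * tripleA τ (x i ^ 2 / x j ^ 2)
  | .two => x j / x i * tripleB τ (x i ^ 2 / x j ^ 2)
  | .three => x j ^ 2 / x i ^ 2 * tripleA τ (x i ^ 2 / x j ^ 2)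
  | .four => x j ^ 2 / x i ^ 2 * tripleA τ (x i ^ 2 / x j ^ 2)
  | .six => x j / x i * tripleB τ (x i ^ 2 / x j ^ 2)

open Classical in
/-- The function `P_n^{(σ)}(z_1, …, z_{2n}; τ)`, holomorphic in all variables. It is the defining
formula `formulaP` with the denominators of the matrix entries cancelled against the product in
front of the pfaffian, so that it makes sense also at the removable singularities of that formula.
Everywhere else it is equal to the defining formula: see `P_eq_formulaP`. -/
def P (σ : Label) (n : ℕ) (z : Fin (2 * n) → ℂ) (τ : ℍ) : ℂ :=
  (1 / (2 ^ n * (n.factorial : ℂ))) *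
    ∑ s : Equiv.Perm (Fin (2 * n)), ((Equiv.Perm.sign s : ℤ) : ℂ) *
      ((∏ k : Fin n, numer σ z τ (s (evenPos k)) (s (oddPos k))) *
        ∏ i : Fin (2 * n), ∏ j ∈ (Finset.Ioi i).filter (fun j => ¬ IsPaired s i j),
          prefactor σ z τ i j)

/-! ### Agreement of `P` with the defining formula -/

lemma mulVar_ne_zero {m : ℕ} (z : Fin m → ℂ) (j : Fin m) : mulVar z j ≠ 0 := Complex.exp_ne_zero _

lemma nomePow_ne_zero (τ : ℍ) (a : ℚ) : nomePow τ a ≠ 0 := Complex.exp_ne_zero _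

lemma nomePow_add (τ : ℍ) (a b : ℚ) : nomePow τ (a + b) = nomePow τ a * nomePow τ b := by
  unfold nomePow
  rw [← Complex.exp_add]
  congr 1
  push_cast
  ring

lemma norm_nomePow_lt_one (τ : ℍ) {a : ℚ} (ha : 0 < a) : ‖nomePow τ a‖ < 1 := by
  unfold nomePow
  rw [Complex.norm_exp, Real.exp_lt_one_iff]
  have h1 : (0 : ℝ) < (a : ℝ) := by exact_mod_cast ha
  have h2 : (Real.pi * Complex.I * (τ : ℂ) * (a : ℂ)).re = -(Real.pi * τ.im * (a : ℝ)) := by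
    have : ((a : ℚ) : ℂ) = (((a : ℝ)) : ℂ) := by push_cast; rfl
    rw [this]
    simp [Complex.mul_re, Complex.mul_im]
  rw [h2]
  have := mul_pos (mul_pos Real.pi_pos τ.im_pos) h1
  linarith

lemma qPoch_shift (a : ℂ) {q : ℂ} (hq : ‖q‖ < 1) : qPoch a q = (1 - a) * qPoch (a * q) q := by
  have hm : Multipliable (fun j : ℕ => 1 - (a * q) * q ^ j) := by
    have hs : Summable (fun j : ℕ => -((a * q) * q ^ j)) :=
      ((summable_geometric_of_norm_lt_one hq).mul_left (a * q)).neg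
    simpa [sub_eq_add_neg] using Complex.multipliable_one_add_of_summable hs
  unfold qPoch
  rw [tprod_eq_zero_mul' (f := fun j : ℕ => 1 - a * q ^ j)]
  · simp only [pow_zero, mul_one]
    congr 1
    refine tprod_congr fun j => ?_
    ring
  · refine hm.congr fun j => ?_
    ring

lemma theta_inv {y q : ℂ} (hy : y ≠ 0) (hq : ‖q‖ < 1) : theta y⁻¹ q = -y⁻¹ * theta y q := by
  unfold theta
  rw [qPoch_shift y⁻¹ hq, qPoch_shift y hq]
  have h1 : y⁻¹ * q = q / y := by field_simp
  have h2 : q / y⁻¹ = y * q := by field_simp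
  rw [h1, h2]
  field_simp
  ring

lemma theta_mid (r y : ℂ) (hy : y ≠ 0) (hr : r ≠ 0) : theta (r * y⁻¹) (r * r) = theta (r * y) (r * r) := by
  unfold theta
  have h1 : r * r / (r * y⁻¹) = r * y := by field_simp
  have h2 : r * r / (r * y) = r * y⁻¹ := by field_simp
  rw [h1, h2, mul_comm]

lemma prefactor_symm (σ : Label) {m : ℕ} (z : Fin m → ℂ) (τ : ℍ) (i j : Fin m) :
    prefactor σ z τ i j = prefactor σ z τ j i := by
  have hi := mulVar_ne_zero z i
  have hj := mulVar_ne_zero z j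
  have hA : ∀ k : ℕ, mulVar z i ^ k / mulVar z j ^ k = (mulVar z j ^ k / mulVar z i ^ k)⁻¹ := by
    intro k
    rw [inv_div]
  have h23 : nomePow τ (2 / 3) = nomePow τ (1 / 3) * nomePow τ (1 / 3) := by
    rw [← nomePow_add]; norm_num
  have h6 : nomePow τ 6 = nomePow τ 3 * nomePow τ 3 := by
    rw [← nomePow_add]; norm_num
  have n6 : ‖nomePow τ 6‖ < 1 := norm_nomePow_lt_one τ (by norm_num)
  have n23 : ‖nomePow τ (2 / 3)‖ < 1 := norm_nomePow_lt_one τ (by norm_num)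
  cases σ <;> simp only [prefactor]
  · rw [hA 2, h23, theta_mid _ _ (by positivity) (nomePow_ne_zero _ _)]
  · rw [hA 6, ← inv_neg, theta_inv (by simp [hi, hj]) n6]
    field_simp
  · rw [hA 6, h6, theta_mid _ _ (by positivity) (nomePow_ne_zero _ _)]
  · rw [hA 2, ← inv_neg, theta_inv (by simp [hi, hj]) n23]
    field_simp
  · rw [hA 6, h6, theta_mid _ _ (by positivity) (nomePow_ne_zero _ _)]
  · rw [hA 2, h23, theta_mid _ _ (by positivity) (nomePow_ne_zero _ _)]

lemma entry_eq (σ : Label) {m : ℕ} (z : Fin m → ℂ) (τ : ℍ) (i j : Fin m) :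
    entry σ z τ i j = numer σ z τ i j / prefactor σ z τ i j := by
  have hi := mulVar_ne_zero z i
  have hj := mulVar_ne_zero z j
  cases σ <;> simp only [entry, numer, prefactor]
  · rw [mul_div_mul_comm, mul_div_assoc]
  · rw [mul_div_mul_comm, mul_div_mul_comm]
    congr 1
    field_simp
  · rw [mul_div_mul_comm, mul_div_assoc]
  · rw [mul_div_mul_comm, mul_div_mul_comm]
    congr 1
    field_simp
  · rw [mul_div_mul_comm, mul_div_assoc]
  · rw [mul_div_mul_comm, mul_div_assoc]

lemma evenPos_inj {n : ℕ} {k l : Fin n} (h : evenPos k = evenPos l) : k = l := by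
  simp only [evenPos, Fin.mk.injEq] at h
  omega

lemma oddPos_inj {n : ℕ} {k l : Fin n} (h : oddPos k = oddPos l) : k = l := by
  simp only [oddPos, Fin.mk.injEq] at h
  omega

lemma evenPos_ne_oddPos {n : ℕ} (k l : Fin n) : evenPos k ≠ oddPos l := by
  simp only [evenPos, oddPos, ne_eq, Fin.mk.injEq]
  omega

open Classical in
lemma prod_pairs_split {n : ℕ} (s : Equiv.Perm (Fin (2 * n))) (W : Fin (2 * n) → Fin (2 * n) → ℂ)
    (hW : ∀ i j, W i j = W j i) :
    (∏ i : Fin (2 * n), ∏ j ∈ Finset.Ioi i, W i j) =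
      (∏ k : Fin n, W (s (evenPos k)) (s (oddPos k))) *
        ∏ i : Fin (2 * n), ∏ j ∈ (Finset.Ioi i).filter (fun j => ¬ IsPaired s i j), W i j := by
  have h1 : (∏ i : Fin (2 * n), ∏ j ∈ Finset.Ioi i, W i j) =
      (∏ i : Fin (2 * n), ∏ j ∈ (Finset.Ioi i).filter (fun j => IsPaired s i j), W i j) *
      ∏ i : Fin (2 * n), ∏ j ∈ (Finset.Ioi i).filter (fun j => ¬ IsPaired s i j), W i j := by
    rw [← Finset.prod_mul_distrib]
    refine Finset.prod_congr rfl fun i _ => ?_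
    rw [Finset.prod_filter_mul_prod_filter_not]
  rw [h1]
  congr 1
  rw [Finset.prod_sigma']
  symm
  have hne : ∀ k : Fin n, s (evenPos k) ≠ s (oddPos k) := fun k h =>
    evenPos_ne_oddPos k k (s.injective h)
  refine Finset.prod_bij
    (fun k _ => (⟨min (s (evenPos k)) (s (oddPos k)), max (s (evenPos k)) (s (oddPos k))⟩ :
      (_ : Fin (2 * n)) × Fin (2 * n))) ?_ ?_ ?_ ?_
  · intro k _
    rcases lt_or_gt_of_ne (hne k) with h | h
    · simp only [min_eq_left h.le, max_eq_right h.le, Finset.mem_sigma, Finset.mem_univ,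
        Finset.mem_filter, Finset.mem_Ioi, true_and]
      exact ⟨h, k, Or.inl ⟨rfl, rfl⟩⟩
    · simp only [min_eq_right h.le, max_eq_left h.le, Finset.mem_sigma, Finset.mem_univ,
        Finset.mem_filter, Finset.mem_Ioi, true_and]
      exact ⟨h, k, Or.inr ⟨rfl, rfl⟩⟩
  · intro k _ l _ h
    have e1 : min (s (evenPos k)) (s (oddPos k)) = min (s (evenPos l)) (s (oddPos l)) :=
      congrArg Sigma.fst h
    have e2 : s (evenPos k) = s (evenPos l) ∨ s (evenPos k) = s (oddPos l) ∨
        s (oddPos k) = s (evenPos l) ∨ s (oddPos k) = s (oddPos l) := by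
      rcases min_choice (s (evenPos k)) (s (oddPos k)) with a | a <;>
      rcases min_choice (s (evenPos l)) (s (oddPos l)) with b | b <;>
      rw [a, b] at e1 <;> tauto
    rcases e2 with e | e | e | e
    · exact evenPos_inj (s.injective e)
    · exact absurd (s.injective e) (evenPos_ne_oddPos _ _)
    · exact absurd (s.injective e).symm (evenPos_ne_oddPos _ _)
    · exact oddPos_inj (s.injective e)
  · rintro ⟨i, j⟩ hij
    simp only [Finset.mem_sigma, Finset.mem_univ, Finset.mem_filter, Finset.mem_Ioi,
      true_and] at hij
    obtain ⟨hlt, k, ⟨a, b⟩ | ⟨a, b⟩⟩ := hij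
    · exact ⟨k, Finset.mem_univ _, by rw [a, b, min_eq_left hlt.le, max_eq_right hlt.le]⟩
    · exact ⟨k, Finset.mem_univ _, by rw [a, b, min_eq_right hlt.le, max_eq_left hlt.le]⟩
  · intro k _
    rcases lt_or_gt_of_ne (hne k) with h | h
    · simp only [min_eq_left h.le, max_eq_right h.le]
    · simp only [min_eq_right h.le, max_eq_left h.le]
      exact hW _ _

open Classical in
/-- `P_n^{(σ)}` is given by its defining formula wherever no denominator vanishes. -/
theorem P_eq_formulaP (σ : Label) (n : ℕ) (z : Fin (2 * n) → ℂ) (τ : ℍ)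
    (h : ∀ i j, i < j → prefactor σ z τ i j ≠ 0) : P σ n z τ = formulaP σ n z τ := by
  have h' : ∀ i j, i ≠ j → prefactor σ z τ i j ≠ 0 := by
    intro i j hij
    rcases lt_or_gt_of_ne hij with hl | hl
    · exact h i j hl
    · rw [prefactor_symm]
      exact h j i hl
  unfold P formulaP pfaffian
  have hterm : ∀ s : Equiv.Perm (Fin (2 * n)),
      (∏ k : Fin n, numer σ z τ (s (evenPos k)) (s (oddPos k))) *
        (∏ i : Fin (2 * n), ∏ j ∈ (Finset.Ioi i).filter (fun j => ¬ IsPaired s i j),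
          prefactor σ z τ i j) =
      (∏ i : Fin (2 * n), ∏ j ∈ Finset.Ioi i, prefactor σ z τ i j) *
        ∏ k : Fin n, entry σ z τ (s (evenPos k)) (s (oddPos k)) := by
    intro s
    have hnum : (∏ k : Fin n, numer σ z τ (s (evenPos k)) (s (oddPos k))) =
        (∏ k : Fin n, prefactor σ z τ (s (evenPos k)) (s (oddPos k))) *
        ∏ k : Fin n, entry σ z τ (s (evenPos k)) (s (oddPos k)) := by
      rw [← Finset.prod_mul_distrib]
      refine Finset.prod_congr rfl fun k _ => ?_
      rw [entry_eq, mul_div_cancel₀]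
      exact h' _ _ fun e => evenPos_ne_oddPos k k (s.injective e)
    rw [hnum, prod_pairs_split s _ (fun i j => prefactor_symm σ z τ i j)]
    ring
  simp only [hterm, Matrix.of_apply]
  rw [mul_left_comm (∏ i : Fin (2 * n), ∏ j ∈ Finset.Ioi i, prefactor σ z τ i j)]
  congr 1
  rw [Finset.mul_sum]
  refine Finset.sum_congr rfl fun s _ => ?_
  ring

/-! ### Schur polynomials -/

/-- The Vandermonde product `Δ(x) = ∏_{i<j} (x_i - x_j)`. -/
def Delta {R : Type*} [CommRing R] {m : ℕ} (x : Fin m → R) : R :=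
  ∏ i : Fin m, ∏ j ∈ Finset.Ioi i, (x i - x j)

/-- The alternant `det (x_i^{λ_j + m - j})`, `1 ≤ i, j ≤ m`, as a polynomial. -/
def alternant {m : ℕ} (lam : Fin m → ℕ) : MvPolynomial (Fin m) ℂ :=
  (Matrix.of fun i j : Fin m =>
    (MvPolynomial.X i : MvPolynomial (Fin m) ℂ) ^ (lam j + (m - 1 - (j : ℕ)))).det

lemma prime_X_sub_X {m : ℕ} {i j : Fin m} (hij : i ≠ j) :
    Prime (MvPolynomial.X i - MvPolynomial.X j : MvPolynomial (Fin m) ℂ) := by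
  classical
  let f : MvPolynomial (Fin m) ℂ →ₐ[ℂ] MvPolynomial (Fin m) ℂ :=
    MvPolynomial.aeval fun k => if k = i then MvPolynomial.X i - MvPolynomial.X j
      else MvPolynomial.X k
  let g : MvPolynomial (Fin m) ℂ →ₐ[ℂ] MvPolynomial (Fin m) ℂ :=
    MvPolynomial.aeval fun k => if k = i then MvPolynomial.X i + MvPolynomial.X j
      else MvPolynomial.X k
  have hfg : f.comp g = AlgHom.id ℂ _ := by
    refine MvPolynomial.algHom_ext fun k => ?_
    by_cases hk : k = i
    · subst hk
      simp [f, g, Ne.symm hij]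
    · simp [f, g, hk]
  have hgf : g.comp f = AlgHom.id ℂ _ := by
    refine MvPolynomial.algHom_ext fun k => ?_
    by_cases hk : k = i
    · subst hk
      simp [f, g, Ne.symm hij]
    · simp [f, g, hk]
  let e : MvPolynomial (Fin m) ℂ ≃ₐ[ℂ] MvPolynomial (Fin m) ℂ := AlgEquiv.ofAlgHom f g hfg hgf
  have he : e (MvPolynomial.X i) = MvPolynomial.X i - MvPolynomial.X j := by
    simp [e, f]
  rw [← he]
  exact (MulEquiv.prime_iff e.toMulEquiv).2 MvPolynomial.X_prime

lemma X_sub_X_dvd_alternant {m : ℕ} (lam : Fin m → ℕ) {i j : Fin m} (hij : i ≠ j) :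
    (MvPolynomial.X i - MvPolynomial.X j : MvPolynomial (Fin m) ℂ) ∣ alternant lam := by
  classical
  rw [← Ideal.mem_span_singleton, ← Ideal.Quotient.eq_zero_iff_mem]
  unfold alternant
  rw [RingHom.map_det]
  refine Matrix.det_zero_of_row_eq hij ?_
  funext k
  simp only [RingHom.mapMatrix_apply, Matrix.map_apply, Matrix.of_apply, map_pow]
  congr 1
  rw [Ideal.Quotient.eq, Ideal.mem_span_singleton]

/-- The Vandermonde product divides every alternant. -/
theorem Delta_dvd_alternant {m : ℕ} (lam : Fin m → ℕ) :
    Delta (fun i => (MvPolynomial.X i : MvPolynomial (Fin m) ℂ)) ∣ alternant lam := by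
  classical
  unfold Delta
  rw [Finset.prod_sigma']
  refine Finset.prod_dvd_of_isRelPrime ?_ ?_
  · rintro ⟨i, j⟩ hij ⟨k, l⟩ hkl hne
    simp only [Finset.coe_sigma, Set.mem_sigma_iff, Finset.coe_univ, Set.mem_univ,
      Finset.coe_Ioi, Set.mem_Ioi, true_and] at hij hkl
    simp only [Function.onFun]
    refine ((prime_X_sub_X hij.ne).irreducible.isRelPrime_iff_not_dvd).2 ?_
    rintro ⟨c, hc⟩
    have key : ∀ a : Fin m, a ≠ i → a ≠ j → a = k ∨ a = l → False := by
      intro a hai haj hakl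
      have := congrArg (MvPolynomial.eval (Pi.single a (1 : ℂ))) hc
      rcases hakl with rfl | rfl
      · simp [hai.symm, haj.symm, hkl.ne'] at this
      · simp [hai.symm, haj.symm, hkl.ne] at this
    by_cases h1 : k = i ∨ k = j
    · by_cases h2 : l = i ∨ l = j
      · apply hne
        rcases h1 with rfl | rfl <;> rcases h2 with rfl | rfl
        · exact absurd hkl (lt_irrefl _)
        · rfl
        · exact absurd hkl hij.not_gt
        · exact absurd hkl (lt_irrefl _)
      · push Not at h2
        exact key l h2.1 h2.2 (Or.inr rfl)
    · push Not at h1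
      exact key k h1.1 h1.2 (Or.inl rfl)
  · rintro ⟨i, j⟩ hij
    simp only [Finset.mem_sigma, Finset.mem_univ, Finset.mem_Ioi, true_and] at hij
    exact X_sub_X_dvd_alternant lam hij.ne

/-- The Schur polynomial `s_λ(x_1, …, x_m)` of a partition `λ_1 ≥ … ≥ λ_m ≥ 0`: the quotient of
the alternant `det (x_i^{λ_j + m - j})` by the Vandermonde product. -/
def schur {m : ℕ} (lam : Fin m → ℕ) : MvPolynomial (Fin m) ℂ :=
  (Delta_dvd_alternant lam).choose

theorem Delta_mul_schur {m : ℕ} (lam : Fin m → ℕ) :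
    Delta (fun i => (MvPolynomial.X i : MvPolynomial (Fin m) ℂ)) * schur lam = alternant lam :=
  (Delta_dvd_alternant lam).choose_spec.symm

/-- The partition `(n-1, n-1, …, 1, 1, 0, 0)`. -/
def doubleStaircase (n : ℕ) (j : Fin (2 * n)) : ℕ := n - 1 - (j : ℕ) / 2

/-- The partition `(n, n-1, n-1, …, 1, 1, 0)`. -/
def shiftedStaircase (n : ℕ) (j : Fin (2 * n)) : ℕ := n - ((j : ℕ) + 1) / 2

/-! ### Leading coefficients -/

/-- `L(z) p^a` is the leading term of the Taylor expansion of `f(z; τ)` at `p = 0`: one has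
`f(z; τ) = ∑_{k ≥ 0} c_k(z) p^{k/3}`, and the first coefficient that is not identically zero as
a function of `z` is the coefficient of `p^a`, and equals `L`. -/
def IsLeadingTerm {m : ℕ} (f : (Fin m → ℂ) → ℍ → ℂ) (a : ℚ) (L : (Fin m → ℂ) → ℂ) : Prop :=
  ∃ c : ℕ → (Fin m → ℂ) → ℂ,
    (∀ z τ, HasSum (fun k : ℕ => c k z * nomePow τ ((k : ℚ) / 3)) (f z τ)) ∧
    ∃ k : ℕ, (k : ℚ) / 3 = a ∧ (∀ j < k, c j = 0) ∧ c k = L ∧ L ≠ 0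

end EllipticPfaffian

end

/-! ### Pfaffians as signed sums, and their expansion into determinants. -/

namespace EllipticPfaffian

open Finset

/-! ### Signed sums over permutations -/

/-! Put u = p^{1/3} and t = x_i/x_j. Apart from a symmetric factor E(t) = E(1/t) shared by numerator
and denominator, which leaves the pfaffian as a product over pairs (`pform_mul_mul`), each entry is,
for σ ≠ 1, (t^{-s} - t^s) A(t²) A(t^{-2}) with s = 1 or 2 and A a quotient of infinite products in
u.

For small u, A(y) looks like a power series g in u^r y, where r = 1 for σ = 0, 6, r = 2 for σ = 3
and r = 3 for σ = 2, 4. Multiplying out turns the entry into a sum of terms u^{rj} G_j(u) (t^{2j+s}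
- t^{-2j-s}) with G_j tending to minus the j-th coefficient of g (`hasExpansion_of_symbol`). Each
term is a skew-symmetric matrix of rank two, so the pfaffian expands into determinants with columns
x^m and x^{-m} (`pfaffian_sum`). Determinants with a repeated index vanish; hence the lowest power
of u comes from the n smallest weights, and the n! orderings of these cancel the factor 1/n!
(`tendsto_pfaffian`). Sorting the exponents ±m_k and clearing negative powers leaves an alternant,
that is, a Vandermonde product times e_n, a Schur polynomial or 1.

For σ = 2, 4 the series g is (1 - X²)/(1 - X³) or (1 - X)/(1 - X³). Some of its coefficients are 0,
so their limits alone would not determine the leading term. The corresponding terms, those with 3 ∣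
m, are in fact absent for every u: θ(y;q) θ(qy²;q²) contains no y^m with m ≡ 2 mod 3
(`trisection_theta`, the vanishing part of the quintuple product identity, deduced from Jacobi's
triple product by a sign-reversing involution), and the denominators depend on t^6 only. The
surviving coefficients are ±1.

For σ = 1 the limit u → 0 is already nonzero. It is a pfaffian with entries (b_i - b_j)/(a_i + a_j),
evaluated by means of Cauchy's determinant (`pform_sub_add`).

Finally, for fixed z the function P is holomorphic in u on the unit disc. A limit of P/u^N therefore
removes the singularity at 0, and the Taylor series of the quotient gives the required expansion
(`isLeadingTerm_of_tendsto`). -/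

lemma bijective_evenPos_oddPos (n : ℕ) :
    Function.Bijective (Sum.elim (evenPos (n := n)) (oddPos (n := n))) := by
  rw [Fintype.bijective_iff_injective_and_card]
  refine ⟨?_, by simp [two_mul]⟩
  rintro (a | a) (b | b) h
  · exact congrArg _ (evenPos_inj h)
  · exact absurd h (evenPos_ne_oddPos a b)
  · exact absurd h.symm (evenPos_ne_oddPos b a)
  · exact congrArg _ (oddPos_inj h)

/-- The equivalence that splits the positions into even and odd ones. -/
noncomputable def posEquiv (n : ℕ) : Fin n ⊕ Fin n ≃ Fin (2 * n) :=
  Equiv.ofBijective _ (bijective_evenPos_oddPos n)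

@[simp] lemma posEquiv_inl {n : ℕ} (k : Fin n) : posEquiv n (Sum.inl k) = evenPos k := rfl

@[simp] lemma posEquiv_inr {n : ℕ} (k : Fin n) : posEquiv n (Sum.inr k) = oddPos k := rfl

lemma prod_evenPos_oddPos {M : Type*} [CommMonoid M] {n : ℕ} (G : Fin (2 * n) → M) :
    ∏ j, G j = (∏ k, G (evenPos k)) * ∏ k, G (oddPos k) := by
  rw [← (posEquiv n).prod_comp, Fintype.prod_sum_type]
  simp

/-- The matrix whose columns `2k` and `2k + 1` are `φ k` and `ψ k`. -/
def interleave {R : Type*} {n : ℕ} (φ ψ : Fin n → Fin (2 * n) → R) :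
    Matrix (Fin (2 * n)) (Fin (2 * n)) R :=
  Matrix.of fun i j =>
    if (j : ℕ) % 2 = 0 then φ ⟨(j : ℕ) / 2, by omega⟩ i else ψ ⟨(j : ℕ) / 2, by omega⟩ i

@[simp] lemma interleave_evenPos {R : Type*} {n : ℕ} (φ ψ : Fin n → Fin (2 * n) → R)
    (i : Fin (2 * n)) (k : Fin n) : interleave φ ψ i (evenPos k) = φ k i := by
  simp [interleave, evenPos]

@[simp] lemma interleave_oddPos {R : Type*} {n : ℕ} (φ ψ : Fin n → Fin (2 * n) → R)
    (i : Fin (2 * n)) (k : Fin n) : interleave φ ψ i (oddPos k) = ψ k i := by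
  have h1 : (2 * (k : ℕ) + 1) % 2 = 1 := by omega
  have h2 : (2 * (k : ℕ) + 1) / 2 = k := by omega
  simp [interleave, oddPos, h1, h2]

/-- The sign of a permutation as a complex number. -/
abbrev sgn {α : Type*} [DecidableEq α] [Fintype α] (s : Equiv.Perm α) : ℂ :=
  ((Equiv.Perm.sign s : ℤ) : ℂ)

lemma sum_sgn_prod_eq_det {n : ℕ} (φ ψ : Fin n → Fin (2 * n) → ℂ) :
    ∑ s : Equiv.Perm (Fin (2 * n)),
      sgn s * ∏ k, (φ k (s (evenPos k)) * ψ k (s (oddPos k))) = (interleave φ ψ).det := by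
  rw [Matrix.det_apply']
  refine Finset.sum_congr rfl fun s _ => ?_
  rw [prod_evenPos_oddPos, Finset.prod_mul_distrib]
  simp

lemma sum_sgn_mul_right {α : Type*} [DecidableEq α] [Fintype α] (σ : Equiv.Perm α)
    (F : Equiv.Perm α → ℂ) :
    ∑ s, sgn s * F (s * σ) = sgn σ * ∑ s, sgn s * F s := by
  rw [Finset.mul_sum, ← Equiv.sum_comp (Equiv.mulRight σ)
    (fun s => sgn σ * (sgn s * F s))]
  refine Finset.sum_congr rfl fun s _ => ?_
  simp only [sgn, Equiv.coe_mulRight, Equiv.Perm.sign_mul]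
  rcases Int.units_eq_one_or (Equiv.Perm.sign σ) with h | h <;> simp [h]

/-- Composing s with the transposition of the two positions of a pair exchanges the two terms of one
factor and reverses the sign of s. Hence antisymmetrising each of the n factors only doubles the
signed sum. -/
lemma sum_sgn_prod_sub {n : ℕ} (F : Fin n → Fin (2 * n) → Fin (2 * n) → ℂ) :
    ∑ s : Equiv.Perm (Fin (2 * n)),
      sgn s * ∏ k, (F k (s (evenPos k)) (s (oddPos k)) - F k (s (oddPos k)) (s (evenPos k))) =
    2 ^ n * ∑ s : Equiv.Perm (Fin (2 * n)), sgn s * ∏ k, F k (s (evenPos k)) (s (oddPos k)) := by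
  classical
  -- Only the factors with index in A are antisymmetrised, so that an induction on A can treat one
  -- factor at a time.
  let Φ : Finset (Fin n) → Equiv.Perm (Fin (2 * n)) → ℂ := fun A s => ∏ k,
    if k ∈ A then F k (s (evenPos k)) (s (oddPos k)) - F k (s (oddPos k)) (s (evenPos k))
    else F k (s (evenPos k)) (s (oddPos k))
  have key : ∀ A : Finset (Fin n),
      ∑ s, sgn s * Φ A s = 2 ^ #A * ∑ s, sgn s * Φ ∅ s := by
    intro A
    induction A using Finset.induction_on with
    | empty => simp
    | insert a A ha ih =>
      have hstep : ∀ s, Φ (insert a A) s = Φ A s - Φ A (s * Equiv.swap (evenPos a) (oddPos a)) := by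
        intro s
        simp only [Φ]
        rw [← Finset.mul_prod_erase univ _ (Finset.mem_univ a),
          ← Finset.mul_prod_erase univ (fun k => if k ∈ A then _ else _) (Finset.mem_univ a),
          ← Finset.mul_prod_erase univ (fun k => if k ∈ A then
            F k ((s * Equiv.swap (evenPos a) (oddPos a)) (evenPos k)) _ - _ else _)
            (Finset.mem_univ a)]
        have h2 : ∀ k ∈ univ.erase a,
            (s * Equiv.swap (evenPos a) (oddPos a)) (evenPos k) = s (evenPos k) ∧
            (s * Equiv.swap (evenPos a) (oddPos a)) (oddPos k) = s (oddPos k) := by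
          intro k hk
          have hka : k ≠ a := Finset.ne_of_mem_erase hk
          simp only [Equiv.Perm.mul_apply]
          rw [Equiv.swap_apply_of_ne_of_ne (fun h => hka (evenPos_inj h)) (evenPos_ne_oddPos k a),
            Equiv.swap_apply_of_ne_of_ne (evenPos_ne_oddPos a k).symm (fun h => hka (oddPos_inj h))]
          exact ⟨rfl, rfl⟩
        have h3 : ∀ k ∈ univ.erase a, (k ∈ insert a A) = (k ∈ A) := by
          intro k hk
          simp [Finset.ne_of_mem_erase hk]
        rw [Finset.prod_congr (g := fun k => if k ∈ A
            then F k (s (evenPos k)) (s (oddPos k)) - F k (s (oddPos k)) (s (evenPos k))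
            else F k (s (evenPos k)) (s (oddPos k))) rfl fun k hk => by simp only [h3 k hk],
          Finset.prod_congr (f := fun k => if k ∈ A then
            F k ((s * Equiv.swap (evenPos a) (oddPos a)) (evenPos k)) _ - _ else _)
            (g := fun k => if k ∈ A
            then F k (s (evenPos k)) (s (oddPos k)) - F k (s (oddPos k)) (s (evenPos k))
            else F k (s (evenPos k)) (s (oddPos k))) rfl fun k hk => by
              simp only [(h2 k hk).1, (h2 k hk).2]]
        simp [ha]
        ring
      simp only [hstep, mul_sub, Finset.sum_sub_distrib]
      rw [sum_sgn_mul_right, ih, Finset.card_insert_of_notMem ha]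
      have : sgn (Equiv.swap (evenPos a) (oddPos a)) = -1 := by
        simp [sgn, Equiv.Perm.sign_swap (evenPos_ne_oddPos a a)]
      rw [this]
      ring
  simpa [Φ] using key univ

/-- A permutation of the pairs, as a permutation of the positions. -/
noncomputable def pairPerm {n : ℕ} (α β : Equiv.Perm (Fin n)) : Equiv.Perm (Fin (2 * n)) :=
  (posEquiv n).permCongr (Equiv.sumCongr α β)

@[simp] lemma pairPerm_evenPos {n : ℕ} (α β : Equiv.Perm (Fin n)) (k : Fin n) :
    pairPerm α β (evenPos k) = evenPos (α k) := by
  have : (posEquiv n).symm (evenPos k) = Sum.inl k := by rw [Equiv.symm_apply_eq]; rfl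
  simp [pairPerm, Equiv.permCongr_apply, this]

@[simp] lemma pairPerm_oddPos {n : ℕ} (α β : Equiv.Perm (Fin n)) (k : Fin n) :
    pairPerm α β (oddPos k) = oddPos (β k) := by
  have : (posEquiv n).symm (oddPos k) = Sum.inr k := by rw [Equiv.symm_apply_eq]; rfl
  simp [pairPerm, Equiv.permCongr_apply, this]

lemma sgn_pairPerm {n : ℕ} (α β : Equiv.Perm (Fin n)) :
    sgn (pairPerm α β) = sgn α * sgn β := by
  simp [sgn, pairPerm, Equiv.Perm.sign_permCongr, Equiv.Perm.sign_sumCongr]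

/-- Permuting the pairs of columns does not change the determinant. -/
lemma det_interleave_comp {n : ℕ} (φ ψ : Fin n → Fin (2 * n) → ℂ) (α : Equiv.Perm (Fin n)) :
    (interleave (fun k => φ (α k)) (fun k => ψ (α k))).det = (interleave φ ψ).det := by
  have h : interleave (fun k => φ (α k)) (fun k => ψ (α k)) =
      (interleave φ ψ).submatrix id (pairPerm α α) := by
    ext i j
    obtain ⟨k | k, rfl⟩ := (posEquiv n).surjective j <;> simp
  rw [h, Matrix.det_permute']
  have : sgn (pairPerm α α) = 1 := by
    rw [sgn_pairPerm]
    rcases Int.units_eq_one_or (Equiv.Perm.sign α) with h | h <;> simp [sgn, h]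
  rw [show (((Equiv.Perm.sign (pairPerm α α) : ℤˣ) : ℤ) : ℂ) = 1 from this, one_mul]

/-- Expansion of a pfaffian whose entries are sums of rank two skew-symmetric entries. -/
lemma pfaffian_sum {n : ℕ} {ι : Type*} [Fintype ι] [DecidableEq ι] (c : ι → ℂ)
    (φ ψ : ι → Fin (2 * n) → ℂ) :
    pfaffian (Matrix.of fun i j => ∑ k, c k * (φ k i * ψ k j - φ k j * ψ k i)) =
      1 / (n.factorial : ℂ) * ∑ κ : Fin n → ι, (∏ i, c (κ i)) *
        (interleave (fun i => φ (κ i)) (fun i => ψ (κ i))).det := by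
  unfold pfaffian
  have h1 : ∀ s : Equiv.Perm (Fin (2 * n)),
      ∏ k : Fin n, (Matrix.of fun i j => ∑ k, c k * (φ k i * ψ k j - φ k j * ψ k i))
        (s (evenPos k)) (s (oddPos k)) =
      ∑ κ : Fin n → ι, (∏ i, c (κ i)) * ∏ k : Fin n,
        (φ (κ k) (s (evenPos k)) * ψ (κ k) (s (oddPos k)) -
          φ (κ k) (s (oddPos k)) * ψ (κ k) (s (evenPos k))) := by
    intro s
    simp only [Matrix.of_apply]
    rw [Finset.prod_univ_sum, Fintype.piFinset_univ]
    refine Finset.sum_congr rfl fun κ _ => ?_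
    rw [Finset.prod_mul_distrib]
  simp only [h1, Finset.mul_sum]
  rw [Finset.sum_comm]
  refine Finset.sum_congr rfl fun κ _ => ?_
  -- The factor 2^n that arises here cancels the one in the definition of the pfaffian.
  have h2 := sum_sgn_prod_sub (fun k i j => φ (κ k) i * ψ (κ k) j)
  rw [sum_sgn_prod_eq_det (fun k => φ (κ k)) (fun k => ψ (κ k))] at h2
  have h3 : ∀ s : Equiv.Perm (Fin (2 * n)), (1 / (2 ^ n * (n.factorial : ℂ))) *
      (sgn s * ((∏ i, c (κ i)) * ∏ k : Fin n,
        (φ (κ k) (s (evenPos k)) * ψ (κ k) (s (oddPos k)) -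
          φ (κ k) (s (oddPos k)) * ψ (κ k) (s (evenPos k))))) =
      ((1 / (2 ^ n * (n.factorial : ℂ))) * (∏ i, c (κ i))) * (sgn s * ∏ k : Fin n,
        (φ (κ k) (s (evenPos k)) * ψ (κ k) (s (oddPos k)) -
          φ (κ k) (s (oddPos k)) * ψ (κ k) (s (evenPos k)))) := by
    intro s
    ring
  rw [Finset.sum_congr rfl fun s _ => h3 s, ← Finset.mul_sum, h2]
  have : (n.factorial : ℂ) ≠ 0 := by exact_mod_cast n.factorial_ne_zero
  field_simp

lemma det_interleave_eq_zero {n : ℕ} (φ ψ : Fin n → Fin (2 * n) → ℂ) {a b : Fin n} (hab : a ≠ b)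
    (h : φ a = φ b) : (interleave φ ψ).det = 0 :=
  Matrix.det_zero_of_column_eq (fun e => hab (evenPos_inj e)) fun i => by simp [h]

end EllipticPfaffian

/-! ### Pfaffians without denominators, and the evaluation that settles σ = 1. -/

namespace EllipticPfaffian

open Finset

/-! ### Pfaffians with cleared denominators -/

open Classical in
/-- The pfaffian of `N i j / W i j` multiplied by `∏_{i<j} W i j`, with the denominators
cancelled. -/
noncomputable def pform {n : ℕ} (N W : Fin (2 * n) → Fin (2 * n) → ℂ) : ℂ :=
  (1 / (2 ^ n * (n.factorial : ℂ))) *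
    ∑ s : Equiv.Perm (Fin (2 * n)), ((Equiv.Perm.sign s : ℤ) : ℂ) *
      ((∏ k : Fin n, N (s (evenPos k)) (s (oddPos k))) *
        ∏ i : Fin (2 * n), ∏ j ∈ (Finset.Ioi i).filter (fun j => ¬ IsPaired s i j), W i j)

lemma P_eq_pform (σ : Label) (n : ℕ) (z : Fin (2 * n) → ℂ) (τ : ℍ) :
    P σ n z τ = pform (numer σ z τ) (prefactor σ z τ) := rfl

lemma pform_congr {n : ℕ} {N N' W W' : Fin (2 * n) → Fin (2 * n) → ℂ} (hN : ∀ i j, N i j = N' i j)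
    (hW : ∀ i j, W i j = W' i j) : pform N W = pform N' W' := by
  rw [show N = N' from funext₂ hN, show W = W' from funext₂ hW]

/-- In every term each unordered pair of indices occurs exactly once, in `N` if it is matched and in
`W` otherwise. Therefore a common factor `E` comes out, even where it vanishes. -/
lemma pform_mul_mul {n : ℕ} (E N W : Fin (2 * n) → Fin (2 * n) → ℂ) (hE : ∀ i j, E i j = E j i) :
    pform (fun i j => E i j * N i j) (fun i j => E i j * W i j) =
      (∏ i, ∏ j ∈ Ioi i, E i j) * pform N W := by
  classical
  unfold pform
  rw [mul_left_comm, Finset.mul_sum (a := ∏ i, ∏ j ∈ Ioi i, E i j)]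
  congr 1
  refine Finset.sum_congr rfl fun s _ => ?_
  rw [prod_pairs_split s E hE]
  simp only [Finset.prod_mul_distrib]
  ring

/-- Every index belongs to exactly one matched pair. -/
lemma pform_mul_left {n : ℕ} (v : Fin (2 * n) → ℂ) (N W : Fin (2 * n) → Fin (2 * n) → ℂ) :
    pform (fun i j => v i * v j * N i j) W = (∏ i, v i) * pform N W := by
  unfold pform
  rw [mul_left_comm, Finset.mul_sum (a := ∏ i, v i)]
  congr 1
  refine Finset.sum_congr rfl fun s _ => ?_
  rw [← Equiv.prod_comp s v, prod_evenPos_oddPos (fun i => v (s i))]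
  simp only [Finset.prod_mul_distrib]
  ring

lemma pform_const_mul_left {n : ℕ} (c : ℂ) (N W : Fin (2 * n) → Fin (2 * n) → ℂ) :
    pform (fun i j => c * N i j) W = c ^ n * pform N W := by
  unfold pform
  rw [mul_left_comm, Finset.mul_sum (a := c ^ n)]
  congr 1
  refine Finset.sum_congr rfl fun s _ => ?_
  simp only [Finset.prod_mul_distrib, Finset.prod_const, Finset.card_univ, Fintype.card_fin]
  ring

lemma pform_eq_pfaffian {n : ℕ} (N W : Fin (2 * n) → Fin (2 * n) → ℂ)
    (hW : ∀ i j, W i j = W j i) (h0 : ∀ i j, i ≠ j → W i j ≠ 0) :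
    pform N W = (∏ i, ∏ j ∈ Ioi i, W i j) * pfaffian (Matrix.of fun i j => N i j / W i j) := by
  classical
  unfold pform pfaffian
  rw [mul_left_comm, Finset.mul_sum (a := ∏ i, ∏ j ∈ Ioi i, W i j)]
  congr 1
  refine Finset.sum_congr rfl fun s _ => ?_
  rw [prod_pairs_split s W hW]
  have : ∏ k : Fin n, N (s (evenPos k)) (s (oddPos k)) =
      (∏ k : Fin n, W (s (evenPos k)) (s (oddPos k))) *
        ∏ k : Fin n, (Matrix.of fun i j => N i j / W i j) (s (evenPos k)) (s (oddPos k)) := by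
    rw [← Finset.prod_mul_distrib]
    refine Finset.prod_congr rfl fun k _ => ?_
    rw [Matrix.of_apply, mul_div_cancel₀ _ (h0 _ _ fun e => evenPos_ne_oddPos k k (s.injective e))]
  rw [this]
  ring

lemma tendsto_pform {n : ℕ} {α : Type*} {l : Filter α} {N W : α → Fin (2 * n) → Fin (2 * n) → ℂ}
    {N₀ W₀ : Fin (2 * n) → Fin (2 * n) → ℂ}
    (hN : ∀ i j, i ≠ j → Filter.Tendsto (fun u => N u i j) l (nhds (N₀ i j)))
    (hW : ∀ i j, i ≠ j → Filter.Tendsto (fun u => W u i j) l (nhds (W₀ i j))) :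
    Filter.Tendsto (fun u => pform (N u) (W u)) l (nhds (pform N₀ W₀)) := by
  classical
  unfold pform
  refine Filter.Tendsto.const_mul _ (tendsto_finsetSum _ fun s _ => Filter.Tendsto.const_mul _ ?_)
  refine Filter.Tendsto.mul (tendsto_finsetProd _ fun k _ => hN _ _ ?_)
    (tendsto_finsetProd _ fun i _ => tendsto_finsetProd _ fun j hj => hW _ _ ?_)
  · exact fun e => evenPos_ne_oddPos k k (s.injective e)
  · exact (Finset.mem_Ioi.1 (Finset.mem_filter.1 hj).1).ne

/-! ### Cauchy's determinant -/

/-- Subtracting from row i the multiple (a_0 + b_0)/(a_i + b_0) of row 0 clears the first column.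
The remaining entries are (a_i - a_0)(b_j - b_0) / ((a_i + b_0)(a_0 + b_j)(a_i + b_j)), a Cauchy
matrix of smaller size with scaled rows and columns. -/
lemma det_cauchy {K : Type*} [Field K] : ∀ {n : ℕ} (a b : Fin n → K) (_ : ∀ i j, a i + b j ≠ 0),
    (∏ i, ∏ j, (a i + b j)) * (Matrix.of fun i j => (a i + b j)⁻¹).det =
      (∏ i, ∏ j ∈ Ioi i, (a j - a i)) * ∏ i, ∏ j ∈ Ioi i, (b j - b i)
  | 0, a, b, h => by simp
  | n + 1, a, b, h => by
    have ih := det_cauchy (fun i => a i.succ) (fun i => b i.succ) fun i j => h _ _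
    let B : Matrix (Fin (n + 1)) (Fin (n + 1)) K := Matrix.of fun i j =>
      if i = 0 then (a 0 + b j)⁻¹
      else (a i + b j)⁻¹ - (a 0 + b 0) * (a i + b 0)⁻¹ * (a 0 + b j)⁻¹
    have h1 : (Matrix.of fun i j => (a i + b j)⁻¹).det = B.det := by
      refine Matrix.det_eq_of_forall_row_eq_smul_add_const
        (fun i => if i = 0 then 0 else (a 0 + b 0) * (a i + b 0)⁻¹) 0 (by simp) fun i j => ?_
      by_cases hi : i = 0
      · subst hi
        simp [B]
      · simp [B, hi]
    have h2 : B.det = (a 0 + b 0)⁻¹ * (Matrix.of fun i j : Fin n =>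
        ((a i.succ - a 0) * (a i.succ + b 0)⁻¹) *
          (((b j.succ - b 0) * (a 0 + b j.succ)⁻¹) * (a i.succ + b j.succ)⁻¹)).det := by
      rw [Matrix.det_succ_column_zero, Fin.sum_univ_succ]
      rw [Finset.sum_eq_zero (s := univ) (f := fun i : Fin n => _)]
      · simp only [Fin.val_zero, pow_zero, one_mul, add_zero]
        congr 1
        congr 1
        ext i j
        have e1 := h i.succ j.succ
        have e2 := h i.succ 0
        have e3 := h 0 j.succ
        simp only [B, Matrix.submatrix_apply, Matrix.of_apply, Fin.succAbove_zero, Fin.succ_ne_zero,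
          if_false]
        field_simp
        ring
      · intro i _
        have : B i.succ 0 = 0 := by
          have e1 := h 0 0
          simp only [B, Matrix.of_apply, Fin.succ_ne_zero, if_false]
          rw [mul_right_comm, mul_inv_cancel₀ e1, one_mul, sub_self]
        rw [this]
        ring
    have h3 : (Matrix.of fun i j : Fin n =>
        ((a i.succ - a 0) * (a i.succ + b 0)⁻¹) *
          (((b j.succ - b 0) * (a 0 + b j.succ)⁻¹) * (a i.succ + b j.succ)⁻¹)).det =
        (∏ i : Fin n, ((a i.succ - a 0) * (a i.succ + b 0)⁻¹)) *
        ((∏ j : Fin n, ((b j.succ - b 0) * (a 0 + b j.succ)⁻¹)) *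
          (Matrix.of fun i j : Fin n => (a i.succ + b j.succ)⁻¹).det) := by
      rw [← Matrix.det_mul_row, ← Matrix.det_mul_column]
      rfl
    rw [h1, h2, h3]
    simp only [Fin.prod_univ_succ (n := n), Fin.prod_Ioi_zero, Fin.prod_Ioi_succ,
      Finset.prod_mul_distrib]
    have e0 := h 0 0
    have f1 : (∏ i : Fin n, (a i.succ + b 0)) * ∏ i : Fin n, (a i.succ + b 0)⁻¹ = 1 := by
      rw [← Finset.prod_mul_distrib]
      exact Finset.prod_eq_one fun i _ => mul_inv_cancel₀ (h _ _)
    have f2 : (∏ i : Fin n, (a 0 + b i.succ)) * ∏ i : Fin n, (a 0 + b i.succ)⁻¹ = 1 := by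
      rw [← Finset.prod_mul_distrib]
      exact Finset.prod_eq_one fun i _ => mul_inv_cancel₀ (h _ _)
    have f3 := mul_inv_cancel₀ e0
    generalize (∏ i : Fin n, (a i.succ + b 0)) = p1 at *
    generalize (∏ i : Fin n, (a i.succ + b 0)⁻¹) = p2 at *
    generalize (∏ i : Fin n, (a 0 + b i.succ)) = p3 at *
    generalize (∏ i : Fin n, (a 0 + b i.succ)⁻¹) = p4 at *
    generalize (a 0 + b 0)⁻¹ = p6 at *
    generalize a 0 + b 0 = p5 at *
    generalize (∏ i : Fin n, (a i.succ - a 0)) = p7 at *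
    generalize (∏ i : Fin n, (b i.succ - b 0)) = p8 at *
    generalize (∏ i : Fin n, ∏ j : Fin n, (a i.succ + b j.succ)) = p9 at *
    generalize (Matrix.of fun i j : Fin n => (a i.succ + b j.succ)⁻¹).det = d at *
    generalize (∏ i : Fin n, ∏ j ∈ Ioi i, (a j.succ - a i.succ)) = q1 at *
    generalize (∏ i : Fin n, ∏ j ∈ Ioi i, (b j.succ - b i.succ)) = q2 at *
    calc _ = (p5 * p6) * (p1 * p2) * (p3 * p4) * (p7 * p8) * (p9 * d) := by ring
      _ = _ := by rw [f1, f2, f3, ih]; ring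

/-! ### Products over pairs -/

/-- Passing to unordered pairs makes the product independent of the order, so that it can be
reindexed along bijections that are not monotone. -/
lemma prod_lt_eq_prod_sym2 {α : Type*} [LinearOrder α] [Fintype α] (p : Sym2 α → ℂ) :
    ∏ x : α, ∏ y : α, (if x < y then p s(x, y) else 1) =
      ∏ e ∈ (univ : Finset α).sym2 with ¬ e.IsDiag, p e := by
  have h := Finset.sum_sym2_filter_not_isDiag (M := Additive ℂ) (univ : Finset α)
    (fun e => Additive.ofMul (p e))
  have h' := congrArg Additive.toMul h
  rw [toMul_sum, toMul_sum] at h'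
  refine Eq.trans ?_ h'.symm
  rw [← Finset.prod_product', Finset.univ_product_univ, ← Finset.prod_filter]
  refine Finset.prod_congr ?_ fun _ _ => rfl
  ext x
  simp only [mem_filter, mem_univ, true_and, mem_offDiag]
  exact ⟨fun h => ⟨h.ne, h⟩, fun h => h.2⟩

lemma prod_lt_comp_equiv {α β : Type*} [LinearOrder α] [Fintype α] [LinearOrder β] [Fintype β]
    (e : α ≃ β) (W : β → β → ℂ) (hW : ∀ x y, W x y = W y x) :
    ∏ x : α, ∏ y : α, (if x < y then W (e x) (e y) else 1) =
      ∏ x : β, ∏ y : β, (if x < y then W x y else 1) := by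
  classical
  have h1 := prod_lt_eq_prod_sym2 (α := α)
    (Sym2.lift ⟨fun x y => W (e x) (e y), fun x y => hW _ _⟩)
  have h2 := prod_lt_eq_prod_sym2 (α := β) (Sym2.lift ⟨W, hW⟩)
  simp only [Sym2.lift_mk] at h1 h2
  rw [h1, h2]
  refine Finset.prod_bij (fun x _ => x.map e) ?_ ?_ ?_ ?_
  · intro x hx
    induction x with | _ x y => simpa using hx
  · intro x _ y _ h
    exact Sym2.map.injective e.injective h
  · intro y hy
    refine ⟨y.map e.symm, ?_, ?_⟩
    · induction y with | _ x y => simpa using hy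
    · induction y with | _ x y => simp
  · intro x _
    induction x with | _ x y => rfl

lemma prod_Ioi_eq_prod_lt {m : ℕ} (W : Fin m → Fin m → ℂ) :
    ∏ i, ∏ j ∈ Ioi i, W i j = ∏ i, ∏ j, (if i < j then W i j else 1) := by
  refine Finset.prod_congr rfl fun i _ => ?_
  rw [← Finset.prod_filter]
  congr 1
  ext j
  simp

/-- The lexicographic sum of two copies of `Fin n` is carried to `Fin (2 * n)` by the even and odd
positions followed by s. Its increasing pairs are those inside either copy and all mixed ones. -/
lemma prod_pairs_evenPos_oddPos {n : ℕ} (s : Equiv.Perm (Fin (2 * n)))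
    (W : Fin (2 * n) → Fin (2 * n) → ℂ) (hW : ∀ i j, W i j = W j i) :
    ∏ i, ∏ j ∈ Ioi i, W i j =
      (∏ k, ∏ l ∈ Ioi k, W (s (evenPos k)) (s (evenPos l))) *
      (∏ k, ∏ l ∈ Ioi k, W (s (oddPos k)) (s (oddPos l))) *
      ∏ k, ∏ l, W (s (evenPos k)) (s (oddPos l)) := by
  simp only [prod_Ioi_eq_prod_lt]
  rw [← prod_lt_comp_equiv (α := Fin n ⊕ₗ Fin n) (ofLex.trans ((posEquiv n).trans s)) W hW]
  have hL : ∀ G : Fin n ⊕ₗ Fin n → ℂ,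
      ∏ x, G x = (∏ k, G (toLex (Sum.inl k))) * ∏ k, G (toLex (Sum.inr k)) := by
    intro G
    rw [← toLex.prod_comp, Fintype.prod_sum_type]
  simp only [hL]
  simp [Finset.prod_mul_distrib]
  ring

/-! ### A pfaffian evaluation -/

lemma sgn_mul_self {α : Type*} [DecidableEq α] [Fintype α] (s : Equiv.Perm α) :
    sgn s * sgn s = 1 := by
  rcases Int.units_eq_one_or (Equiv.Perm.sign s) with h | h <;> simp [sgn, h]

lemma prod_mul_prod_sub_eq_det_vandermonde {n : ℕ} (v : Fin n → ℂ) :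
    (∏ k, ∏ l ∈ Ioi k, (v k + v l)) * ∏ k, ∏ l ∈ Ioi k, (v l - v k) =
      (Matrix.vandermonde fun k => v k ^ 2).det := by
  rw [Matrix.det_vandermonde, ← Finset.prod_mul_distrib]
  refine Finset.prod_congr rfl fun k _ => ?_
  rw [← Finset.prod_mul_distrib]
  refine Finset.prod_congr rfl fun l _ => ?_
  ring

/-- Averaging over rearrangements of the odd positions turns the pfaffian into a signed sum of
Cauchy determinants, and averaging the determinant over both kinds of positions turns it into a
signed sum of products of two Vandermonde determinants in the squares. The two sums agree term by
term: ∏(a_i + a_j) splits into mixed factors, which Cauchy's formula absorbs, and factors a_k + a_l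
inside each half, which together with a_l - a_k give differences of squares. -/
lemma prod_add_mul_pfaffian {n : ℕ} (a b : Fin (2 * n) → ℂ) (h : ∀ i j, i ≠ j → a i + a j ≠ 0) :
    (∏ i, ∏ j ∈ Ioi i, (a i + a j)) *
        pfaffian (Matrix.of fun i j => (b i - b j) / (a i + a j)) =
      (interleave (fun (k : Fin n) i => b i * (a i ^ 2) ^ (k : ℕ))
        (fun (k : Fin n) i => (a i ^ 2) ^ (k : ℕ))).det := by
  have hn : (n.factorial : ℂ) ≠ 0 := by exact_mod_cast n.factorial_ne_zero
  have hcard : ((Fintype.card (Equiv.Perm (Fin n)) : ℕ) : ℂ) = n.factorial := by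
    rw [Fintype.card_perm, Fintype.card_fin]
  have hne : ∀ (s : Equiv.Perm (Fin (2 * n))) (k l : Fin n),
      a (s (oddPos k)) + a (s (evenPos l)) ≠ 0 := fun s k l =>
    h _ _ fun e => evenPos_ne_oddPos l k (s.injective e).symm
  obtain ⟨S, hSdef⟩ : ∃ S, S = ∑ s : Equiv.Perm (Fin (2 * n)), sgn s *
    ∏ k : Fin n, (b (s (evenPos k)) * (a (s (oddPos k)) + a (s (evenPos k)))⁻¹) := ⟨_, rfl⟩
  have hpf : pfaffian (Matrix.of fun i j => (b i - b j) / (a i + a j)) =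
      1 / (n.factorial : ℂ) * S := by
    have := sum_sgn_prod_sub (n := n) fun _ i j => b i * (a j + a i)⁻¹
    rw [← hSdef] at this
    have e : ∀ i j, (b i - b j) / (a i + a j) = b i * (a j + a i)⁻¹ - b j * (a i + a j)⁻¹ := by
      intro i j
      rw [add_comm (a j), div_eq_mul_inv]
      ring
    unfold pfaffian
    simp only [Matrix.of_apply, e]
    rw [this]
    field_simp
  -- Substituting s ∘ `pairPerm 1 β` for s costs the sign of β. Summation over β then assembles a
  -- determinant.
  have hS : ∀ β : Equiv.Perm (Fin n), S = ∑ s : Equiv.Perm (Fin (2 * n)),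
      sgn s * ((∏ k, b (s (evenPos k))) *
        (sgn β * ∏ k, (a (s (oddPos (β k))) + a (s (evenPos k)))⁻¹)) := by
    intro β
    have := sum_sgn_mul_right (pairPerm 1 β) fun s : Equiv.Perm (Fin (2 * n)) =>
      ∏ k : Fin n, (b (s (evenPos k)) * (a (s (oddPos k)) + a (s (evenPos k)))⁻¹)
    rw [← hSdef, sgn_pairPerm] at this
    simp only [Equiv.Perm.mul_apply, pairPerm_evenPos, pairPerm_oddPos, Equiv.Perm.one_apply,
      Finset.prod_mul_distrib] at this
    have h2 : S = sgn β * (sgn (1 : Equiv.Perm (Fin n)) * sgn β * S) := by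
      rw [show sgn (1 : Equiv.Perm (Fin n)) = 1 by simp [sgn], one_mul, ← mul_assoc,
        sgn_mul_self, one_mul]
    rw [h2, ← this, Finset.mul_sum]
    refine Finset.sum_congr rfl fun s _ => ?_
    ring
  have hnS : (n.factorial : ℂ) * S = ∑ s : Equiv.Perm (Fin (2 * n)),
      sgn s * ((∏ k, b (s (evenPos k))) * (Matrix.of fun k l : Fin n =>
        (a (s (oddPos k)) + a (s (evenPos l)))⁻¹).det) := by
    have : (n.factorial : ℂ) * S = ∑ β : Equiv.Perm (Fin n), S := by
      rw [Finset.sum_const, Finset.card_univ, nsmul_eq_mul, hcard]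
    rw [this, Finset.sum_congr rfl fun β _ => hS β, Finset.sum_comm]
    refine Finset.sum_congr rfl fun s _ => ?_
    rw [← Finset.mul_sum, ← Finset.mul_sum, Matrix.det_apply']
    rfl
  obtain ⟨D, hD⟩ : ∃ D, D = (interleave (fun (k : Fin n) i => b i * (a i ^ 2) ^ (k : ℕ))
        (fun (k : Fin n) i => (a i ^ 2) ^ (k : ℕ))).det := ⟨_, rfl⟩
  have hDαβ : ∀ α β : Equiv.Perm (Fin n), D = ∑ s : Equiv.Perm (Fin (2 * n)),
      sgn s * ((∏ k, b (s (evenPos k))) *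
        ((sgn β * ∏ k : Fin n, (a (s (oddPos (β k))) ^ 2) ^ (k : ℕ)) *
        (sgn α * ∏ k : Fin n, (a (s (evenPos (α k))) ^ 2) ^ (k : ℕ)))) := by
    intro α β
    have := sum_sgn_mul_right (pairPerm α β) fun s : Equiv.Perm (Fin (2 * n)) =>
      ∏ k : Fin n, ((b (s (evenPos k)) * (a (s (evenPos k)) ^ 2) ^ (k : ℕ)) *
        (a (s (oddPos k)) ^ 2) ^ (k : ℕ))
    rw [sum_sgn_prod_eq_det (fun (k : Fin n) i => b i * (a i ^ 2) ^ (k : ℕ))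
        (fun (k : Fin n) i => (a i ^ 2) ^ (k : ℕ)), ← hD, sgn_pairPerm] at this
    simp only [Equiv.Perm.mul_apply, pairPerm_evenPos, pairPerm_oddPos,
      Finset.prod_mul_distrib] at this
    have h2 : D = sgn α * sgn β * (sgn α * sgn β * D) := by
      linear_combination (- D) * sgn_mul_self α - sgn α * sgn α * D * sgn_mul_self β
    rw [h2, ← this, Finset.mul_sum]
    refine Finset.sum_congr rfl fun s _ => ?_
    rw [Equiv.prod_comp α (fun k => b (s (evenPos k)))]
    ring
  have hnD : (n.factorial : ℂ) * (n.factorial * D) = ∑ s : Equiv.Perm (Fin (2 * n)),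
      sgn s * ((∏ k, b (s (evenPos k))) *
        ((Matrix.vandermonde fun k => a (s (oddPos k)) ^ 2).det *
          (Matrix.vandermonde fun k => a (s (evenPos k)) ^ 2).det)) := by
    have : (n.factorial : ℂ) * (n.factorial * D) =
        ∑ β : Equiv.Perm (Fin n), ∑ α : Equiv.Perm (Fin n), D := by
      simp only [Finset.sum_const, Finset.card_univ, nsmul_eq_mul, hcard]
    rw [this, Finset.sum_congr rfl fun β _ => Finset.sum_congr rfl fun α _ => hDαβ α β]
    rw [Finset.sum_congr rfl fun β _ => Finset.sum_comm, Finset.sum_comm]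
    refine Finset.sum_congr rfl fun s _ => ?_
    simp only [← Finset.mul_sum]
    rw [← Finset.sum_mul, Matrix.det_apply', Matrix.det_apply']
    rfl
  rw [← hD, hpf]
  have hfin : (∏ i, ∏ j ∈ Ioi i, (a i + a j)) * ((n.factorial : ℂ) * S) =
      (n.factorial : ℂ) * (n.factorial * D) := by
    rw [hnS, hnD, Finset.mul_sum]
    refine Finset.sum_congr rfl fun s _ => ?_
    rw [prod_pairs_evenPos_oddPos s (fun i j => a i + a j) fun i j => add_comm _ _]
    have hc := det_cauchy (fun k => a (s (oddPos k))) (fun k => a (s (evenPos k))) (hne s)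
    rw [← prod_mul_prod_sub_eq_det_vandermonde, ← prod_mul_prod_sub_eq_det_vandermonde]
    have hcomm : ∏ k, ∏ l, (a (s (evenPos k)) + a (s (oddPos l))) =
        ∏ k, ∏ l, (a (s (oddPos k)) + a (s (evenPos l))) := by
      rw [Finset.prod_comm]
      simp only [add_comm]
    rw [hcomm]
    linear_combination (sgn s * (∏ k, b (s (evenPos k))) *
      (∏ k, ∏ l ∈ Ioi k, (a (s (evenPos k)) + a (s (evenPos l)))) *
      (∏ k, ∏ l ∈ Ioi k, (a (s (oddPos k)) + a (s (oddPos l))))) * hc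
  have hfin' := mul_left_cancel₀ hn ((mul_left_comm _ _ _).trans hfin)
  field_simp
  linear_combination hfin'

/-- The pfaffian of `(b i - b j) / (a i + a j)`, with cleared denominators. -/
theorem pform_sub_add {n : ℕ} (a b : Fin (2 * n) → ℂ) :
    pform (fun i j => b i - b j) (fun i j => a i + a j) =
      (interleave (fun (k : Fin n) i => b i * (a i ^ 2) ^ (k : ℕ))
        (fun (k : Fin n) i => (a i ^ 2) ^ (k : ℕ))).det := by
  -- Shifting all a_i by a small ε ≠ 0 makes every denominator nonzero. Both sides are continuous in
  -- ε, so the identity survives at ε = 0.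
  have hev : ∀ᶠ ε : ℂ in nhdsWithin 0 {0}ᶜ, ∀ i j, i ≠ j → (a i + ε) + (a j + ε) ≠ 0 := by
    simp only [Filter.eventually_all]
    intro i j _
    by_cases h0 : a i + a j = 0
    · filter_upwards [self_mem_nhdsWithin] with ε hε h
      exact hε (by simpa using (by linear_combination h / 2 - h0 / 2 : ε = 0))
    · refine Filter.Eventually.filter_mono nhdsWithin_le_nhds ?_
      have : ContinuousAt (fun ε : ℂ => (a i + ε) + (a j + ε)) 0 := by fun_prop
      exact this.eventually_ne (by simpa using h0)
  have h1 : Filter.Tendsto (fun ε : ℂ => pform (fun i j => b i - b j)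
      (fun i j => (a i + ε) + (a j + ε))) (nhdsWithin 0 {0}ᶜ)
      (nhds (pform (fun i j => b i - b j) (fun i j => a i + a j))) := by
    refine tendsto_pform (fun i j _ => tendsto_const_nhds) fun i j _ => ?_
    refine Filter.Tendsto.mono_left ?_ nhdsWithin_le_nhds
    have : ContinuousAt (fun ε : ℂ => (a i + ε) + (a j + ε)) 0 := by fun_prop
    simpa [ContinuousAt] using this
  have h2 : Filter.Tendsto (fun ε : ℂ => (interleave
      (fun (k : Fin n) i => b i * ((a i + ε) ^ 2) ^ (k : ℕ))
        (fun (k : Fin n) i => ((a i + ε) ^ 2) ^ (k : ℕ))).det) (nhdsWithin 0 {0}ᶜ)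
      (nhds (interleave (fun (k : Fin n) i => b i * (a i ^ 2) ^ (k : ℕ))
        (fun (k : Fin n) i => (a i ^ 2) ^ (k : ℕ))).det) := by
    refine Filter.Tendsto.mono_left ?_ nhdsWithin_le_nhds
    have : Continuous (fun ε : ℂ => (interleave
      (fun (k : Fin n) i => b i * ((a i + ε) ^ 2) ^ (k : ℕ))
        (fun (k : Fin n) i => ((a i + ε) ^ 2) ^ (k : ℕ))).det) := by
      refine Continuous.matrix_det (continuous_matrix fun i j => ?_)
      obtain ⟨k | k, rfl⟩ := (posEquiv n).surjective j <;> simp <;> fun_prop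
    simpa using this.tendsto 0
  refine tendsto_nhds_unique (h1.congr' ?_) h2
  filter_upwards [hev] with ε hε
  rw [pform_eq_pfaffian _ _ (fun i j => add_comm _ _) hε, ← prod_add_mul_pfaffian _ _ hε]

end EllipticPfaffian

/-! ### Alternants, and the determinants with columns x^m and x^{-m}. -/

namespace EllipticPfaffian

open Finset

/-! ### Alternants -/

/-- The value of the alternant `det (y_i^{λ_j + m - j})`. -/
noncomputable def altDet {m : ℕ} (lam : Fin m → ℕ) (y : Fin m → ℂ) : ℂ :=
  (Matrix.of fun i j : Fin m => y i ^ (lam j + (m - 1 - (j : ℕ)))).det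

lemma Delta_mul_eval_schur {m : ℕ} (lam : Fin m → ℕ) (y : Fin m → ℂ) :
    Delta y * MvPolynomial.eval y (schur lam) = altDet lam y := by
  have h := congrArg (MvPolynomial.eval y) (Delta_mul_schur lam)
  rw [map_mul] at h
  unfold alternant at h
  rw [RingHom.map_det] at h
  have h1 : MvPolynomial.eval y (Delta fun i => MvPolynomial.X i) = Delta y := by
    simp [Delta, map_prod]
  rw [h1] at h
  rw [h, altDet]
  congr 1
  ext i j
  simp

lemma Delta_eq_det {R : Type*} [CommRing R] {m : ℕ} (y : Fin m → R) :
    Delta y = (Matrix.of fun i j : Fin m => y i ^ (m - 1 - (j : ℕ))).det := by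
  have h := Matrix.det_projVandermonde (fun _ : Fin m => (1 : R)) y
  simp only [one_mul] at h
  unfold Delta
  rw [← h]
  congr 1
  ext i j
  simp only [Matrix.of_apply, Matrix.projVandermonde_apply, one_pow, one_mul, Fin.val_rev]
  congr 1
  omega

lemma Delta_eq_altDet {m : ℕ} (y : Fin m → ℂ) : Delta y = altDet (fun _ => 0) y := by
  rw [Delta_eq_det, altDet]
  simp

/-- The alternant of the partition `(1, …, 1, 0, …, 0)`. -/
lemma Delta_mul_eval_esymm {m : ℕ} (y : Fin m → ℂ) (k : ℕ) (hk : k ≤ m) :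
    Delta y * MvPolynomial.eval y (MvPolynomial.esymm (Fin m) ℂ k) =
      altDet (fun j => if (j : ℕ) < k then 1 else 0) y := by
  -- The Vandermonde product of the m + 1 variables X, y_1, …, y_m is ∏(X - y_i) Δ(y). Comparing
  -- coefficients of X^{m-k} produces e_k on this side and, by expansion along the row of X, a
  -- single minor on the other.
  open Polynomial in
  have h1 : Delta (Fin.cons (X : ℂ[X]) fun i => C (y i) : Fin (m + 1) → ℂ[X]) =
      (∏ i, (X - C (y i))) * C (Delta y) := by
    simp [Delta, Fin.prod_univ_succ, Fin.prod_Ioi_succ, map_prod]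
  have h2 := congrArg (fun p => Polynomial.coeff p (m - k)) h1
  simp only [Polynomial.coeff_mul_C] at h2
  have h3 : (∏ i, (Polynomial.X - Polynomial.C (y i))).coeff (m - k) =
      (-1) ^ k * MvPolynomial.eval y (MvPolynomial.esymm (Fin m) ℂ k) := by
    have := Multiset.prod_X_sub_C_coeff (R := ℂ) ((univ : Finset (Fin m)).val.map y)
      (k := m - k) (by simp)
    have e : m - (m - k) = k := by omega
    simp only [Multiset.card_map, Finset.card_val, Finset.card_univ, Fintype.card_fin, e,
      Multiset.map_map] at this
    rw [show ∏ i, (Polynomial.X - Polynomial.C (y i)) = (Multiset.map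
      ((fun t => Polynomial.X - Polynomial.C t) ∘ y) univ.val).prod from rfl, this]
    congr 1
    have h4 := MvPolynomial.aeval_esymm_eq_multiset_esymm (Fin m) ℂ k y
    rw [← h4]
    simp [MvPolynomial.aeval_eq_eval]
  rw [h3, Delta_eq_det, Matrix.det_succ_row_zero] at h2
  have h5 : ∀ j : Fin (m + 1), ((Matrix.of fun i j : Fin (m + 1) =>
      (Fin.cons (Polynomial.X : Polynomial ℂ) fun i => Polynomial.C (y i) :
        Fin (m + 1) → Polynomial ℂ) i ^ (m + 1 - 1 - (j : ℕ))).submatrix Fin.succ j.succAbove).det =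
      Polynomial.C (Matrix.of fun i c : Fin m => y i ^ (m - (j.succAbove c : ℕ))).det := by
    intro j
    rw [RingHom.map_det]
    congr 1
    ext1 i c
    simp
  simp only [h5, Matrix.of_apply, Fin.cons_zero, Polynomial.finsetSum_coeff,
    Polynomial.coeff_mul_C] at h2
  rw [Finset.sum_eq_single (⟨k, by omega⟩ : Fin (m + 1))] at h2
  · have h6 : ((-1 : Polynomial ℂ) ^ k * Polynomial.X ^ (m + 1 - 1 - k)).coeff (m - k) =
        (-1) ^ k := by
      rw [show (-1 : Polynomial ℂ) ^ k = Polynomial.C ((-1) ^ k) by simp, Polynomial.coeff_C_mul,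
        Polynomial.coeff_X_pow]
      simp
    rw [h6] at h2
    have h7 : (Matrix.of fun i c : Fin m =>
        y i ^ (m - ((⟨k, by omega⟩ : Fin (m + 1)).succAbove c : ℕ))).det =
        altDet (fun j => if (j : ℕ) < k then 1 else 0) y := by
      unfold altDet
      congr 1
      ext i c
      simp only [Matrix.of_apply]
      congr 1
      -- Deleting the column of exponent m - k raises by one the exponents of the k columns before
      -- it, compared with the Vandermonde matrix in m variables.
      by_cases hc : (c : ℕ) < k
      · rw [Fin.succAbove_of_castSucc_lt _ _ (by simpa [Fin.lt_def] using hc)]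
        simp [hc]
        omega
      · rw [Fin.succAbove_of_le_castSucc _ _ (by simpa [Fin.le_def] using hc)]
        simp [hc]
        omega
    rw [h7] at h2
    have h8 : ((-1 : ℂ) ^ k) ≠ 0 := by simp
    refine mul_left_cancel₀ h8 ?_
    rw [h2]
    ring
  · intro j _ hj
    have : ((-1 : Polynomial ℂ) ^ (j : ℕ) * Polynomial.X ^ (m + 1 - 1 - (j : ℕ))).coeff (m - k) =
        0 := by
      rw [show (-1 : Polynomial ℂ) ^ (j : ℕ) = Polynomial.C ((-1) ^ (j : ℕ)) by simp,
        Polynomial.coeff_C_mul, Polynomial.coeff_X_pow, if_neg, mul_zero]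
      intro e
      apply hj
      ext
      simp only
      omega
    rw [this, zero_mul]
  · simp

/-- At the point y_i = 2^i the transposed alternant is a Vandermonde matrix whose nodes
2^{λ_j+m-1-j} are distinct. -/
lemma altDet_ne_zero {m : ℕ} (lam : Fin m → ℕ)
    (hlam : Function.Injective fun j : Fin m => lam j + (m - 1 - (j : ℕ))) :
    altDet lam (fun i => 2 ^ (i : ℕ)) ≠ 0 := by
  have : altDet lam (fun i => 2 ^ (i : ℕ)) =
      (Matrix.vandermonde fun j : Fin m => (2 : ℂ) ^ (lam j + (m - 1 - (j : ℕ)))).det := by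
    rw [← Matrix.det_transpose, altDet]
    congr 1
    ext i j
    simp [Matrix.vandermonde, ← pow_mul, mul_comm]
  rw [this, Matrix.det_vandermonde_ne_zero_iff]
  intro a b h
  refine hlam ?_
  have h' : (2 : ℂ) ^ (lam a + (m - 1 - (a : ℕ))) = 2 ^ (lam b + (m - 1 - (b : ℕ))) := h
  exact Nat.pow_right_injective le_rfl (by exact_mod_cast h')

lemma altDet_injective_of_antitone {m : ℕ} (lam : Fin m → ℕ) (hlam : Antitone lam) :
    Function.Injective fun j : Fin m => lam j + (m - 1 - (j : ℕ)) := by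
  intro a b h
  simp only at h
  rcases lt_trichotomy a b with hab | hab | hab
  · have := hlam hab.le
    have := Fin.lt_def.1 hab
    omega
  · exact hab
  · have := hlam hab.le
    have := Fin.lt_def.1 hab
    omega

lemma exists_mulVar_pow_eq {m d : ℕ} (hd : d ≠ 0) (y : Fin m → ℂ) (hy : ∀ j, y j ≠ 0) :
    ∃ z : Fin m → ℂ, ∀ j, mulVar z j ^ d = y j := by
  refine ⟨fun j => Complex.log (y j) / (d * (Real.pi * Complex.I)), fun j => ?_⟩
  unfold mulVar
  rw [← Complex.exp_nat_mul]
  have hd' : (d : ℂ) ≠ 0 := by exact_mod_cast hd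
  have hpi : (Real.pi : ℂ) ≠ 0 := by exact_mod_cast Real.pi_ne_zero
  have hI := Complex.I_ne_zero
  rw [show (d : ℂ) * (Real.pi * Complex.I * (Complex.log (y j) / (d * (Real.pi * Complex.I)))) =
    Complex.log (y j) by field_simp]
  exact Complex.exp_log (hy j)

/-! ### Sorting the columns -/

/-- The permutation of the positions that lists the even ones increasingly, followed by the odd
ones decreasingly. -/
noncomputable def sortPos (n : ℕ) : Equiv.Perm (Fin (2 * n)) :=
  Equiv.ofBijective
    (fun j => if (j : ℕ) % 2 = 0 then ⟨(j : ℕ) / 2, by omega⟩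
      else ⟨2 * n - 1 - (j : ℕ) / 2, by omega⟩) <| by
    refine Finite.injective_iff_bijective.1 fun a b h => ?_
    have ha := a.2
    have hb := b.2
    ext
    split_ifs at h <;> simp only [Fin.mk.injEq] at h <;> omega

lemma evenPos_val {n : ℕ} (k : Fin n) : (evenPos k : ℕ) = 2 * k := rfl

lemma oddPos_val {n : ℕ} (k : Fin n) : (oddPos k : ℕ) = 2 * k + 1 := rfl

lemma sortPos_val {n : ℕ} (j : Fin (2 * n)) :
    (sortPos n j : ℕ) = if (j : ℕ) % 2 = 0 then (j : ℕ) / 2 else 2 * n - 1 - (j : ℕ) / 2 := by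
  simp only [sortPos, Equiv.ofBijective_apply]
  split_ifs <;> rfl

/-- An even position starts no inversion. An odd position i forms an inversion with all later
positions, of which there are 2n - 1 - i, an even number. -/
lemma sign_sortPos (n : ℕ) : Equiv.Perm.sign (sortPos n) = 1 := by
  rw [Equiv.Perm.sign_eq_prod_prod_Ioi]
  refine Finset.prod_eq_one fun i _ => ?_
  by_cases hi : (i : ℕ) % 2 = 0
  · refine Finset.prod_eq_one fun j hj => if_pos ?_
    have hj' : (i : ℕ) < j := Fin.lt_def.1 (Finset.mem_Ioi.1 hj)
    rw [Fin.lt_def, sortPos_val, sortPos_val, if_pos hi]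
    split_ifs <;> omega
  · have : ∀ j ∈ Ioi i, (if sortPos n i < sortPos n j then (1 : ℤˣ) else -1) = -1 := by
      intro j hj
      refine if_neg ?_
      have hj' : (i : ℕ) < j := Fin.lt_def.1 (Finset.mem_Ioi.1 hj)
      rw [Fin.lt_def, sortPos_val, sortPos_val, if_neg hi]
      split_ifs <;> omega
    rw [Finset.prod_congr rfl this, Finset.prod_const, Fin.card_Ioi]
    exact Even.neg_one_pow (by rw [Nat.even_iff]; omega)

lemma det_interleave_eq_det_sorted {n : ℕ} (φ ψ : Fin n → Fin (2 * n) → ℂ) :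
    (interleave φ ψ).det = (Matrix.of fun i j : Fin (2 * n) =>
      if h : (j : ℕ) < n then φ ⟨j, h⟩ i else ψ ⟨2 * n - 1 - j, by omega⟩ i).det := by
  have h : interleave φ ψ = (Matrix.of fun i j : Fin (2 * n) =>
      if h : (j : ℕ) < n then φ ⟨j, h⟩ i else ψ ⟨2 * n - 1 - j, by omega⟩ i).submatrix id
        (sortPos n) := by
    ext i j
    obtain ⟨k | k, rfl⟩ := (posEquiv n).surjective j
    · have hv : (sortPos n (evenPos k) : ℕ) = k := by
        rw [sortPos_val, evenPos_val, if_pos (by omega)]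
        omega
      simp [hv]
    · have hv : (sortPos n (oddPos k) : ℕ) = 2 * n - 1 - k := by
        rw [sortPos_val, oddPos_val, if_neg (by omega)]
        omega
      have h2 : ¬ (2 * n - 1 - (k : ℕ) < n) := by omega
      have h3 : 2 * n - 1 - (2 * n - 1 - (k : ℕ)) = k := by omega
      simp [hv, h2, h3]
  rw [h, Matrix.det_permute', sign_sortPos]
  simp

/-- With m decreasing, the sorted columns have exponents m_0 > m_1 > … > -m_1 > -m_0. Multiplying
each row by x_i^d must turn these into the even exponents 2(λ_j + 2n - 1 - j); the two hypotheses
say so for the positive and the negative half. -/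
lemma det_interleave_pow {n : ℕ} (x : Fin (2 * n) → ℂ) (hx : ∀ i, x i ≠ 0) (m : Fin n → ℕ) (d : ℕ)
    (lam : Fin (2 * n) → ℕ)
    (h1 : ∀ j : Fin (2 * n), ∀ h : (j : ℕ) < n, m ⟨j, h⟩ + d = 2 * (lam j + (2 * n - 1 - j)))
    (h2 : ∀ j : Fin (2 * n), ∀ _ : ¬ (j : ℕ) < n,
      m ⟨2 * n - 1 - j, by omega⟩ + 2 * (lam j + (2 * n - 1 - j)) = d) :
    (interleave (fun k i => x i ^ m k) (fun k i => (x i)⁻¹ ^ m k)).det =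
      (∏ i, x i) ^ (-(d : ℤ)) * altDet lam (fun i => x i ^ 2) := by
  rw [det_interleave_eq_det_sorted, ← Finset.prod_zpow, altDet, ← Matrix.det_mul_column]
  congr 1
  ext i j
  simp only [Matrix.of_apply]
  rw [← pow_mul, ← zpow_natCast (x i) (2 * _), ← zpow_add₀ (hx i)]
  by_cases h : (j : ℕ) < n
  · have := h1 j h
    rw [dif_pos h, ← zpow_natCast]
    congr 1
    omega
  · have := h2 j h
    rw [dif_neg h, inv_pow, ← zpow_natCast, ← zpow_neg]
    congr 1
    omega

/-- The columns are arranged with the exponents `m k` in increasing order. -/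
lemma det_interleave_pow_rev {n : ℕ} (x : Fin (2 * n) → ℂ) (hx : ∀ i, x i ≠ 0) (m : ℕ → ℕ) (d : ℕ)
    (lam : Fin (2 * n) → ℕ)
    (h1 : ∀ j : Fin (2 * n), (j : ℕ) < n → m (n - 1 - j) + d = 2 * (lam j + (2 * n - 1 - j)))
    (h2 : ∀ j : Fin (2 * n), ¬ (j : ℕ) < n →
      m (j - n) + 2 * (lam j + (2 * n - 1 - j)) = d) :
    (interleave (fun (k : Fin n) i => x i ^ m k) (fun (k : Fin n) i => (x i)⁻¹ ^ m k)).det =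
      (∏ i, x i) ^ (-(d : ℤ)) * altDet lam (fun i => x i ^ 2) := by
  rw [← det_interleave_comp _ _ Fin.revPerm]
  refine det_interleave_pow x hx (fun k => m (Fin.revPerm k : Fin n)) d lam ?_ ?_
  · intro j h
    rw [← h1 j h]
    simp only [Fin.revPerm_apply, Fin.val_rev]
    congr 2
    omega
  · intro j h
    rw [← h2 j h]
    simp only [Fin.revPerm_apply, Fin.val_rev]
    congr 2
    omega

end EllipticPfaffian

/-! ### Asymptotics of infinite products as u tends to 0. -/

namespace EllipticPfaffian

open Finset Filter Topology Asymptotics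

/-! ### The function `(c u^a; u^b)_∞` -/

/-- The function `(c u^a; u^b)_∞` of `u`. -/
noncomputable def qp (c : ℂ) (a b : ℕ) (u : ℂ) : ℂ := qPoch (c * u ^ a) (u ^ b)

lemma norm_pow_lt_one {u : ℂ} (hu : ‖u‖ < 1) {b : ℕ} (hb : b ≠ 0) : ‖u ^ b‖ < 1 := by
  rw [norm_pow]
  exact pow_lt_one₀ (norm_nonneg _) hu hb

lemma qp_shift (c : ℂ) (a : ℕ) {b : ℕ} (hb : b ≠ 0) {u : ℂ} (hu : ‖u‖ < 1) :
    qp c a b u = (1 - c * u ^ a) * qp c (a + b) b u := by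
  unfold qp
  rw [qPoch_shift _ (norm_pow_lt_one hu hb), pow_add, mul_assoc]

lemma qp_zero (c : ℂ) {a : ℕ} (ha : a ≠ 0) (b : ℕ) : qp c a b 0 = 1 := by
  simp [qp, qPoch, ha]

lemma differentiableOn_qp (c : ℂ) (a : ℕ) {b : ℕ} (hb : b ≠ 0) :
    DifferentiableOn ℂ (qp c a b) (Metric.ball 0 1) := by
  intro u hu
  obtain ⟨ρ, h1, h2⟩ := exists_between (mem_ball_zero_iff.1 hu)
  have hρ : 0 ≤ ρ := (norm_nonneg u).trans h1.le
  have h := Summable.hasProdLocallyUniformlyOn_nat_one_add (K := Metric.ball (0 : ℂ) ρ)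
    (f := fun j u => -(c * u ^ a * (u ^ b) ^ j)) (u := fun j => ‖c‖ * ρ ^ j)
    Metric.isOpen_ball ((summable_geometric_of_lt_one hρ h2).mul_left _)
    (Eventually.of_forall fun j x hx => ?_) fun j => ?_
  · have hd := h.differentiableOn (Eventually.of_forall fun s => ?_) Metric.isOpen_ball
    · have hat := hd.differentiableAt (Metric.isOpen_ball.mem_nhds (mem_ball_zero_iff.2 h1))
      refine (hat.congr_of_eventuallyEq (Eventually.of_forall fun x => ?_)).differentiableWithinAt
      simp [qp, qPoch, sub_eq_add_neg]
    · fun_prop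
  · have hx' := (mem_ball_zero_iff.1 hx).le
    rw [norm_neg, norm_mul, norm_mul, mul_assoc]
    refine mul_le_mul_of_nonneg_left ?_ (norm_nonneg _)
    rw [← pow_mul, norm_pow, norm_pow, ← pow_add]
    calc ‖x‖ ^ (a + b * j) ≤ ‖x‖ ^ j := by
          refine pow_le_pow_of_le_one (norm_nonneg _) (hx'.trans h2.le) ?_
          have := Nat.le_mul_of_pos_left j (Nat.pos_of_ne_zero hb)
          omega
      _ ≤ ρ ^ j := pow_le_pow_left₀ (norm_nonneg _) hx' j
  · fun_prop

lemma tendsto_qp (c : ℂ) {a b : ℕ} (ha : a ≠ 0) (hb : b ≠ 0) :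
    Tendsto (qp c a b) (𝓝[≠] 0) (𝓝 1) := by
  have := ((differentiableOn_qp c a hb).differentiableAt
    (Metric.ball_mem_nhds 0 one_pos)).continuousAt.tendsto
  rw [qp_zero c ha] at this
  exact this.mono_left nhdsWithin_le_nhds

/-- The bound |∏(1 + x_j) - 1| ≤ exp(∑|x_j|) - 1 applies with |x_j| ≤ |c| |u|^a 2^{-j} for |u| <
1/2, and e^x - 1 ≤ x e^x makes it linear in |u|^a. -/
lemma isBigO_qp_sub_one (c : ℂ) (a : ℕ) {b : ℕ} (hb : b ≠ 0) :
    (fun u => qp c a b u - 1) =O[𝓝[≠] 0] fun u => u ^ a := by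
  refine IsBigO.of_bound (2 * ‖c‖ * Real.exp (2 * ‖c‖)) ?_
  have hev : ∀ᶠ u : ℂ in 𝓝[≠] 0, ‖u‖ < 1 / 2 := by
    refine Eventually.filter_mono nhdsWithin_le_nhds ?_
    filter_upwards [Metric.ball_mem_nhds (0 : ℂ) (by norm_num : (0 : ℝ) < 1 / 2)] with u hu
    exact mem_ball_zero_iff.1 hu
  filter_upwards [hev] with u hu
  have hu1 : ‖u‖ ≤ 1 := by linarith
  have hb2 : ∀ j : ℕ, ‖-(c * u ^ a * (u ^ b) ^ j)‖ ≤ ‖c‖ * ‖u‖ ^ a * (1 / 2) ^ j := by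
    intro j
    rw [norm_neg, norm_mul, norm_mul, norm_pow, ← pow_mul, norm_pow]
    refine mul_le_mul_of_nonneg_left ?_ (by positivity)
    calc ‖u‖ ^ (b * j) ≤ ‖u‖ ^ j := pow_le_pow_of_le_one (norm_nonneg _) hu1
          (Nat.le_mul_of_pos_left j (Nat.pos_of_ne_zero hb))
      _ ≤ _ := pow_le_pow_left₀ (norm_nonneg _) hu.le j
  have hgeo : Summable fun j : ℕ => ‖c‖ * ‖u‖ ^ a * (1 / 2 : ℝ) ^ j :=
    (summable_geometric_of_lt_one (by norm_num) (by norm_num)).mul_left _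
  have hsum : Summable fun j : ℕ => ‖-(c * u ^ a * (u ^ b) ^ j)‖ :=
    Summable.of_nonneg_of_le (fun _ => norm_nonneg _) hb2 hgeo
  have hm := (multipliable_one_add_of_summable hsum).hasProd.tendsto_prod_nat
  have hle : ‖qp c a b u - 1‖ ≤ Real.exp (2 * ‖c‖ * ‖u‖ ^ a) - 1 := by
    have hqp : qp c a b u = ∏' j : ℕ, (1 + -(c * u ^ a * (u ^ b) ^ j)) := by
      simp [qp, qPoch, sub_eq_add_neg]
    rw [hqp]
    refine le_of_tendsto ((hm.sub_const 1).norm) (Eventually.of_forall fun m => ?_)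
    refine (Finset.norm_prod_one_add_sub_one_le _ _).trans ?_
    refine sub_le_sub_right (Real.exp_le_exp.2 ?_) _
    calc ∑ j ∈ range m, ‖-(c * u ^ a * (u ^ b) ^ j)‖
        ≤ ∑ j ∈ range m, ‖c‖ * ‖u‖ ^ a * (1 / 2 : ℝ) ^ j := Finset.sum_le_sum fun j _ => hb2 j
      _ ≤ ∑' j : ℕ, ‖c‖ * ‖u‖ ^ a * (1 / 2 : ℝ) ^ j :=
          hgeo.sum_le_tsum _ fun j _ => by positivity
      _ = 2 * ‖c‖ * ‖u‖ ^ a := by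
          rw [tsum_mul_left, tsum_geometric_two]
          ring
  have hexp : ∀ x : ℝ, Real.exp x - 1 ≤ x * Real.exp x := by
    intro x
    have h1 := Real.add_one_le_exp (-x)
    have h2 := mul_le_mul_of_nonneg_right h1 (Real.exp_pos x).le
    rw [← Real.exp_add, neg_add_cancel, Real.exp_zero] at h2
    linarith
  have hle2 : 2 * ‖c‖ * ‖u‖ ^ a ≤ 2 * ‖c‖ :=
    mul_le_of_le_one_right (by positivity) (pow_le_one₀ (norm_nonneg _) hu1)
  calc ‖qp c a b u - 1‖ ≤ _ := hle.trans (hexp _)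
    _ ≤ 2 * ‖c‖ * ‖u‖ ^ a * Real.exp (2 * ‖c‖) :=
        mul_le_mul_of_nonneg_left (Real.exp_le_exp.2 hle2) (by positivity)
    _ = _ := by
        rw [norm_pow]
        ring

/-! ### Expansions in powers of `u^r y` -/

lemma isBigO_pow_pow {a b : ℕ} (h : b ≤ a) :
    (fun u : ℂ => u ^ a) =O[𝓝[≠] 0] fun u => u ^ b := by
  refine IsBigO.of_bound 1 ?_
  have : ∀ᶠ u : ℂ in 𝓝[≠] 0, ‖u‖ < 1 := by
    refine Eventually.filter_mono nhdsWithin_le_nhds ?_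
    filter_upwards [Metric.ball_mem_nhds (0 : ℂ) one_pos] with u hu
    exact mem_ball_zero_iff.1 hu
  filter_upwards [this] with u hu
  rw [norm_pow, norm_pow, one_mul]
  exact pow_le_pow_of_le_one (norm_nonneg _) hu.le h

/-- Up to `O(u^K)`, the function `A y u` is a polynomial in `u^r y` whose coefficients tend to
those of the power series `g`, as `u` tends to `0`. -/
def HasSymbolUpTo (r K : ℕ) (A : ℂ → ℂ → ℂ) (g : PowerSeries ℂ) : Prop :=
  ∃ α : ℕ → ℂ → ℂ, (∀ j, Tendsto (α j) (𝓝[≠] 0) (𝓝 (PowerSeries.coeff j g))) ∧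
    ∀ y ≠ 0, (fun u => A y u - ∑ j ∈ range K, α j u * (u ^ r * y) ^ j) =O[𝓝[≠] 0] fun u => u ^ K

lemma isBigO_mul_pow {r K n : ℕ} (hr : r ≠ 0) (hn : K ≤ n) {α : ℂ → ℂ} {a : ℂ}
    (hα : Tendsto α (𝓝[≠] 0) (𝓝 a)) (y : ℂ) :
    (fun u => α u * (u ^ r * y) ^ n) =O[𝓝[≠] 0] fun u => u ^ K := by
  have h1 : (fun u => α u * (u ^ r * y) ^ n) = fun u => (α u * y ^ n) * u ^ (r * n) := by
    funext u
    rw [mul_pow, ← pow_mul]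
    ring
  rw [h1]
  have h2 := (hα.mul_const (y ^ n)).isBigO_one ℂ
  have h3 : K ≤ r * n := hn.trans (Nat.le_mul_of_pos_left n (Nat.pos_of_ne_zero hr))
  simpa using h2.mul (isBigO_pow_pow h3)

lemma HasSymbolUpTo.congr {r K : ℕ} {A A' : ℂ → ℂ → ℂ} {g g' : PowerSeries ℂ}
    (h : HasSymbolUpTo r K A g) (hA : ∀ y, ∀ u, ‖u‖ < 1 → A' y u = A y u) (hg : g = g') :
    HasSymbolUpTo r K A' g' := by
  subst hg
  obtain ⟨α, h1, h2⟩ := h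
  refine ⟨α, h1, fun y hy => (h2 y hy).congr' ?_ EventuallyEq.rfl⟩
  refine Eventually.filter_mono nhdsWithin_le_nhds ?_
  filter_upwards [Metric.ball_mem_nhds (0 : ℂ) one_pos] with u hu
  rw [hA y u (mem_ball_zero_iff.1 hu)]

lemma hasSymbolUpTo_of_polynomial {r : ℕ} (hr : r ≠ 0) (K M : ℕ) {A : ℂ → ℂ → ℂ}
    {g : PowerSeries ℂ} (α : ℕ → ℂ → ℂ)
    (hα : ∀ j, Tendsto (α j) (𝓝[≠] 0) (𝓝 (PowerSeries.coeff j g)))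
    (hM : ∀ j, M ≤ j → ∀ u, α j u = 0)
    (hA : ∀ y ≠ 0, ∀ u, A y u = ∑ j ∈ range M, α j u * (u ^ r * y) ^ j) :
    HasSymbolUpTo r K A g := by
  refine ⟨α, hα, fun y hy => ?_⟩
  have h1 : (fun u => A y u - ∑ j ∈ range K, α j u * (u ^ r * y) ^ j) =
      fun u => ∑ j ∈ range M, α (K + j) u * (u ^ r * y) ^ (K + j) := by
    funext u
    have e1 : ∑ j ∈ range M, α j u * (u ^ r * y) ^ j =
        ∑ j ∈ range (M + K), α j u * (u ^ r * y) ^ j := by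
      rw [Finset.sum_range_add, Finset.sum_eq_zero (s := range K), add_zero]
      intro j _
      rw [hM _ (Nat.le_add_right M j), zero_mul]
    rw [hA y hy, e1, add_comm M K, Finset.sum_range_add]
    ring
  rw [h1]
  exact IsBigO.fun_sum fun j _ => isBigO_mul_pow hr (Nat.le_add_right K j) (hα _) y

lemma tendsto_sum_mul_pow {r : ℕ} (K : ℕ) {α : ℕ → ℂ → ℂ} {a : ℕ → ℂ}
    (hα : ∀ j, Tendsto (α j) (𝓝[≠] 0) (𝓝 (a j))) (y : ℂ) :
    ∃ l, Tendsto (fun u => ∑ j ∈ range K, α j u * (u ^ r * y) ^ j) (𝓝[≠] 0) (𝓝 l) := by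
  refine ⟨∑ j ∈ range K, a j * (0 ^ r * y) ^ j,
    tendsto_finsetSum _ fun j _ => (hα j).mul ?_⟩
  have : ContinuousAt (fun u : ℂ => (u ^ r * y) ^ j) 0 := by fun_prop
  exact this.tendsto.mono_left nhdsWithin_le_nhds

lemma isBigO_sum_mul_sum {r K : ℕ} (hr : r ≠ 0) {α β : ℕ → ℂ → ℂ} {a b : ℕ → ℂ}
    (hα : ∀ j, Tendsto (α j) (𝓝[≠] 0) (𝓝 (a j)))
    (hβ : ∀ j, Tendsto (β j) (𝓝[≠] 0) (𝓝 (b j))) (y : ℂ) :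
    (fun u => (∑ j ∈ range K, α j u * (u ^ r * y) ^ j) * (∑ j ∈ range K, β j u * (u ^ r * y) ^ j) -
      ∑ n ∈ range K, (∑ p ∈ antidiagonal n, α p.1 u * β p.2 u) * (u ^ r * y) ^ n) =O[𝓝[≠] 0]
        fun u => u ^ K := by
  have h : ∀ u, (∑ j ∈ range K, α j u * (u ^ r * y) ^ j) *
      (∑ j ∈ range K, β j u * (u ^ r * y) ^ j) -
      ∑ n ∈ range K, (∑ p ∈ antidiagonal n, α p.1 u * β p.2 u) * (u ^ r * y) ^ n =
      ∑ p ∈ (range K ×ˢ range K) with ¬ p.1 + p.2 < K,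
        (α p.1 u * β p.2 u) * (u ^ r * y) ^ (p.1 + p.2) := by
    intro u
    rw [Finset.sum_mul_sum, ← Finset.sum_product',
      ← Finset.sum_filter_add_sum_filter_not _ (fun p : ℕ × ℕ => p.1 + p.2 < K)]
    rw [← Finset.sum_fiberwise_of_maps_to (s := (range K ×ˢ range K).filter
      (fun p : ℕ × ℕ => p.1 + p.2 < K)) (t := range K) (g := fun p => p.1 + p.2)]
    · have e : ∀ n ∈ range K, (∑ p ∈ antidiagonal n, α p.1 u * β p.2 u) * (u ^ r * y) ^ n =
          ∑ p ∈ ((range K ×ˢ range K).filter (fun p : ℕ × ℕ => p.1 + p.2 < K)) with p.1 + p.2 = n,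
            α p.1 u * (u ^ r * y) ^ p.1 * (β p.2 u * (u ^ r * y) ^ p.2) := by
        intro n hn
        rw [Finset.sum_mul]
        refine Finset.sum_congr ?_ fun p hp => ?_
        · ext p
          simp only [HasAntidiagonal.mem_antidiagonal, mem_filter, mem_product, mem_range] at hn ⊢
          omega
        · rw [← (mem_filter.1 hp).2, pow_add]
          ring
      rw [Finset.sum_congr rfl e, add_sub_cancel_left]
      refine Finset.sum_congr rfl fun p _ => ?_
      rw [pow_add]
      ring
    · intro p hp
      exact mem_range.2 (mem_filter.1 hp).2
  simp only [h]
  refine IsBigO.fun_sum fun p hp => ?_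
  exact isBigO_mul_pow hr (not_lt.1 (mem_filter.1 hp).2) ((hα _).mul (hβ _)) y

lemma HasSymbolUpTo.isBigO_one {r K : ℕ} {A : ℂ → ℂ → ℂ} {g : PowerSeries ℂ}
    (h : HasSymbolUpTo r K A g) {y : ℂ} (hy : y ≠ 0) :
    A y =O[𝓝[≠] 0] fun _ => (1 : ℂ) := by
  obtain ⟨α, h1, h2⟩ := h
  obtain ⟨l, hl⟩ := tendsto_sum_mul_pow (r := r) K h1 y
  have h3 := ((h2 y hy).trans (by simpa using isBigO_pow_pow (Nat.zero_le K))).add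
    (hl.isBigO_one ℂ)
  simpa using h3

lemma HasSymbolUpTo.mul {r K : ℕ} (hr : r ≠ 0) {A B : ℂ → ℂ → ℂ} {g h : PowerSeries ℂ}
    (hA : HasSymbolUpTo r K A g) (hB : HasSymbolUpTo r K B h) :
    HasSymbolUpTo r K (fun y u => A y u * B y u) (g * h) := by
  have hA' := hA
  have hB' := hB
  obtain ⟨α, ha1, ha2⟩ := hA
  obtain ⟨β, hb1, hb2⟩ := hB
  refine ⟨fun n u => ∑ p ∈ antidiagonal n, α p.1 u * β p.2 u, fun n => ?_, fun y hy => ?_⟩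
  · rw [PowerSeries.coeff_mul]
    exact tendsto_finsetSum _ fun p _ => (ha1 _).mul (hb1 _)
  · have h1 := isBigO_sum_mul_sum (K := K) hr ha1 hb1 y
    have h2 := (ha2 y hy).mul (hB'.isBigO_one hy)
    obtain ⟨l, hl⟩ := tendsto_sum_mul_pow (r := r) K ha1 y
    have h3 := (hl.isBigO_one ℂ).mul (hb2 y hy)
    simp only [mul_one, one_mul] at h2 h3
    refine ((h2.add h3).add h1).congr_left fun u => ?_
    ring

lemma HasSymbolUpTo.tendsto {r K : ℕ} (hr : r ≠ 0) (hK : K ≠ 0) {A : ℂ → ℂ → ℂ}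
    {g : PowerSeries ℂ} (h : HasSymbolUpTo r K A g) {y : ℂ} (hy : y ≠ 0) :
    Tendsto (A y) (𝓝[≠] 0) (𝓝 (PowerSeries.constantCoeff g)) := by
  obtain ⟨α, h1, h2⟩ := h
  have hpow : ∀ n : ℕ, n ≠ 0 → Tendsto (fun u : ℂ => u ^ n) (𝓝[≠] 0) (𝓝 0) := by
    intro n hn
    have : ContinuousAt (fun u : ℂ => u ^ n) 0 := by fun_prop
    simpa [ContinuousAt, hn] using this.tendsto.mono_left (nhdsWithin_le_nhds (s := {0}ᶜ))
  have h3 : Tendsto (fun u => ∑ j ∈ range K, α j u * (u ^ r * y) ^ j) (𝓝[≠] 0)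
      (𝓝 (∑ j ∈ range K, PowerSeries.coeff j g * (0 * y) ^ j)) :=
    tendsto_finsetSum _ fun j _ => (h1 j).mul (((hpow r hr).mul_const y).pow j)
  have h4 : ∑ j ∈ range K, PowerSeries.coeff j g * (0 * y) ^ j =
      PowerSeries.constantCoeff g := by
    rw [Finset.sum_eq_single 0]
    · simp
    · intro j _ hj
      simp [hj]
    · intro h0
      exact absurd (mem_range.2 (Nat.pos_of_ne_zero hK)) h0
  have h5 := ((h2 y hy).trans_tendsto (hpow K hK)).add h3
  rw [h4, zero_add] at h5
  simpa only [sub_add_cancel] using h5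

lemma HasSymbolUpTo.inv {r : ℕ} (hr : r ≠ 0) {A : ℂ → ℂ → ℂ} {g : PowerSeries ℂ}
    (hA : ∀ K, HasSymbolUpTo r K A g) (hg : PowerSeries.constantCoeff g ≠ 0) (K : ℕ) :
    HasSymbolUpTo r K (fun y u => (A y u)⁻¹) g⁻¹ := by
  have hlim : ∀ y ≠ 0, Tendsto (A y) (𝓝[≠] 0) (𝓝 (PowerSeries.constantCoeff g)) := fun y hy =>
    (hA 1).tendsto hr one_ne_zero hy
  obtain ⟨α, h1, h2⟩ := hA K
  -- For each u the approximating coefficients are inverted as a formal power series. The recursion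
  -- for the inverse carries the limits of the α_i over to the β_j because the limit of α_0 is
  -- nonzero.
  let β : ℕ → ℂ → ℂ := fun j u => PowerSeries.coeff j (PowerSeries.mk fun i => α i u)⁻¹
  have hβ : ∀ j, Tendsto (β j) (𝓝[≠] 0) (𝓝 (PowerSeries.coeff j g⁻¹)) := by
    have h10 : Tendsto (fun u => (α 0 u)⁻¹) (𝓝[≠] 0) (𝓝 (PowerSeries.constantCoeff g)⁻¹) :=
      (by simpa using h1 0 : Tendsto (α 0) _ (𝓝 (PowerSeries.constantCoeff g))).inv₀ hg
    intro j
    induction j using Nat.strong_induction_on with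
    | _ j ih =>
      by_cases hj : j = 0
      · subst hj
        simpa [β] using h10
      · rw [PowerSeries.coeff_inv]
        refine Tendsto.congr (fun u => (PowerSeries.coeff_inv _ _).symm) ?_
        simp only [hj, if_false]
        refine Tendsto.mul ?_ (tendsto_finsetSum _ fun p _ => ?_)
        · simpa using h10.neg
        · by_cases hp : p.2 < j
          · simp only [hp, if_true, PowerSeries.coeff_mk]
            exact (h1 _).mul (ih _ hp)
          · simp only [hp, if_false]
            exact tendsto_const_nhds
  refine ⟨β, hβ, fun y hy => ?_⟩
  have hinv := ((hlim y hy).inv₀ hg).isBigO_one ℂ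
  rcases Nat.eq_zero_or_pos K with rfl | hK
  · simpa using hinv
  · have h3 := isBigO_sum_mul_sum (K := K) hr h1 hβ y
    obtain ⟨l, hl⟩ := tendsto_sum_mul_pow (r := r) K hβ y
    have h4 := (h2 y hy).mul (hl.isBigO_one ℂ)
    simp only [mul_one] at h4
    have h5 := hinv.mul (h4.add h3)
    simp only [one_mul] at h5
    have hne : ∀ᶠ u in 𝓝[≠] (0 : ℂ), α 0 u ≠ 0 := by
      refine (h1 0).eventually_ne ?_
      simpa using hg
    refine (h5.neg_left).congr' ?_ EventuallyEq.rfl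
    filter_upwards [hne, (hlim y hy).eventually_ne hg] with u hu hAu
    -- The truncated Cauchy product of a series and its formal inverse is exactly 1. Thus 1/A minus
    -- the truncation of β is -1/A times two errors already known to be O(u^K).
    have h6 : ∑ n ∈ range K, (∑ p ∈ antidiagonal n, α p.1 u * β p.2 u) * (u ^ r * y) ^ n = 1 := by
      have h7 : ∀ n, ∑ p ∈ antidiagonal n, α p.1 u * β p.2 u =
          PowerSeries.coeff n (1 : PowerSeries ℂ) := by
        intro n
        rw [← PowerSeries.mul_inv_cancel (PowerSeries.mk fun i => α i u) (by simpa using hu),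
          PowerSeries.coeff_mul]
        simp [β]
      rw [Finset.sum_eq_single 0]
      · rw [h7]
        simp
      · intro n _ hn
        simp [h7, PowerSeries.coeff_one, hn]
      · intro h0
        exact absurd (mem_range.2 hK) h0
    rw [h6]
    field_simp
    ring

/-- As ε y^k u^a = ε u^{a-rk} (u^r y)^k, the coefficient of (u^r y)^k has a nonzero limit only if a
= rk and ε ≠ 0. -/
lemma hasSymbolUpTo_one_sub {r : ℕ} (hr : r ≠ 0) (K : ℕ) (ε : ℂ) {k a : ℕ} (hk : k ≠ 0)
    (ha : r * k ≤ a) :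
    HasSymbolUpTo r K (fun y u => 1 - ε * y ^ k * u ^ a)
      (if a = r * k then 1 - PowerSeries.C ε * PowerSeries.X ^ k else 1) := by
  refine hasSymbolUpTo_of_polynomial hr K (k + 1)
    (fun j u => if j = 0 then 1 else if j = k then -ε * u ^ (a - r * k) else 0) ?_ ?_ ?_
  · intro j
    by_cases hj0 : j = 0
    · subst hj0
      simp only [if_true]
      convert tendsto_const_nhds using 2
      split_ifs <;> simp [hk]
    · simp only [hj0, if_false]
      by_cases hjk : j = k
      · subst hjk
        simp only [if_true]
        by_cases h : a = r * j
        · simp [h, PowerSeries.coeff_one, hk, PowerSeries.coeff_C_mul, PowerSeries.coeff_X_pow]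
        · have h0 : a - r * j ≠ 0 := by omega
          have : ContinuousAt (fun u : ℂ => -ε * u ^ (a - r * j)) 0 := by fun_prop
          have := this.tendsto.mono_left (nhdsWithin_le_nhds (s := {0}ᶜ))
          simpa [h, h0, PowerSeries.coeff_one, hk] using this
      · simp only [hjk, if_false]
        convert tendsto_const_nhds using 2
        split_ifs <;> simp [PowerSeries.coeff_one, hj0, hjk, PowerSeries.coeff_C_mul,
          PowerSeries.coeff_X_pow]
  · intro j hj u
    rw [if_neg (by omega), if_neg (by omega)]
  · intro y _ u
    rw [Finset.sum_range_succ, Finset.sum_eq_single 0]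
    · simp only [if_true, hk, if_false, pow_zero, mul_one, mul_pow, ← pow_mul]
      rw [sub_eq_add_neg]
      congr 1
      rw [show u ^ a = u ^ (a - r * k) * u ^ (r * k) by rw [← pow_add, Nat.sub_add_cancel ha]]
      ring
    · intro j hj hj0
      simp [hj0, (mem_range.1 hj).ne]
    · intro h
      exact absurd (mem_range.2 (Nat.pos_of_ne_zero hk)) h

/-- Once a ≥ K the whole product is 1 + O(u^K). Before that, splitting off the first factor, whose
symbol is 1 as a > rk, raises a by b ≥ 1. So J bounds the number of factors to be split off. -/
lemma hasSymbolUpTo_qp_one {r : ℕ} (hr : r ≠ 0) (K : ℕ) (ε : ℂ) {k b : ℕ} (hk : k ≠ 0)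
    (hb : b ≠ 0) (J : ℕ) : ∀ a, r * k < a → K ≤ a + J →
    HasSymbolUpTo r K (fun y u => qp (ε * y ^ k) a b u) 1 := by
  induction J with
  | zero =>
    intro a _ hK
    refine ⟨fun j _ => if j = 0 then 1 else 0, fun j => ?_, fun y _ => ?_⟩
    · rw [PowerSeries.coeff_one]
      exact tendsto_const_nhds
    · have h1 := (isBigO_qp_sub_one (ε * y ^ k) a hb).trans (isBigO_pow_pow hK)
      rcases Nat.eq_zero_or_pos K with rfl | hK0
      · simpa using (tendsto_qp (ε * y ^ k) (by omega : a ≠ 0) hb).isBigO_one ℂ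
      · refine h1.congr_left fun u => ?_
        rw [Finset.sum_eq_single 0]
        · simp
        · intro j _ hj
          simp [hj]
        · intro h
          exact absurd (mem_range.2 hK0) h
  | succ J ih =>
    intro a ha hK
    have h1 := hasSymbolUpTo_one_sub hr K ε hk ha.le
    rw [if_neg ha.ne'] at h1
    refine (h1.mul hr (ih (a + b) (by omega) (by omega))).congr (fun y u hu => ?_) (by simp)
    exact qp_shift _ _ hb hu

/-- The symbol of `(ε y^k u^a; u^b)_∞`. -/
lemma hasSymbolUpTo_qp {r : ℕ} (hr : r ≠ 0) (K : ℕ) (ε : ℂ) {k a b : ℕ} (hk : k ≠ 0)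
    (hb : b ≠ 0) (ha : r * k ≤ a) :
    HasSymbolUpTo r K (fun y u => qp (ε * y ^ k) a b u)
      (if a = r * k then 1 - PowerSeries.C ε * PowerSeries.X ^ k else 1) := by
  refine ((hasSymbolUpTo_one_sub hr K ε hk ha).mul hr
    (hasSymbolUpTo_qp_one hr K ε hk hb K (a + b) (by omega) (by omega))).congr
    (fun y u hu => qp_shift _ _ hb hu) (mul_one _)

end EllipticPfaffian

/-! ### Theta series and the terms that vanish in a product of two of them. -/

namespace EllipticPfaffian

open Finset Filter Topology

/-! ### Jacobi's triple product -/

/-- `1 / ((1 - q) ⋯ (1 - q^m))` for `m ≥ 0`, and `0` for `m < 0`. -/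
noncomputable def invPoch (q : ℂ) (m : ℤ) : ℂ :=
  if 0 ≤ m then (∏ i ∈ range m.toNat, (1 - q * q ^ i))⁻¹ else 0

lemma one_sub_mul_pow_ne_zero {q : ℂ} (hq : ‖q‖ < 1) (i : ℕ) : 1 - q * q ^ i ≠ 0 := by
  rw [← pow_succ']
  intro h
  have h1 := norm_pow_lt_one hq (Nat.succ_ne_zero i)
  rw [← sub_eq_zero.1 h, norm_one] at h1
  exact lt_irrefl _ h1

/-- The value 0 at negative indices makes the recursion valid for all integers, since 1 - q^0 = 0 at
m = 0. It lets the finite triple product be summed over all of ℤ. -/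
lemma invPoch_sub_one {q : ℂ} (hq : ‖q‖ < 1) (m : ℤ) :
    invPoch q (m - 1) = (1 - q ^ m) * invPoch q m := by
  unfold invPoch
  rcases lt_trichotomy m 0 with h | rfl | h
  · rw [if_neg (by omega), if_neg (by omega), mul_zero]
  · simp
  · rw [if_pos (by omega), if_pos h.le]
    obtain ⟨k, rfl⟩ : ∃ k : ℕ, m = k + 1 := ⟨(m - 1).toNat, by omega⟩
    have h1 : ((k : ℤ) + 1 - 1).toNat = k := by omega
    have h2 : ((k : ℤ) + 1).toNat = k + 1 := by omega
    rw [h1, h2, Finset.prod_range_succ, mul_inv]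
    have h3 := one_sub_mul_pow_ne_zero hq k
    rw [show q ^ ((k : ℤ) + 1) = q * q ^ k by rw [← pow_succ']; exact_mod_cast zpow_natCast q (k + 1)]
    field_simp

/-- The coefficients of the finite form of the triple product. -/
noncomputable def tripleCoeff (v : ℂ) (n : ℕ) (k : ℤ) : ℂ :=
  (∏ i ∈ range (2 * n), (1 - v ^ 2 * (v ^ 2) ^ i)) * ((-1) ^ k * v ^ (k * (k - 1))) *
    (invPoch (v ^ 2) (n - k) * invPoch (v ^ 2) (n + k))

/-- With q = v², this is the effect on coefficients of the new factor (1 - y q^n)(1 - q^{n+1}/y) = 1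
+ q^{2n+1} - q^n y - q^{n+1} y^{-1}. Everything is expressed through A = q^{n+1-k} and B =
q^{n+1+k}, after which the recursion is a rational identity. -/
lemma tripleCoeff_succ {v : ℂ} (hv0 : v ≠ 0) (hv : ‖v‖ < 1) (n : ℕ) (k : ℤ) :
    tripleCoeff v (n + 1) k = (1 + (v ^ 2) ^ (2 * n + 1)) * tripleCoeff v n k -
      (v ^ 2) ^ n * tripleCoeff v n (k - 1) - (v ^ 2) ^ (n + 1) * tripleCoeff v n (k + 1) := by
  have hq : ‖v ^ 2‖ < 1 := norm_pow_lt_one hv two_ne_zero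
  have hq0 : v ^ 2 ≠ 0 := pow_ne_zero 2 hv0
  unfold tripleCoeff
  obtain ⟨H, hH⟩ : ∃ H, invPoch (v ^ 2) (n + 1 - k) = H := ⟨_, rfl⟩
  obtain ⟨G, hG⟩ : ∃ G, invPoch (v ^ 2) (n + 1 + k) = G := ⟨_, rfl⟩
  obtain ⟨A, hA⟩ : ∃ A, (v ^ 2) ^ ((n : ℤ) + 1 - k) = A := ⟨_, rfl⟩
  obtain ⟨B, hB⟩ : ∃ B, (v ^ 2) ^ ((n : ℤ) + 1 + k) = B := ⟨_, rfl⟩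
  have e1 : invPoch (v ^ 2) (n - k) = (1 - A) * H := by
    rw [← hA, ← hH, ← invPoch_sub_one hq]
    congr 1
    ring
  have e2 : invPoch (v ^ 2) (n + k) = (1 - B) * G := by
    rw [← hB, ← hG, ← invPoch_sub_one hq]
    congr 1
    ring
  have hA' : (v ^ 2) ^ ((n : ℤ) - k) = A / v ^ 2 := by
    rw [← hA, show (n : ℤ) + 1 - k = (n - k) + 1 by ring, zpow_add_one₀ hq0]
    field_simp
  have hB' : (v ^ 2) ^ ((n : ℤ) + k) = B / v ^ 2 := by
    rw [← hB, show (n : ℤ) + 1 + k = (n + k) + 1 by ring, zpow_add_one₀ hq0]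
    field_simp
  have e3 : invPoch (v ^ 2) (n + (k - 1)) = (1 - B / v ^ 2) * ((1 - B) * G) := by
    rw [← hB', ← e2, ← invPoch_sub_one hq]
    congr 1
    ring
  have e4 : invPoch (v ^ 2) (n - (k + 1)) = (1 - A / v ^ 2) * ((1 - A) * H) := by
    rw [← hA', ← e1, ← invPoch_sub_one hq]
    congr 1
    ring
  have e5 : invPoch (v ^ 2) (n - (k - 1)) = H := by
    rw [← hH]
    congr 1
    ring
  have e6 : invPoch (v ^ 2) (n + (k + 1)) = G := by
    rw [← hG]
    congr 1
    ring
  have e7 : invPoch (v ^ 2) (((n + 1 : ℕ) : ℤ) - k) = H := by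
    rw [← hH]
    push_cast
    rfl
  have e8 : invPoch (v ^ 2) (((n + 1 : ℕ) : ℤ) + k) = G := by
    rw [← hG]
    push_cast
    rfl
  have hAB : A * B = (v ^ 2) ^ (2 * n + 2) := by
    rw [← hA, ← hB, ← zpow_add₀ hq0, ← zpow_natCast (v ^ 2) (2 * n + 2)]
    congr 1
    push_cast
    ring
  have s1 : (-1 : ℂ) ^ (k - 1) = -(-1) ^ k := by
    rw [zpow_sub_one₀ (by norm_num)]
    norm_num
  have s2 : (-1 : ℂ) ^ (k + 1) = -(-1) ^ k := by
    rw [zpow_add_one₀ (by norm_num)]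
    norm_num
  have p1 : (v ^ 2) ^ n * v ^ ((k - 1) * (k - 1 - 1)) = A * v ^ (k * (k - 1)) := by
    rw [← hA, ← zpow_natCast, ← zpow_natCast, ← zpow_mul, ← zpow_mul, ← zpow_add₀ hv0,
      ← zpow_add₀ hv0]
    congr 1
    push_cast
    ring
  have p2 : (v ^ 2) ^ (n + 1) * v ^ ((k + 1) * (k + 1 - 1)) = B * v ^ (k * (k - 1)) := by
    rw [← hB, ← zpow_natCast, ← zpow_natCast, ← zpow_mul, ← zpow_mul, ← zpow_add₀ hv0,
      ← zpow_add₀ hv0]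
    congr 1
    push_cast
    ring
  have hodd : (v ^ 2) ^ (2 * n + 1) = A * B / v ^ 2 := by
    rw [hAB]
    field_simp
    ring
  have hprod : ∏ i ∈ range (2 * (n + 1)), (1 - v ^ 2 * (v ^ 2) ^ i) =
      (∏ i ∈ range (2 * n), (1 - v ^ 2 * (v ^ 2) ^ i)) * (1 - A * B / v ^ 2) * (1 - A * B) := by
    rw [show 2 * (n + 1) = 2 * n + 1 + 1 by ring, Finset.prod_range_succ, Finset.prod_range_succ,
      ← hodd, hAB, ← pow_succ', ← pow_succ']
  rw [e1, e2, e3, e4, e5, e6, e7, e8, s1, s2, hprod, hodd]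
  generalize (∏ i ∈ range (2 * n), (1 - v ^ 2 * (v ^ 2) ^ i)) = w0
  generalize v ^ ((k - 1) * (k - 1 - 1)) = w1 at *
  generalize v ^ ((k + 1) * (k + 1 - 1)) = w2 at *
  generalize v ^ (k * (k - 1)) = w at *
  generalize (-1 : ℂ) ^ k = s
  have key : w0 * (1 - A * B / v ^ 2) * (1 - A * B) * (s * w) * (H * G) =
      (1 + A * B / v ^ 2) * (w0 * (s * w) * ((1 - A) * H * ((1 - B) * G))) -
      w0 * (-s * (A * w)) * (H * ((1 - B / v ^ 2) * ((1 - B) * G))) -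
      w0 * (-s * (B * w)) * ((1 - A / v ^ 2) * ((1 - A) * H) * G) := by
    field_simp
    ring
  rw [key, ← p1, ← p2]
  ring

lemma hasSum_tripleCoeff {v : ℂ} (hv0 : v ≠ 0) (hv : ‖v‖ < 1) {y : ℂ} (hy : y ≠ 0) (n : ℕ) :
    HasSum (fun k : ℤ => tripleCoeff v n k * y ^ k)
      (∏ j ∈ range n, ((1 - y * (v ^ 2) ^ j) * (1 - v ^ 2 / y * (v ^ 2) ^ j))) := by
  induction n with
  | zero =>
    have h : ∀ k : ℤ, k ≠ 0 → tripleCoeff v 0 k * y ^ k = 0 := by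
      intro k hk
      have : invPoch (v ^ 2) ((0 : ℕ) - k) * invPoch (v ^ 2) ((0 : ℕ) + k) = 0 := by
        rcases lt_or_gt_of_ne hk with h | h
        · exact mul_eq_zero_of_right _ (if_neg (by push_cast; omega))
        · exact mul_eq_zero_of_left (if_neg (by push_cast; omega)) _
      rw [tripleCoeff, this]
      ring
    have := hasSum_single (0 : ℤ) h
    simpa [tripleCoeff, invPoch] using this
  | succ n ih =>
    have h1 : HasSum (fun k : ℤ => tripleCoeff v n (k - 1) * y ^ k)
        (y * ∏ j ∈ range n, ((1 - y * (v ^ 2) ^ j) * (1 - v ^ 2 / y * (v ^ 2) ^ j))) := by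
      have := ((Equiv.subRight (1 : ℤ)).hasSum_iff.2 ih).mul_left y
      refine this.congr_fun ?_
      intro k
      simp only [Function.comp, Equiv.subRight_apply]
      rw [zpow_sub_one₀ hy]
      field_simp
    have h2 : HasSum (fun k : ℤ => tripleCoeff v n (k + 1) * y ^ k)
        (y⁻¹ * ∏ j ∈ range n, ((1 - y * (v ^ 2) ^ j) * (1 - v ^ 2 / y * (v ^ 2) ^ j))) := by
      have := ((Equiv.addRight (1 : ℤ)).hasSum_iff.2 ih).mul_left y⁻¹
      refine this.congr_fun ?_
      intro k
      simp only [Function.comp, Equiv.coe_addRight]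
      rw [zpow_add_one₀ hy]
      field_simp
    have h3 := ((ih.mul_left (1 + (v ^ 2) ^ (2 * n + 1))).sub (h1.mul_left ((v ^ 2) ^ n))).sub
      (h2.mul_left ((v ^ 2) ^ (n + 1)))
    rw [Finset.prod_range_succ]
    have e1 : (fun k : ℤ => tripleCoeff v (n + 1) k * y ^ k) = fun k : ℤ =>
        (1 + (v ^ 2) ^ (2 * n + 1)) * (tripleCoeff v n k * y ^ k) -
          (v ^ 2) ^ n * (tripleCoeff v n (k - 1) * y ^ k) -
          (v ^ 2) ^ (n + 1) * (tripleCoeff v n (k + 1) * y ^ k) := by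
      funext k
      rw [tripleCoeff_succ hv0 hv]
      ring
    have e2 : (1 - y * (v ^ 2) ^ n) * (1 - v ^ 2 / y * (v ^ 2) ^ n) =
        (1 + (v ^ 2) ^ (2 * n + 1)) - (v ^ 2) ^ n * y - (v ^ 2) ^ (n + 1) * y⁻¹ := by
      field_simp
      ring
    rw [e1, e2]
    convert! h3 using 1
    ring

lemma multipliable_qPoch (a : ℂ) {q : ℂ} (hq : ‖q‖ < 1) :
    Multipliable fun j : ℕ => 1 - a * q ^ j := by
  have hs : Summable (fun j : ℕ => -(a * q ^ j)) :=
    ((summable_geometric_of_norm_lt_one hq).mul_left a).neg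
  simpa [sub_eq_add_neg] using Complex.multipliable_one_add_of_summable hs

lemma qPoch_self_ne_zero {q : ℂ} (hq : ‖q‖ < 1) : qPoch q q ≠ 0 := by
  have hs : Summable (fun j : ℕ => ‖-(q * q ^ j)‖) :=
    ((summable_geometric_of_norm_lt_one hq).mul_left q).neg.norm
  have := tprod_one_add_ne_zero_of_summable (f := fun j : ℕ => -(q * q ^ j))
    (fun j => by simpa [← sub_eq_add_neg] using one_sub_mul_pow_ne_zero hq j) hs
  simpa [qPoch, sub_eq_add_neg] using this

lemma summable_triple {ρ r : ℝ} (h0 : 0 < ρ) (h1 : ρ < 1) (hr : 0 < r) :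
    Summable fun k : ℤ => ρ ^ (k * (k - 1)) * r ^ k := by
  have hlim : Tendsto (fun n : ℕ => ρ ^ (2 * n)) atTop (𝓝 0) := by
    simp only [pow_mul]
    exact tendsto_pow_atTop_nhds_zero_of_lt_one (by positivity)
      (pow_lt_one₀ h0.le h1 two_ne_zero)
  refine Summable.of_nat_of_neg ?_ ?_
  · refine summable_of_ratio_test_tendsto_lt_one (l := 0) one_pos
      (Eventually.of_forall fun n => by positivity) ?_
    have : ∀ n : ℕ, ‖ρ ^ (((n + 1 : ℕ) : ℤ) * (((n + 1 : ℕ) : ℤ) - 1)) * r ^ ((n + 1 : ℕ) : ℤ)‖ /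
        ‖ρ ^ ((n : ℤ) * ((n : ℤ) - 1)) * r ^ (n : ℤ)‖ = ρ ^ (2 * n) * r := by
      intro n
      rw [Real.norm_of_nonneg (by positivity), Real.norm_of_nonneg (by positivity),
        div_eq_iff (by positivity), ← zpow_natCast ρ (2 * n), Nat.cast_succ, zpow_add_one₀ hr.ne',
        show ((n : ℤ) + 1) * ((n : ℤ) + 1 - 1) = ((2 * n : ℕ) : ℤ) + (n : ℤ) * ((n : ℤ) - 1) by
          push_cast; ring, zpow_add₀ h0.ne']
      ring
    simp only [this]
    simpa using hlim.mul_const r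
  · refine summable_of_ratio_test_tendsto_lt_one (l := 0) one_pos
      (Eventually.of_forall fun n => by positivity) ?_
    have : ∀ n : ℕ, ‖ρ ^ ((-((n + 1 : ℕ) : ℤ)) * (-((n + 1 : ℕ) : ℤ) - 1)) *
        r ^ (-((n + 1 : ℕ) : ℤ))‖ / ‖ρ ^ ((-(n : ℤ)) * (-(n : ℤ) - 1)) * r ^ (-(n : ℤ))‖ =
        ρ ^ (2 * n) * (ρ ^ 2 * r⁻¹) := by
      intro n
      rw [Real.norm_of_nonneg (by positivity), Real.norm_of_nonneg (by positivity),
        div_eq_iff (by positivity), ← mul_assoc (ρ ^ (2 * n)), ← pow_add,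
        ← zpow_natCast ρ (2 * n + 2),
        Nat.cast_succ, neg_add, ← sub_eq_add_neg, zpow_sub_one₀ hr.ne',
        show (-(n : ℤ) - 1) * (-(n : ℤ) - 1 - 1) =
          ((2 * n + 2 : ℕ) : ℤ) + (-(n : ℤ)) * (-(n : ℤ) - 1) by
          push_cast; ring, zpow_add₀ h0.ne']
      ring
    simp only [this]
    simpa using hlim.mul_const (ρ ^ 2 * r⁻¹)

lemma summable_norm_triple {v : ℂ} (hv0 : v ≠ 0) (hv : ‖v‖ < 1) {y : ℂ} (hy : y ≠ 0) :
    Summable fun k : ℤ => ‖(-1 : ℂ) ^ k * v ^ (k * (k - 1)) * y ^ k‖ := by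
  refine (summable_triple (norm_pos_iff.2 hv0) hv (norm_pos_iff.2 hy)).congr fun k => ?_
  simp [norm_zpow]

lemma tendsto_invPoch {q : ℂ} (hq : ‖q‖ < 1) :
    Tendsto (fun n : ℕ => invPoch q n) atTop (𝓝 (qPoch q q)⁻¹) := by
  have := ((multipliable_qPoch q hq).hasProd.tendsto_prod_nat).inv₀ (qPoch_self_ne_zero hq)
  refine this.congr fun n => ?_
  simp [invPoch]

lemma exists_norm_invPoch_le {q : ℂ} (hq : ‖q‖ < 1) : ∃ C, 0 ≤ C ∧ ∀ m, ‖invPoch q m‖ ≤ C := by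
  obtain ⟨C, hC⟩ := (tendsto_invPoch hq).norm.bddAbove_range
  have hC' : ∀ n : ℕ, ‖invPoch q n‖ ≤ C := fun n => hC ⟨n, rfl⟩
  refine ⟨C, (norm_nonneg _).trans (hC' 0), fun m => ?_⟩
  by_cases hm : 0 ≤ m
  · lift m to ℕ using hm
    exact hC' m
  · rw [invPoch, if_neg hm, norm_zero]
    exact (norm_nonneg _).trans (hC' 0)

/-- Jacobi's triple product identity. -/
theorem qPoch_mul_theta {v : ℂ} (hv0 : v ≠ 0) (hv : ‖v‖ < 1) {y : ℂ} (hy : y ≠ 0) :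
    qPoch (v ^ 2) (v ^ 2) * theta y (v ^ 2) =
      ∑' k : ℤ, (-1) ^ k * v ^ (k * (k - 1)) * y ^ k := by
  have hq : ‖v ^ 2‖ < 1 := norm_pow_lt_one hv two_ne_zero
  have hQ := qPoch_self_ne_zero hq
  set Q := qPoch (v ^ 2) (v ^ 2) with hQdef
  have hP : Tendsto (fun n : ℕ => ∏ i ∈ range (2 * n), (1 - v ^ 2 * (v ^ 2) ^ i)) atTop (𝓝 Q) :=
    (multipliable_qPoch (v ^ 2) hq).hasProd.tendsto_prod_nat.comp
      (tendsto_id.const_mul_atTop' two_pos)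
  obtain ⟨C, hC0, hC⟩ := exists_norm_invPoch_le hq
  obtain ⟨D, hD⟩ := hP.norm.bddAbove_range
  have hD' : ∀ n : ℕ, ‖∏ i ∈ range (2 * n), (1 - v ^ 2 * (v ^ 2) ^ i)‖ ≤ D := fun n => hD ⟨n, rfl⟩
  have hD0 : 0 ≤ D := (norm_nonneg _).trans (hD' 0)
  -- The limit is taken termwise by dominated convergence: the products and inverse products in the
  -- coefficients are bounded uniformly in n and k, and v^{k(k-1)} y^k is summable.
  have hlim1 : Tendsto (fun n : ℕ => ∑' k : ℤ, tripleCoeff v n k * y ^ k) atTop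
      (𝓝 (∑' k : ℤ, Q⁻¹ * ((-1) ^ k * v ^ (k * (k - 1)) * y ^ k))) := by
    refine tendsto_tsum_of_dominated_convergence
      ((summable_norm_triple hv0 hv hy).mul_left (D * (C * C))) (fun k => ?_)
      (Eventually.of_forall fun n k => ?_)
    · have ha : Tendsto (fun n : ℕ => invPoch (v ^ 2) (n - k)) atTop (𝓝 Q⁻¹) := by
        have h1 : Tendsto (fun n : ℕ => ((n : ℤ) - k).toNat) atTop atTop := by
          refine tendsto_atTop.2 fun b => ?_
          filter_upwards [eventually_ge_atTop (b + k.toNat)] with n hn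
          omega
        refine ((tendsto_invPoch hq).comp h1).congr' ?_
        filter_upwards [eventually_ge_atTop k.toNat] with n hn
        simp only [Function.comp]
        congr 1
        omega
      have hb : Tendsto (fun n : ℕ => invPoch (v ^ 2) (n + k)) atTop (𝓝 Q⁻¹) := by
        have h1 : Tendsto (fun n : ℕ => ((n : ℤ) + k).toNat) atTop atTop := by
          refine tendsto_atTop.2 fun b => ?_
          filter_upwards [eventually_ge_atTop (b + (-k).toNat)] with n hn
          omega
        refine ((tendsto_invPoch hq).comp h1).congr' ?_
        filter_upwards [eventually_ge_atTop (-k).toNat] with n hn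
        simp only [Function.comp]
        congr 1
        omega
      have := ((hP.mul_const ((-1) ^ k * v ^ (k * (k - 1)))).mul (ha.mul hb)).mul_const (y ^ k)
      have e : Q⁻¹ * ((-1) ^ k * v ^ (k * (k - 1)) * y ^ k) =
          Q * ((-1) ^ k * v ^ (k * (k - 1))) * (Q⁻¹ * Q⁻¹) * y ^ k := by
        field_simp
      rw [e]
      exact this
    · have e : tripleCoeff v n k * y ^ k = (∏ i ∈ range (2 * n), (1 - v ^ 2 * (v ^ 2) ^ i)) *
          (invPoch (v ^ 2) (n - k) * invPoch (v ^ 2) (n + k)) *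
          ((-1) ^ k * v ^ (k * (k - 1)) * y ^ k) := by
        unfold tripleCoeff
        ring
      rw [e, norm_mul, norm_mul, norm_mul]
      refine mul_le_mul_of_nonneg_right ?_ (norm_nonneg _)
      exact mul_le_mul (hD' n) (mul_le_mul (hC _) (hC _) (norm_nonneg _) hC0)
        (by positivity) hD0
  have hlim2 : Tendsto (fun n : ℕ => ∑' k : ℤ, tripleCoeff v n k * y ^ k) atTop
      (𝓝 (theta y (v ^ 2))) := by
    have := (multipliable_qPoch y hq).hasProd.tendsto_prod_nat.mul
      (multipliable_qPoch (v ^ 2 / y) hq).hasProd.tendsto_prod_nat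
    refine this.congr fun n => ?_
    rw [(hasSum_tripleCoeff hv0 hv hy n).tsum_eq, Finset.prod_mul_distrib]
  rw [tendsto_nhds_unique hlim2 hlim1, tsum_mul_left, ← mul_assoc, mul_inv_cancel₀ hQ, one_mul]

/-! ### A vanishing trisection -/

/-- The expansion of `θ(y; q) θ(q y²; q²)` contains no power `y^m` with `m ≡ 2 mod 3`. -/
theorem trisection_theta {v : ℂ} (hv0 : v ≠ 0) (hv : ‖v‖ < 1) {y : ℂ} (hy : y ≠ 0) {ω : ℂ}
    (hω : 1 + ω + ω ^ 2 = 0) :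
    theta y (v ^ 2) * theta (v ^ 2 * y ^ 2) ((v ^ 2) ^ 2) +
      ω * (theta (ω * y) (v ^ 2) * theta (v ^ 2 * (ω * y) ^ 2) ((v ^ 2) ^ 2)) +
      ω ^ 2 * (theta (ω ^ 2 * y) (v ^ 2) * theta (v ^ 2 * (ω ^ 2 * y) ^ 2) ((v ^ 2) ^ 2)) = 0 := by
  have hω3 : ω ^ 3 = 1 := by linear_combination (ω - 1) * hω
  have hω0 : ω ≠ 0 := by
    rintro rfl
    norm_num at hω
  have hv2 : ‖v ^ 2‖ < 1 := norm_pow_lt_one hv two_ne_zero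
  have hv4 : ‖(v ^ 2) ^ 2‖ < 1 := norm_pow_lt_one hv2 two_ne_zero
  -- Coefficient of x^{k+2j} in the double series obtained from two triple products, the second with
  -- nome q² and argument q x².
  let c : ℤ × ℤ → ℂ := fun p => (-1) ^ p.1 * (-1) ^ p.2 * v ^ (p.1 * (p.1 - 1) + 2 * p.2 ^ 2)
  have hM : ∀ x : ℂ, x ≠ 0 → HasSum (fun p : ℤ × ℤ => c p * x ^ (p.1 + 2 * p.2))
      (qPoch (v ^ 2) (v ^ 2) * qPoch ((v ^ 2) ^ 2) ((v ^ 2) ^ 2) *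
        (theta x (v ^ 2) * theta (v ^ 2 * x ^ 2) ((v ^ 2) ^ 2))) := by
    intro x hx
    have hx2 : v ^ 2 * x ^ 2 ≠ 0 := mul_ne_zero (pow_ne_zero _ hv0) (pow_ne_zero _ hx)
    have s1 := summable_norm_triple hv0 hv hx
    have s2 := summable_norm_triple (pow_ne_zero 2 hv0) hv2 hx2
    have h1 := (summable_mul_of_summable_norm s1 s2).hasSum
    rw [← tsum_mul_tsum_of_summable_norm s1 s2, ← qPoch_mul_theta hv0 hv hx,
      ← qPoch_mul_theta (pow_ne_zero 2 hv0) hv2 hx2] at h1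
    have e0 : (fun p : ℤ × ℤ => c p * x ^ (p.1 + 2 * p.2)) = fun p : ℤ × ℤ =>
        ((-1) ^ p.1 * v ^ (p.1 * (p.1 - 1)) * x ^ p.1) *
          ((-1) ^ p.2 * (v ^ 2) ^ (p.2 * (p.2 - 1)) * (v ^ 2 * x ^ 2) ^ p.2) := by
      funext p
      have e1 : (v ^ 2 * x ^ 2) ^ p.2 = v ^ (2 * p.2) * x ^ (2 * p.2) := by
        rw [mul_zpow, ← zpow_natCast v, ← zpow_natCast x, ← zpow_mul, ← zpow_mul]
        norm_num
      have e2 : (v ^ 2) ^ (p.2 * (p.2 - 1)) = v ^ (2 * (p.2 * (p.2 - 1))) := by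
        rw [← zpow_natCast v, ← zpow_mul]
        norm_num
      have e3 : v ^ (p.1 * (p.1 - 1) + 2 * p.2 ^ 2) =
          v ^ (p.1 * (p.1 - 1)) * (v ^ (2 * (p.2 * (p.2 - 1))) * v ^ (2 * p.2)) := by
        rw [← zpow_add₀ hv0, ← zpow_add₀ hv0]
        congr 1
        ring
      simp only [c]
      rw [e1, e2, e3, zpow_add₀ hx]
      ring
    rw [e0, mul_mul_mul_comm]
    exact h1
  -- The weights 1, ω, ω² select the exponents m with 3 ∣ m + 1.
  let g : ℤ × ℤ → ℂ := fun p => c p * y ^ (p.1 + 2 * p.2) *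
    (1 + ω ^ (1 + (p.1 + 2 * p.2)) + (ω ^ 2) ^ (1 + (p.1 + 2 * p.2)))
  have hg : HasSum g (qPoch (v ^ 2) (v ^ 2) * qPoch ((v ^ 2) ^ 2) ((v ^ 2) ^ 2) *
      (theta y (v ^ 2) * theta (v ^ 2 * y ^ 2) ((v ^ 2) ^ 2) +
      ω * (theta (ω * y) (v ^ 2) * theta (v ^ 2 * (ω * y) ^ 2) ((v ^ 2) ^ 2)) +
      ω ^ 2 * (theta (ω ^ 2 * y) (v ^ 2) *
        theta (v ^ 2 * (ω ^ 2 * y) ^ 2) ((v ^ 2) ^ 2)))) := by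
    have h0 := hM y hy
    have h1 := (hM (ω * y) (mul_ne_zero hω0 hy)).mul_left ω
    have h2 := (hM (ω ^ 2 * y) (mul_ne_zero (pow_ne_zero 2 hω0) hy)).mul_left (ω ^ 2)
    have e0 : g = fun p : ℤ × ℤ => c p * y ^ (p.1 + 2 * p.2) +
        ω * (c p * (ω * y) ^ (p.1 + 2 * p.2)) +
        ω ^ 2 * (c p * (ω ^ 2 * y) ^ (p.1 + 2 * p.2)) := by
      funext p
      simp only [g]
      rw [mul_zpow, mul_zpow, zpow_add₀ hω0, zpow_add₀ (pow_ne_zero 2 hω0), zpow_one, zpow_one]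
      ring
    rw [e0]
    convert! (h0.add h1).add h2 using 1
    ring
  have hz3 : ∀ m : ℤ, ω ^ (3 * m) = 1 := by
    intro m
    rw [zpow_mul]
    rw [show ω ^ (3 : ℤ) = 1 by exact_mod_cast hω3, one_zpow]
  have hbr : ∀ m : ℤ, ¬ (3 : ℤ) ∣ m → 1 + ω ^ m + (ω ^ 2) ^ m = 0 := by
    intro m hm
    have e : ∀ n : ℤ, (ω ^ 2) ^ n = ω ^ (2 * n) := by
      intro n
      rw [← zpow_natCast ω 2, ← zpow_mul]
      norm_num
    obtain ⟨n, rfl | rfl⟩ : ∃ n, m = 3 * n + 1 ∨ m = 3 * n + 2 := ⟨m / 3, by omega⟩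
    · rw [e, show 2 * (3 * n + 1) = 3 * (2 * n) + 2 by ring, zpow_add₀ hω0, zpow_add₀ hω0, hz3,
        hz3]
      rw [zpow_one, show ω ^ (2 : ℤ) = ω ^ 2 by norm_cast]
      linear_combination hω
    · rw [e, show 2 * (3 * n + 2) = 3 * (2 * n + 1) + 1 by ring, zpow_add₀ hω0, zpow_add₀ hω0, hz3,
        hz3]
      rw [zpow_one, show ω ^ (2 : ℤ) = ω ^ 2 by norm_cast]
      linear_combination hω
  have hg0 : ∑' p, g p = 0 := by
    -- Parametrisation of the pairs (k, j) with k + 2j ≡ 2 mod 3: k = j + 2 + 3i gives k + 2j = 3(i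
    -- + j) + 2.
    let ι : ℤ × ℤ → ℤ × ℤ := fun p => (p.2 + 2 + 3 * p.1, p.2)
    have hι : Function.Injective ι := by
      rintro ⟨a, b⟩ ⟨a', b'⟩ h
      simp only [ι, Prod.mk.injEq] at h
      ext <;> simp only <;> omega
    have hsupp : Function.support g ⊆ Set.range ι := by
      rintro ⟨k, j⟩ hp
      by_contra hnot
      apply hp
      have : ¬ (3 : ℤ) ∣ 1 + (k + 2 * j) := by
        intro hd
        apply hnot
        refine ⟨((k - j - 2) / 3, j), ?_⟩
        simp only [ι, Prod.mk.injEq, and_true]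
        omega
      simp only [g]
      rw [hbr _ this, mul_zero]
    rw [← hι.tsum_eq hsupp]
    -- This involution fixes i + j, hence the power of y, and also fixes the quadratic exponent of
    -- v. It replaces i by -1 - i and so reverses the sign (-1)^{k+j} = (-1)^i.
    let φ : ℤ × ℤ ≃ ℤ × ℤ :=
      { toFun := fun p => (-1 - p.1, p.2 + 1 + 2 * p.1)
        invFun := fun p => (-1 - p.1, p.2 + 1 + 2 * p.1)
        left_inv := by
          rintro ⟨a, b⟩
          ext <;> simp only <;> ring
        right_inv := by
          rintro ⟨a, b⟩
          ext <;> simp only <;> ring }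
    have hneg : ∀ p, g (ι (φ p)) = -g (ι p) := by
      rintro ⟨i, j⟩
      have hm1 : (-1 : ℂ) ≠ 0 := by norm_num
      simp only [g, c, ι, φ, Equiv.coe_fn_mk]
      rw [← zpow_add₀ hm1, ← zpow_add₀ hm1]
      have e1 : j + 1 + 2 * i + 2 + 3 * (-1 - i) + (j + 1 + 2 * i) = i + 1 + 2 * j := by ring
      have e2 : j + 2 + 3 * i + j = i + 2 * (1 + i + j) := by ring
      have e3 : j + 1 + 2 * i + 2 + 3 * (-1 - i) + 2 * (j + 1 + 2 * i) =
        j + 2 + 3 * i + 2 * j := by ring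
      have e4 : (j + 1 + 2 * i + 2 + 3 * (-1 - i)) * (j + 1 + 2 * i + 2 + 3 * (-1 - i) - 1) +
          2 * (j + 1 + 2 * i) ^ 2 =
          (j + 2 + 3 * i) * (j + 2 + 3 * i - 1) + 2 * j ^ 2 := by ring
      have e5 : ∀ n : ℤ, (-1 : ℂ) ^ (2 * n) = 1 := fun n => by
        rw [zpow_mul]
        norm_num
      rw [e1, e2, e3, e4, zpow_add₀ hm1 (i + 1), zpow_add₀ hm1 i (2 * _), e5, e5,
        zpow_add_one₀ hm1]
      ring
    have h1 : ∑' p, g (ι p) = -∑' p, g (ι p) := by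
      rw [← tsum_neg]
      rw [← φ.tsum_eq (fun p => g (ι p))]
      exact tsum_congr hneg
    exact self_eq_neg.1 h1
  have h1 := hg.tsum_eq
  rw [hg0] at h1
  rcases mul_eq_zero.1 h1.symm with h | h
  · exact absurd h (mul_ne_zero (qPoch_self_ne_zero hv2) (qPoch_self_ne_zero hv4))
  · exact h

end EllipticPfaffian

/-! ### Expanding the matrix entries in the functions t^m - t^{-m}. -/

namespace EllipticPfaffian

open Finset Filter Topology Asymptotics

/-! ### Expansions of odd Laurent type -/

/-- For every `M`, and up to `O(u^M)`, the function `f t u` is a combination of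
`u ^ (w k) * (t ^ (m k) - t ^ (- m k))` with coefficients that tend to `γ k` as `u → 0`. -/
def HasExpansion (f : ℂ → ℂ → ℂ) (w m : ℕ → ℕ) (γ : ℕ → ℂ) : Prop :=
  ∀ M : ℕ, ∃ g : ℕ → ℂ → ℂ, (∀ k < M, Tendsto (g k) (𝓝[≠] 0) (𝓝 (γ k))) ∧
    ∀ t ≠ 0, (fun u => f t u - ∑ k ∈ range M, u ^ w k * g k u * (t ^ m k - t⁻¹ ^ m k))
      =O[𝓝[≠] 0] fun u => u ^ M

/-- The product of the two sums is invariant under t ↦ 1/t, so exchanging the summation indices in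
the part with t^{-s} pairs each power with its inverse. -/
lemma sub_mul_sum_mul_sum {t : ℂ} (ht : t ≠ 0) (s M : ℕ) (c : ℕ → ℂ) :
    (t⁻¹ ^ s - t ^ s) * ((∑ k ∈ range M, c k * (t ^ 2) ^ k) * ∑ l ∈ range M, c l * (t⁻¹ ^ 2) ^ l) =
      -∑ p ∈ range M ×ˢ range M, c p.1 * c p.2 *
        (t ^ (2 * ((p.1 : ℤ) - p.2) + s) - t⁻¹ ^ (2 * ((p.1 : ℤ) - p.2) + s)) := by
  have h1 : (t⁻¹ ^ s - t ^ s) *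
      ((∑ k ∈ range M, c k * (t ^ 2) ^ k) * ∑ l ∈ range M, c l * (t⁻¹ ^ 2) ^ l) =
      (∑ p ∈ range M ×ˢ range M, c p.1 * c p.2 * t ^ (2 * ((p.1 : ℤ) - p.2) - s)) -
      ∑ p ∈ range M ×ˢ range M, c p.1 * c p.2 * t ^ (2 * ((p.1 : ℤ) - p.2) + s) := by
    rw [Finset.sum_mul_sum, ← Finset.sum_product', Finset.mul_sum, ← Finset.sum_sub_distrib]
    refine Finset.sum_congr rfl fun p _ => ?_
    have e1 : t ^ (2 * ((p.1 : ℤ) - p.2)) = (t ^ 2) ^ p.1 * (t⁻¹ ^ 2) ^ p.2 := by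
      rw [← pow_mul, ← pow_mul, inv_pow, ← zpow_natCast, ← zpow_natCast, ← zpow_neg,
        ← zpow_add₀ ht]
      congr 1
      push_cast
      ring
    rw [sub_eq_add_neg (2 * ((p.1 : ℤ) - p.2)), zpow_add₀ ht, zpow_add₀ ht, e1, zpow_neg,
      zpow_natCast, inv_pow]
    ring
  have h2 : ∑ p ∈ range M ×ˢ range M, c p.1 * c p.2 * t ^ (2 * ((p.1 : ℤ) - p.2) - s) =
      ∑ p ∈ range M ×ˢ range M, c p.1 * c p.2 * t⁻¹ ^ (2 * ((p.1 : ℤ) - p.2) + s) := by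
    rw [Finset.sum_product, Finset.sum_product, Finset.sum_comm]
    refine Finset.sum_congr rfl fun k _ => Finset.sum_congr rfl fun l _ => ?_
    rw [inv_zpow', mul_comm (c l)]
    congr 2
    ring
  rw [h1, h2, ← Finset.sum_sub_distrib, ← Finset.sum_neg_distrib]
  refine Finset.sum_congr rfl fun p _ => ?_
  ring

/-- A pair (k, l) contributes the exponent 2(k - l) + s. This is 2j + s for k = l + j and -(2j + s)
for l = k + s + j. The only pairs left over, l = k + 1 with s = 2, have exponent 0 and contribute
nothing. -/
lemma sum_pairs_eq (t : ℂ) {s : ℕ} (hs1 : 1 ≤ s) (hs2 : s ≤ 2) (M : ℕ)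
    (C : ℕ → ℕ → ℂ) :
    -∑ p ∈ range M ×ˢ range M, C p.1 p.2 *
        (t ^ (2 * ((p.1 : ℤ) - p.2) + s) - t⁻¹ ^ (2 * ((p.1 : ℤ) - p.2) + s)) =
      ∑ j ∈ range M, (-(∑ p ∈ (range M ×ˢ range M) with p.1 = p.2 + j, C p.1 p.2) +
        ∑ p ∈ (range M ×ˢ range M) with p.2 = p.1 + s + j, C p.1 p.2) *
        (t ^ (2 * j + s) - t⁻¹ ^ (2 * j + s)) := by
  have h1 : ∑ p ∈ (range M ×ˢ range M) with p.2 ≤ p.1, C p.1 p.2 *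
        (t ^ (2 * ((p.1 : ℤ) - p.2) + s) - t⁻¹ ^ (2 * ((p.1 : ℤ) - p.2) + s)) =
      ∑ j ∈ range M, (∑ p ∈ (range M ×ˢ range M) with p.1 = p.2 + j, C p.1 p.2) *
        (t ^ (2 * j + s) - t⁻¹ ^ (2 * j + s)) := by
    rw [← Finset.sum_fiberwise_of_maps_to (t := range M) (g := fun p : ℕ × ℕ => p.1 - p.2)]
    · refine Finset.sum_congr rfl fun j _ => ?_
      rw [Finset.sum_mul, Finset.filter_filter]
      refine Finset.sum_congr ?_ fun p hp => ?_
      · ext p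
        simp only [mem_filter]
        refine and_congr_right fun _ => ?_
        omega
      · have hp' := (mem_filter.1 hp).2
        have e : 2 * ((p.1 : ℤ) - p.2) + s = ((2 * j + s : ℕ) : ℤ) := by
          push_cast
          omega
        rw [e, zpow_natCast, zpow_natCast]
    · intro p hp
      simp only [mem_filter, mem_product, mem_range] at hp ⊢
      omega
  have h2 : ∑ p ∈ (range M ×ˢ range M) with ¬ p.2 ≤ p.1, C p.1 p.2 *
        (t ^ (2 * ((p.1 : ℤ) - p.2) + s) - t⁻¹ ^ (2 * ((p.1 : ℤ) - p.2) + s)) =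
      -∑ j ∈ range M, (∑ p ∈ (range M ×ˢ range M) with p.2 = p.1 + s + j, C p.1 p.2) *
        (t ^ (2 * j + s) - t⁻¹ ^ (2 * j + s)) := by
    rw [← Finset.sum_filter_add_sum_filter_not _ (fun p : ℕ × ℕ => p.1 + s ≤ p.2),
      Finset.filter_filter, Finset.filter_filter]
    rw [Finset.sum_eq_zero (s := (range M ×ˢ range M).filter
      fun p : ℕ × ℕ => ¬ p.2 ≤ p.1 ∧ ¬ p.1 + s ≤ p.2), add_zero]
    · rw [← Finset.sum_fiberwise_of_maps_to (t := range M) (g := fun p : ℕ × ℕ => p.2 - p.1 - s)]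
      · rw [← Finset.sum_neg_distrib]
        refine Finset.sum_congr rfl fun j _ => ?_
        rw [← mul_neg, Finset.sum_mul, Finset.filter_filter]
        refine Finset.sum_congr ?_ fun p hp => ?_
        · ext p
          simp only [mem_filter]
          refine and_congr_right fun _ => ?_
          omega
        · have hp' := (mem_filter.1 hp).2
          have e : 2 * ((p.1 : ℤ) - p.2) + s = -((2 * j + s : ℕ) : ℤ) := by
            push_cast
            omega
          rw [e, zpow_neg, zpow_neg, zpow_natCast, zpow_natCast, inv_pow, inv_inv, neg_sub]
      · intro p hp
        simp only [mem_filter, mem_product, mem_range] at hp ⊢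
        omega
    · intro p hp
      have hp' := (mem_filter.1 hp).2
      have e : 2 * ((p.1 : ℤ) - p.2) + s = 0 := by omega
      simp [e]
  rw [← Finset.sum_filter_add_sum_filter_not _ (fun p : ℕ × ℕ => p.2 ≤ p.1), h1, h2]
  simp only [add_mul, neg_mul, Finset.sum_add_distrib, Finset.sum_neg_distrib]
  ring

/-- It matters that the coefficients α_k(u) of a symbol do not depend on y: the same coefficients
then serve t² and t^{-2}, and later all entries of the matrix. -/
lemma hasExpansion_of_symbol {r s : ℕ} (hr : r ≠ 0) (hs1 : 1 ≤ s) (hs2 : s ≤ 2)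
    {A : ℂ → ℂ → ℂ} {g : PowerSeries ℂ} (hA : ∀ K, HasSymbolUpTo r K A g)
    (hg : PowerSeries.constantCoeff g = 1) :
    HasExpansion (fun t u => (t⁻¹ ^ s - t ^ s) * (A (t ^ 2) u * A (t⁻¹ ^ 2) u))
      (fun j => r * j) (fun j => 2 * j + s) (fun j => -PowerSeries.coeff j g) := by
  intro M
  have hAM := hA M
  obtain ⟨α, h1, h2⟩ := hA M
  -- The factor u^{r(k+l)} exceeds u^{rj} by u^{2rl} for k = l + j, and by u^{2rk+rs} for l = k + s
  -- + j. In the limit only (k, l) = (j, 0) survives.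
  let G : ℕ → ℂ → ℂ := fun j u =>
    -(∑ p ∈ (range M ×ˢ range M) with p.1 = p.2 + j, α p.1 u * α p.2 u * u ^ (2 * r * p.2)) +
      ∑ p ∈ (range M ×ˢ range M) with p.2 = p.1 + s + j,
        α p.1 u * α p.2 u * u ^ (2 * r * p.1 + r * s)
  have hpow : ∀ n : ℕ, Tendsto (fun u : ℂ => u ^ n) (𝓝[≠] 0) (𝓝 (0 ^ n)) := by
    intro n
    have : ContinuousAt (fun u : ℂ => u ^ n) 0 := by fun_prop
    exact this.tendsto.mono_left nhdsWithin_le_nhds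
  refine ⟨G, fun j hj => ?_, fun t ht => ?_⟩
  · have h3 : Tendsto (G j) (𝓝[≠] 0) (𝓝 (-(∑ p ∈ (range M ×ˢ range M) with p.1 = p.2 + j,
        PowerSeries.coeff p.1 g * PowerSeries.coeff p.2 g * 0 ^ (2 * r * p.2)) +
      ∑ p ∈ (range M ×ˢ range M) with p.2 = p.1 + s + j,
        PowerSeries.coeff p.1 g * PowerSeries.coeff p.2 g * 0 ^ (2 * r * p.1 + r * s))) :=
      (tendsto_finsetSum _ fun p _ => ((h1 _).mul (h1 _)).mul (hpow _)).neg.add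
        (tendsto_finsetSum _ fun p _ => ((h1 _).mul (h1 _)).mul (hpow _))
    convert h3 using 2
    rw [Finset.sum_eq_single (j, 0), Finset.sum_eq_zero]
    · simp [hg]
    · intro p _
      rw [zero_pow, mul_zero]
      have := Nat.mul_pos (Nat.pos_of_ne_zero hr) hs1
      omega
    · rintro ⟨k, l⟩ hp hne
      have hp' := (mem_filter.1 hp).2
      simp only at hp'
      have hl : l ≠ 0 := by
        rintro rfl
        exact hne (by simp [hp'])
      simp [hr, hl]
    · intro hnot
      exact absurd (by simp only [mem_filter, mem_product, mem_range]; omega) hnot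
  · have ht2 : t ^ 2 ≠ 0 := pow_ne_zero 2 ht
    have ht2' : t⁻¹ ^ 2 ≠ 0 := pow_ne_zero 2 (inv_ne_zero ht)
    have e1 := (h2 _ ht2).mul (hAM.isBigO_one ht2')
    obtain ⟨l, hl⟩ := tendsto_sum_mul_pow (r := r) M h1 (t ^ 2)
    have e2 := (hl.isBigO_one ℂ).mul (h2 _ ht2')
    simp only [mul_one, one_mul] at e1 e2
    refine ((e1.add e2).const_mul_left (t⁻¹ ^ s - t ^ s)).congr_left fun u => ?_
    have e3 : (t⁻¹ ^ s - t ^ s) * ((∑ k ∈ range M, α k u * (u ^ r * t ^ 2) ^ k) *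
        ∑ l ∈ range M, α l u * (u ^ r * t⁻¹ ^ 2) ^ l) =
        ∑ j ∈ range M, u ^ (r * j) * G j u * (t ^ (2 * j + s) - t⁻¹ ^ (2 * j + s)) := by
      have := sub_mul_sum_mul_sum ht s M (fun k => α k u * (u ^ r) ^ k)
      simp only [mul_assoc, ← mul_pow] at this
      simp only [← mul_assoc] at this ⊢
      rw [this, sum_pairs_eq t hs1 hs2 M
        (fun k l => α k u * (u ^ r) ^ k * α l u * (u ^ r) ^ l)]
      refine Finset.sum_congr rfl fun j _ => ?_
      congr 1
      simp only [G]
      rw [mul_add, mul_neg, Finset.mul_sum, Finset.mul_sum]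
      congr 1
      · congr 1
        refine Finset.sum_congr rfl fun p hp => ?_
        have hp' := (mem_filter.1 hp).2
        rw [hp', ← pow_mul, ← pow_mul, mul_add r, pow_add, show 2 * r * p.2 = r * p.2 + r * p.2 by
          ring, pow_add]
        ring
      · refine Finset.sum_congr rfl fun p hp => ?_
        have hp' := (mem_filter.1 hp).2
        rw [hp', ← pow_mul, ← pow_mul, mul_add r, mul_add r, pow_add, pow_add, pow_add,
          show 2 * r * p.1 = r * p.1 + r * p.1 by ring, pow_add]
        ring
    rw [← e3]
    ring

/-- If the sum of `f` over the three multiples of `t` by cubic roots of unity vanishes, then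
the exponents divisible by `3` do not occur. -/
lemma HasExpansion.trisect {f : ℂ → ℂ → ℂ} {w m : ℕ → ℕ} {γ : ℕ → ℂ} (h : HasExpansion f w m γ)
    {ζ : ℂ} (hζ : 1 + ζ + ζ ^ 2 = 0)
    (hf : ∀ t ≠ 0, ∀ᶠ u in 𝓝[≠] (0 : ℂ), f t u + f (ζ * t) u + f (ζ ^ 2 * t) u = 0)
    {e : ℕ → ℕ} (he : StrictMono e) (hm : ∀ k, ¬ 3 ∣ m k ↔ k ∈ Set.range e) :
    HasExpansion f (fun k => w (e k)) (fun k => m (e k)) (fun k => γ (e k)) := by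
  have hζ3 : ζ ^ 3 = 1 := by linear_combination (ζ - 1) * hζ
  have hζ0 : ζ ≠ 0 := by
    rintro rfl
    norm_num at hζ
  have hζinv : 1 + ζ⁻¹ + ζ⁻¹ ^ 2 = 0 := by
    field_simp
    linear_combination hζ
  have hsum : ∀ ξ : ℂ, 1 + ξ + ξ ^ 2 = 0 → ∀ n : ℕ, 1 + ξ ^ n + (ξ ^ 2) ^ n =
      if 3 ∣ n then 3 else 0 := by
    intro ξ hξ n
    have hξ3 : ξ ^ 3 = 1 := by linear_combination (ξ - 1) * hξ
    obtain ⟨q, rfl | rfl | rfl⟩ : ∃ q, n = 3 * q ∨ n = 3 * q + 1 ∨ n = 3 * q + 2 :=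
      ⟨n / 3, by omega⟩
    · rw [if_pos ⟨q, rfl⟩, pow_mul, ← pow_mul ξ 2, show 2 * (3 * q) = 3 * (2 * q) by ring, pow_mul,
        hξ3]
      norm_num
    · rw [if_neg (by omega), pow_add, pow_mul, ← pow_mul ξ 2,
        show 2 * (3 * q + 1) = 3 * (2 * q) + 2 by ring, pow_add, pow_mul, hξ3]
      linear_combination hξ
    · rw [if_neg (by omega), pow_add, pow_mul, ← pow_mul ξ 2,
        show 2 * (3 * q + 2) = 3 * (2 * q + 1) + 1 by ring, pow_add, pow_mul, hξ3]
      linear_combination hξ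
  intro M
  -- Expanding up to index e(M) ≥ M retains exactly the first M exponents not divisible by 3, with a
  -- small enough error.
  obtain ⟨g, hg1, hg2⟩ := h (e M)
  refine ⟨fun k => g (e k), fun k hk => hg1 _ (he hk), fun t ht => ?_⟩
  have r0 := hg2 t ht
  have r1 := hg2 (ζ * t) (mul_ne_zero hζ0 ht)
  have r2 := hg2 (ζ ^ 2 * t) (mul_ne_zero (pow_ne_zero 2 hζ0) ht)
  -- Subtracting the average over t, ζt, ζ²t leaves f unchanged, removes the terms with 3 ∣ m and
  -- preserves the others.
  have hR := (r0.sub (((r0.add r1).add r2).const_mul_left (1 / 3))).trans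
    (isBigO_pow_pow (he.id_le M))
  refine hR.congr' ?_ EventuallyEq.rfl
  filter_upwards [hf t ht] with u hu
  have hD : ∀ k, (t ^ m k - t⁻¹ ^ m k) + ((ζ * t) ^ m k - (ζ * t)⁻¹ ^ m k) +
      ((ζ ^ 2 * t) ^ m k - (ζ ^ 2 * t)⁻¹ ^ m k) =
      (if 3 ∣ m k then 3 else 0) * (t ^ m k - t⁻¹ ^ m k) := by
    intro k
    have a1 := hsum ζ hζ (m k)
    have a2 := hsum ζ⁻¹ hζinv (m k)
    rw [mul_inv, mul_inv, mul_pow, mul_pow, mul_pow, mul_pow, ← inv_pow ζ 2, mul_sub]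
    rw [← a1]
    rw [← a1] at a2
    linear_combination (-t⁻¹ ^ m k) * a2
  have hre : ∑ k ∈ range M, u ^ w (e k) * g (e k) u * (t ^ m (e k) - t⁻¹ ^ m (e k)) =
      ∑ k ∈ range (e M), (u ^ w k * g k u) * ((t ^ m k - t⁻¹ ^ m k) -
        1 / 3 * ((if 3 ∣ m k then 3 else 0) * (t ^ m k - t⁻¹ ^ m k))) := by
    have h1 : ∀ k ∈ range (e M), (u ^ w k * g k u) * ((t ^ m k - t⁻¹ ^ m k) -
        1 / 3 * ((if 3 ∣ m k then 3 else 0) * (t ^ m k - t⁻¹ ^ m k))) =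
        if ¬ 3 ∣ m k then u ^ w k * g k u * (t ^ m k - t⁻¹ ^ m k) else 0 := by
      intro k _
      by_cases h3 : 3 ∣ m k <;> simp [h3]
    rw [Finset.sum_congr rfl h1, ← Finset.sum_filter,
      show (range (e M)).filter (fun k => ¬ 3 ∣ m k) = (range M).image e from ?_,
      Finset.sum_image fun a _ b _ hab => he.injective hab]
    ext k
    simp only [mem_filter, mem_range, mem_image, hm, Set.mem_range]
    constructor
    · rintro ⟨hk, j, rfl⟩
      exact ⟨j, he.lt_iff_lt.1 hk, rfl⟩
    · rintro ⟨j, hj, rfl⟩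
      exact ⟨he hj, j, rfl⟩
  have hsub : ∑ k ∈ range (e M), (u ^ w k * g k u) * ((t ^ m k - t⁻¹ ^ m k) -
        1 / 3 * ((if 3 ∣ m k then 3 else 0) * (t ^ m k - t⁻¹ ^ m k))) =
      (∑ k ∈ range (e M), u ^ w k * g k u * (t ^ m k - t⁻¹ ^ m k)) -
      1 / 3 * ((∑ k ∈ range (e M), u ^ w k * g k u * (t ^ m k - t⁻¹ ^ m k)) +
        (∑ k ∈ range (e M), u ^ w k * g k u * ((ζ * t) ^ m k - (ζ * t)⁻¹ ^ m k)) +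
        ∑ k ∈ range (e M), u ^ w k * g k u * ((ζ ^ 2 * t) ^ m k - (ζ ^ 2 * t)⁻¹ ^ m k)) := by
    rw [← Finset.sum_add_distrib, ← Finset.sum_add_distrib, Finset.mul_sum,
      ← Finset.sum_sub_distrib]
    refine Finset.sum_congr rfl fun k _ => ?_
    rw [← hD k]
    ring
  rw [hre, hsub]
  linear_combination (-(1 / 3 : ℂ)) * hu

end EllipticPfaffian

/-! ### From expansions of the entries to the leading term of the pfaffian. -/

namespace EllipticPfaffian

open Finset Filter Topology Asymptotics

/-! ### Leading behaviour of pfaffians -/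

/-- Exchange argument: the values of κ outside {0, …, n-1} are as numerous as the missing elements
of that set, and each has larger weight than any of these. -/
lemma sum_range_lt_sum_comp {n : ℕ} {w : ℕ → ℕ} (hw : StrictMono w) {κ : Fin n → ℕ}
    (hκ : Function.Injective κ) {i₀ : Fin n} (hi : n ≤ κ i₀) :
    ∑ k ∈ range n, w k < ∑ i, w (κ i) := by
  have h1 : ∑ i, w (κ i) = ∑ k ∈ univ.image κ, w k :=
    (Finset.sum_image fun a _ b _ hab => hκ hab).symm
  have hcard : (univ.image κ).card = (range n).card := by
    rw [card_image_of_injective _ hκ, card_univ, Fintype.card_fin, card_range]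
  have hcard' : (range n \ univ.image κ).card = (univ.image κ \ range n).card := by
    have a1 := card_sdiff_add_card_inter (range n) (univ.image κ)
    have a2 := card_sdiff_add_card_inter (univ.image κ) (range n)
    rw [inter_comm] at a2
    omega
  have hne : (univ.image κ \ range n).Nonempty :=
    ⟨κ i₀, mem_sdiff.2 ⟨mem_image_of_mem _ (mem_univ _), by simpa using hi⟩⟩
  have hne' : (range n \ univ.image κ).Nonempty := by
    rw [← card_pos, hcard', card_pos]
    exact hne
  have h2 : ∑ k ∈ range n \ univ.image κ, w k < (range n \ univ.image κ).card • w n := by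
    rw [← sum_const]
    exact sum_lt_sum_of_nonempty hne' fun k hk => hw (mem_range.1 (mem_sdiff.1 hk).1)
  have h3 : (univ.image κ \ range n).card • w n ≤ ∑ k ∈ univ.image κ \ range n, w k := by
    rw [← sum_const]
    refine sum_le_sum fun k hk => hw.monotone ?_
    have := (mem_sdiff.1 hk).2
    simpa using this
  rw [h1, ← sum_inter_add_sum_sdiff (range n) (univ.image κ),
    ← sum_inter_add_sum_sdiff (univ.image κ) (range n), inter_comm (univ.image κ)]
  rw [hcard'] at h2
  omega

lemma isBigO_prod_sub_prod {ι α : Type*} {l : Filter α} {h : α → ℂ} (s : Finset ι)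
    {A B : ι → α → ℂ} (hA : ∀ i, A i =O[l] fun _ => (1 : ℂ)) (hB : ∀ i, B i =O[l] fun _ => (1 : ℂ))
    (hAB : ∀ i, (fun u => A i u - B i u) =O[l] h) :
    (fun u => ∏ i ∈ s, A i u - ∏ i ∈ s, B i u) =O[l] h := by
  classical
  induction s using Finset.induction_on with
  | empty => simpa using isBigO_zero h l
  | insert a s ha ih =>
    have hP : (fun u => ∏ i ∈ s, A i u) =O[l] fun _ => (1 : ℂ) := by
      simpa using IsBigO.finsetProd (s := s) (g := fun _ _ => (1 : ℂ)) fun i _ => hA i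
    have e1 := (hAB a).mul hP
    have e2 := (hB a).mul ih
    simp only [mul_one, one_mul] at e1 e2
    refine (e1.add e2).congr_left fun u => ?_
    rw [prod_insert ha, prod_insert ha]
    ring

lemma isBigO_pfaffian_sub {n : ℕ} {α : Type*} {l : Filter α} {h : α → ℂ}
    {A B : Fin (2 * n) → Fin (2 * n) → α → ℂ} (hA : ∀ i j, A i j =O[l] fun _ => (1 : ℂ))
    (hB : ∀ i j, B i j =O[l] fun _ => (1 : ℂ)) (hAB : ∀ i j, (fun u => A i j u - B i j u) =O[l] h) :
    (fun u => pfaffian (Matrix.of fun i j => A i j u) - pfaffian (Matrix.of fun i j => B i j u))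
      =O[l] h := by
  have h1 : ∀ s : Equiv.Perm (Fin (2 * n)), (fun u => ((Equiv.Perm.sign s : ℤ) : ℂ) *
      (∏ k, A (s (evenPos k)) (s (oddPos k)) u - ∏ k, B (s (evenPos k)) (s (oddPos k)) u)) =O[l] h :=
    fun s => (isBigO_prod_sub_prod univ (fun k => hA _ _) (fun k => hB _ _)
      fun k => hAB _ _).const_mul_left _
  refine ((IsBigO.sum (s := univ) fun s _ => h1 s).const_mul_left
    (1 / (2 ^ n * (n.factorial : ℂ)))).congr_left fun u => ?_
  simp only [pfaffian, Matrix.of_apply, mul_sub, sum_sub_distrib, Finset.sum_apply]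

/-- Among the index maps κ in the expansion, those that are not injective give a zero determinant,
and injective ones with a value ≥ n carry a higher power of u. The n! rearrangements of 0, …, n-1
all contribute the same limit. -/
lemma tendsto_pfaffian_monomials {n M : ℕ} (hM : n ≤ M) {w : ℕ → ℕ} (hw : StrictMono w)
    (g : ℕ → ℂ → ℂ) (γ : ℕ → ℂ) (hg : ∀ k < M, Tendsto (g k) (𝓝[≠] 0) (𝓝 (γ k)))
    (φ ψ : ℕ → Fin (2 * n) → ℂ) :
    Tendsto (fun u => pfaffian (Matrix.of fun i j =>
        ∑ k : Fin M, u ^ w k * g k u * (φ k i * ψ k j - φ k j * ψ k i)) / u ^ ∑ k ∈ range n, w k)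
      (𝓝[≠] 0) (𝓝 ((∏ k ∈ range n, γ k) *
        (interleave (fun (k : Fin n) i => φ k i) (fun k i => ψ k i)).det)) := by
  classical
  set V := (∏ k ∈ range n, γ k) *
        (interleave (fun (k : Fin n) i => φ k i) (fun k i => ψ k i)).det with hV
  let Ψ : Equiv.Perm (Fin n) → Fin n → Fin M := fun α i => Fin.castLE hM (α i)
  have hΨ : Function.Injective Ψ := by
    intro α β h
    ext i
    simpa [Ψ] using congrArg Fin.val (congrFun h i)
  have hterm : ∀ κ : Fin n → Fin M, Tendsto (fun u : ℂ =>
      (∏ i, u ^ w (κ i) * g (κ i) u) *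
        (interleave (fun i => φ (κ i)) (fun i => ψ (κ i))).det / u ^ ∑ k ∈ range n, w k) (𝓝[≠] 0)
      (𝓝 (if κ ∈ univ.image Ψ then V else 0)) := by
    intro κ
    by_cases hinj : Function.Injective κ
    · by_cases hlt : ∀ i, (κ i : ℕ) < n
      · have hbij : Function.Bijective fun i => (⟨κ i, hlt i⟩ : Fin n) := by
          refine Finite.injective_iff_bijective.1 fun a b hab => hinj ?_
          ext
          simpa using hab
        let α : Equiv.Perm (Fin n) := Equiv.ofBijective _ hbij
        have hα : Ψ α = κ := by
          ext i
          simp [Ψ, α]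
        have hval : ∀ i, (κ i : ℕ) = (α i : Fin n) := fun i => rfl
        rw [if_pos (by rw [← hα]; exact mem_image_of_mem _ (mem_univ _))]
        have hdet : (interleave (fun i => φ (κ i)) (fun i => ψ (κ i))).det =
            (interleave (fun (k : Fin n) i => φ k i) (fun k i => ψ k i)).det := by
          rw [← det_interleave_comp (fun (k : Fin n) i => φ k i) (fun k i => ψ k i) α]
          rfl
        have hγ : Tendsto (fun u => ∏ i, g (κ i) u) (𝓝[≠] 0)
            (𝓝 (∏ k ∈ range n, γ k)) := by
          rw [← Fin.prod_univ_eq_prod_range, ← Equiv.prod_comp α]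
          exact tendsto_finsetProd _ fun i _ => hg _ (κ i).2
        have hwt : ∑ k ∈ range n, w k = ∑ i, w (κ i) := by
          rw [← Fin.sum_univ_eq_sum_range, ← Equiv.sum_comp α]
          rfl
        rw [hV, ← hdet]
        refine (hγ.mul_const _).congr' ?_
        filter_upwards [self_mem_nhdsWithin] with u hu
        rw [prod_mul_distrib, prod_pow_eq_pow_sum, hwt]
        have : u ^ ∑ i, w (κ i) ≠ 0 := pow_ne_zero _ hu
        field_simp
      · push Not at hlt
        obtain ⟨i₀, hi₀⟩ := hlt
        rw [if_neg]
        · have hlt := sum_range_lt_sum_comp hw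
            (fun a b hab => hinj (Fin.ext hab) : Function.Injective fun i => (κ i : ℕ)) hi₀
          obtain ⟨d, hd⟩ := Nat.exists_eq_add_of_lt hlt
          have hγ : Tendsto (fun u => ∏ i, g (κ i) u) (𝓝[≠] 0) (𝓝 (∏ i, γ (κ i))) :=
            tendsto_finsetProd _ fun i _ => hg _ (κ i).2
          have hu0 : Tendsto (fun u : ℂ => u ^ (d + 1)) (𝓝[≠] 0) (𝓝 0) := by
            have : ContinuousAt (fun u : ℂ => u ^ (d + 1)) 0 := by fun_prop
            simpa [ContinuousAt] using this.tendsto.mono_left nhdsWithin_le_nhds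
          have := (hu0.mul hγ).mul_const
            (interleave (fun i => φ (κ i)) (fun i => ψ (κ i))).det
          rw [zero_mul, zero_mul] at this
          refine this.congr' ?_
          filter_upwards [self_mem_nhdsWithin] with u hu
          have h0 : u ^ ∑ k ∈ range n, w k ≠ 0 := pow_ne_zero _ hu
          rw [prod_mul_distrib, prod_pow_eq_pow_sum, hd, add_assoc, pow_add _ _ (d + 1)]
          rw [mul_assoc (u ^ ∑ k ∈ range n, w k), mul_assoc (u ^ ∑ k ∈ range n, w k),
            mul_div_cancel_left₀ _ h0]
        · intro hmem
          obtain ⟨α, -, hα⟩ := mem_image.1 hmem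
          have : (κ i₀ : ℕ) < n := by
            rw [← hα]
            simp [Ψ]
          omega
    · have hdet : (interleave (fun i => φ (κ i)) (fun i => ψ (κ i))).det = 0 := by
        simp only [Function.Injective, not_forall] at hinj
        obtain ⟨a, b, hab, hne⟩ := hinj
        exact det_interleave_eq_zero _ _ hne (by rw [hab])
      rw [if_neg]
      · simp only [hdet, mul_zero, zero_div]
        exact tendsto_const_nhds
      · intro hmem
        obtain ⟨α, -, hα⟩ := mem_image.1 hmem
        apply hinj
        rw [← hα]
        exact (Fin.castLE_injective hM).comp α.injective
  have hsum := (tendsto_finsetSum univ fun κ _ => hterm κ).const_mul (1 / (n.factorial : ℂ))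
  have hlim : 1 / (n.factorial : ℂ) *
      ∑ κ : Fin n → Fin M, (if κ ∈ univ.image Ψ then V else 0) = V := by
    rw [sum_ite_mem, univ_inter, sum_const, card_image_of_injective _ hΨ, card_univ,
      Fintype.card_perm, Fintype.card_fin, nsmul_eq_mul]
    have : (n.factorial : ℂ) ≠ 0 := by exact_mod_cast n.factorial_ne_zero
    field_simp
  rw [hlim] at hsum
  refine hsum.congr fun u => ?_
  rw [pfaffian_sum (fun k : Fin M => u ^ w k * g k u) (fun k => φ k) (fun k => ψ k), mul_div_assoc,
    sum_div]

theorem tendsto_pfaffian {n : ℕ} {f : ℂ → ℂ → ℂ} {w m : ℕ → ℕ} {γ : ℕ → ℂ}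
    (h : HasExpansion f w m γ) (hw : StrictMono w) (x : Fin (2 * n) → ℂ) (hx : ∀ i, x i ≠ 0) :
    Tendsto (fun u => pfaffian (Matrix.of fun i j => f (x i / x j) u) / u ^ ∑ k ∈ range n, w k)
      (𝓝[≠] 0) (𝓝 ((∏ k ∈ range n, γ k) *
        (interleave (fun (k : Fin n) i => x i ^ m k) (fun k i => (x i)⁻¹ ^ m k)).det)) := by
  set N := ∑ k ∈ range n, w k with hN
  -- Truncation here makes the error o(u^N) and still includes the first n terms.
  obtain ⟨g, hg1, hg2⟩ := h (N + n + 1)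
  have hF := tendsto_pfaffian_monomials (n := n) (M := N + n + 1) (by omega) hw g γ hg1
    (fun k i => x i ^ m k) (fun k i => (x i)⁻¹ ^ m k)
  rw [← hN] at hF
  let F : Fin (2 * n) → Fin (2 * n) → ℂ → ℂ := fun i j u => ∑ k : Fin (N + n + 1),
    u ^ w k * g k u * (x i ^ m k * (x j)⁻¹ ^ m k - x j ^ m k * (x i)⁻¹ ^ m k)
  have hsub : ∀ i j, (fun u => f (x i / x j) u - F i j u) =O[𝓝[≠] 0] fun u => u ^ (N + n + 1) := by
    intro i j
    refine (hg2 _ (div_ne_zero (hx i) (hx j))).congr_left fun u => ?_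
    simp only [F]
    rw [← Fin.sum_univ_eq_sum_range
      (fun k => u ^ w k * g k u * ((x i / x j) ^ m k - (x i / x j)⁻¹ ^ m k))]
    congr 1
    refine sum_congr rfl fun k _ => ?_
    rw [inv_div, div_eq_mul_inv, div_eq_mul_inv, mul_pow, mul_pow]
  have hpow1 : ∀ d : ℕ, (fun u : ℂ => u ^ d) =O[𝓝[≠] 0] fun _ => (1 : ℂ) := fun d => by
    simpa using isBigO_pow_pow (Nat.zero_le d)
  have hpow : ∀ d : ℕ, Tendsto (fun u : ℂ => u ^ d) (𝓝[≠] 0) (𝓝 (0 ^ d)) := fun d =>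
    (by fun_prop : ContinuousAt (fun u : ℂ => u ^ d) 0).tendsto.mono_left nhdsWithin_le_nhds
  have hF1 : ∀ i j, F i j =O[𝓝[≠] 0] fun _ => (1 : ℂ) := by
    intro i j
    exact Tendsto.isBigO_one ℂ (tendsto_finsetSum univ fun k _ =>
      ((hpow (w k)).mul (hg1 k k.2)).mul_const _)
  have hf1 : ∀ i j, (fun u => f (x i / x j) u) =O[𝓝[≠] 0] fun _ => (1 : ℂ) := by
    intro i j
    refine (((hsub i j).trans (hpow1 _)).add (hF1 i j)).congr_left fun u => ?_
    ring
  have hdiff := isBigO_pfaffian_sub hf1 hF1 hsub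
  have hzero : Tendsto (fun u => (pfaffian (Matrix.of fun i j => f (x i / x j) u) -
      pfaffian (Matrix.of fun i j => F i j u)) / u ^ N) (𝓝[≠] 0) (𝓝 0) := by
    have h1 : (fun u => (pfaffian (Matrix.of fun i j => f (x i / x j) u) -
      pfaffian (Matrix.of fun i j => F i j u)) / u ^ N) =O[𝓝[≠] 0] fun u : ℂ => u := by
      have h2 := hdiff.mul (isBigO_refl (fun u : ℂ => (u ^ N)⁻¹) (𝓝[≠] 0))
      have h3 : (fun u : ℂ => u ^ (N + n + 1) * (u ^ N)⁻¹) =O[𝓝[≠] 0] fun u : ℂ => u := by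
        have h4 := isBigO_pow_pow (show 1 ≤ n + 1 by omega)
        simp only [pow_one] at h4
        refine h4.congr' ?_ EventuallyEq.rfl
        filter_upwards [self_mem_nhdsWithin] with u hu
        have : u ^ N ≠ 0 := pow_ne_zero _ hu
        rw [add_assoc, pow_add u N, mul_comm (u ^ N), mul_inv_cancel_right₀ this]
      exact h2.trans h3
    exact h1.trans_tendsto (tendsto_id.mono_left nhdsWithin_le_nhds)
  have := hzero.add hF
  rw [zero_add] at this
  refine this.congr fun u => ?_
  simp only [F]
  ring

/-- As `den` tends to 1, for small u the cleared form is a genuine pfaffian times a product tending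
to 1. The factor `E` is kept apart because it may vanish. -/
theorem tendsto_pform_div_pow {n s : ℕ} {num den : ℂ → ℂ → ℂ}
    (hden : ∀ y ≠ 0, Tendsto (den y) (𝓝[≠] 0) (𝓝 1)) {w m : ℕ → ℕ} {γ : ℕ → ℂ}
    (h : HasExpansion (fun t u => (t⁻¹ ^ s - t ^ s) *
      ((num (t ^ 2) u * (den (t ^ 2) u)⁻¹) * (num (t⁻¹ ^ 2) u * (den (t⁻¹ ^ 2) u)⁻¹))) w m γ)
    (hw : StrictMono w) (E : Fin (2 * n) → Fin (2 * n) → ℂ) (hE : ∀ i j, E i j = E j i)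
    (x : Fin (2 * n) → ℂ) (hx : ∀ i, x i ≠ 0) :
    Tendsto (fun u => pform
        (fun i j => E i j * (((x i / x j)⁻¹ ^ s - (x i / x j) ^ s) *
          (num ((x i / x j) ^ 2) u * num ((x i / x j)⁻¹ ^ 2) u)))
        (fun i j => E i j * (den ((x i / x j) ^ 2) u * den ((x i / x j)⁻¹ ^ 2) u)) /
          u ^ ∑ k ∈ range n, w k)
      (𝓝[≠] 0) (𝓝 ((∏ i, ∏ j ∈ Ioi i, E i j) * ((∏ k ∈ range n, γ k) *
        (interleave (fun (k : Fin n) i => x i ^ m k) (fun k i => (x i)⁻¹ ^ m k)).det))) := by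
  have ht : ∀ i j, (x i / x j) ^ 2 ≠ 0 := fun i j => pow_ne_zero 2 (div_ne_zero (hx i) (hx j))
  have ht' : ∀ i j, (x i / x j)⁻¹ ^ 2 ≠ 0 := fun i j =>
    pow_ne_zero 2 (inv_ne_zero (div_ne_zero (hx i) (hx j)))
  let W : Fin (2 * n) → Fin (2 * n) → ℂ → ℂ := fun i j u =>
    den ((x i / x j) ^ 2) u * den ((x i / x j)⁻¹ ^ 2) u
  have hW1 : ∀ i j, Tendsto (W i j) (𝓝[≠] 0) (𝓝 1) := fun i j => by
    simpa only [mul_one] using (hden _ (ht i j)).mul (hden _ (ht' i j))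
  have hWne : ∀ᶠ u in 𝓝[≠] (0 : ℂ), ∀ i j, W i j u ≠ 0 :=
    eventually_all.2 fun i => eventually_all.2 fun j => (hW1 i j).eventually_ne one_ne_zero
  have hprod : Tendsto (fun u => ∏ i, ∏ j ∈ Ioi i, W i j u) (𝓝[≠] 0) (𝓝 1) := by
    simpa using tendsto_finsetProd univ fun i _ => tendsto_finsetProd (Ioi i) fun j _ => hW1 i j
  have := (hprod.mul (tendsto_pfaffian h hw x hx)).const_mul (∏ i, ∏ j ∈ Ioi i, E i j)
  rw [one_mul] at this
  refine this.congr' ?_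
  filter_upwards [hWne] with u hu
  rw [pform_mul_mul E _ _ hE, pform_eq_pfaffian _ (fun i j => W i j u) _ fun i j _ => hu i j]
  · rw [mul_div_assoc, mul_div_assoc]
    congr 4
    ext i j
    simp only [Matrix.of_apply, W]
    rw [div_eq_mul_inv, mul_inv]
    ring
  · intro i j
    simp only [W]
    rw [← inv_div (x i) (x j), inv_inv, mul_comm]

end EllipticPfaffian

/-! ### From limits in u = p^{1/3} to Taylor expansions in p^{1/3}. -/

namespace EllipticPfaffian

open Finset Filter Topology

/-! ### Leading terms of functions of the nome -/

/-- The limit makes 0 a removable singularity of Q/u^N. The Taylor series of the extended quotient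
converges on the whole unit disc, hence for every τ, and begins with L(z). -/
lemma isLeadingTerm_of_tendsto {m : ℕ} {f : (Fin m → ℂ) → ℍ → ℂ} {Q : (Fin m → ℂ) → ℂ → ℂ}
    {L : (Fin m → ℂ) → ℂ} {N : ℕ} {a : ℚ} (ha : (N : ℚ) / 3 = a)
    (hf : ∀ z τ, f z τ = Q z (nomePow τ (1 / 3)))
    (hQ : ∀ z, DifferentiableOn ℂ (Q z) (Metric.ball 0 1))
    (hlim : ∀ z, Tendsto (fun u => Q z u / u ^ N) (𝓝[≠] 0) (𝓝 (L z))) (hL : L ≠ 0) :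
    IsLeadingTerm f a L := by
  let g : (Fin m → ℂ) → ℂ → ℂ := fun z => Function.update (fun u => Q z u / u ^ N) 0 (L z)
  have hg : ∀ z, DifferentiableOn ℂ (g z) (Metric.ball 0 1) := by
    intro z
    rw [← Complex.differentiableOn_compl_singleton_and_continuousAt_iff
      (Metric.ball_mem_nhds (0 : ℂ) one_pos)]
    refine ⟨?_, continuousAt_update_same.2 (hlim z)⟩
    refine DifferentiableOn.congr (f := fun u => Q z u / u ^ N) ?_ fun u hu =>
      Function.update_of_ne hu.2 _ _
    exact ((hQ z).mono Set.sdiff_subset).div (by fun_prop) fun u hu => pow_ne_zero N hu.2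
  let c : ℕ → (Fin m → ℂ) → ℂ := fun k z =>
    if k < N then 0 else ((k - N).factorial : ℂ)⁻¹ * iteratedDeriv (k - N) (g z) 0
  refine ⟨c, fun z τ => ?_, N, ha, fun j hj => ?_, ?_, hL⟩
  · set u := nomePow τ (1 / 3) with hu
    have hu0 : u ≠ 0 := nomePow_ne_zero _ _
    have hpow : ∀ k : ℕ, nomePow τ ((k : ℚ) / 3) = u ^ k := by
      intro k
      rw [hu, nomePow, nomePow, ← Complex.exp_nat_mul]
      congr 1
      push_cast
      ring
    have h1 := Complex.hasSum_taylorSeries_on_ball (hg z)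
      (mem_ball_zero_iff.2 (norm_nomePow_lt_one τ (by norm_num : (0 : ℚ) < 1 / 3)))
    rw [← hu] at h1
    have h2 : g z u = Q z u / u ^ N := Function.update_of_ne hu0 _ _
    have h3 := h1.mul_right (u ^ N)
    rw [h2, div_mul_cancel₀ _ (pow_ne_zero N hu0)] at h3
    rw [hf]
    refine ((add_left_injective N).hasSum_iff fun k hk => ?_).1 (h3.congr_fun fun k => ?_)
    · have : k < N := by
        by_contra hkN
        exact hk ⟨k - N, by simp only; omega⟩
      simp [c, this]
    · simp only [Function.comp_apply, c, hpow, smul_eq_mul, sub_zero]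
      rw [if_neg (by omega), Nat.add_sub_cancel, pow_add]
      ring
  · funext z
    simp [c, hj]
  · funext z
    simp [c, g]

/-- It suffices to choose z with x_j^d = 2^j, where the alternant is nonzero. -/
lemma exists_altDet_mulVar_ne_zero {m d : ℕ} (hd : d ≠ 0) {c : ℂ} (hc : c ≠ 0) (e : ℤ)
    {lam : Fin m → ℕ} (hlam : Antitone lam) :
    (fun z : Fin m → ℂ => c * (∏ j, mulVar z j) ^ e * altDet lam fun j => mulVar z j ^ d) ≠ 0 := by
  obtain ⟨z, hz⟩ := exists_mulVar_pow_eq hd (fun j : Fin m => (2 : ℂ) ^ (j : ℕ))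
    fun j => pow_ne_zero _ two_ne_zero
  intro h
  have h1 := congrFun h z
  simp only [hz, Pi.zero_apply] at h1
  refine mul_ne_zero (mul_ne_zero hc (zpow_ne_zero _ (prod_ne_zero_iff.2 fun j _ =>
    mulVar_ne_zero z j))) (altDet_ne_zero lam (altDet_injective_of_antitone lam hlam)) h1

lemma differentiableOn_pform {n : ℕ} {s : Set ℂ} {N W : Fin (2 * n) → Fin (2 * n) → ℂ → ℂ}
    (hN : ∀ i j, DifferentiableOn ℂ (N i j) s) (hW : ∀ i j, DifferentiableOn ℂ (W i j) s) :
    DifferentiableOn ℂ (fun u => pform (fun i j => N i j u) fun i j => W i j u) s := by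
  unfold pform
  refine DifferentiableOn.const_mul (DifferentiableOn.fun_sum fun s _ =>
    DifferentiableOn.const_mul (DifferentiableOn.mul ?_ ?_) _) _
  · exact DifferentiableOn.fun_finsetProd fun k _ => hN _ _
  · exact DifferentiableOn.fun_finsetProd fun i _ => DifferentiableOn.fun_finsetProd fun j _ => hW _ _

theorem isLeadingTerm_P_of_tendsto {σ : Label} {n : ℕ}
    (N W : (Fin (2 * n) → ℂ) → Fin (2 * n) → Fin (2 * n) → ℂ → ℂ)
    (hN : ∀ z τ i j, numer σ z τ i j = N z i j (nomePow τ (1 / 3)))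
    (hW : ∀ z τ i j, prefactor σ z τ i j = W z i j (nomePow τ (1 / 3)))
    (hN' : ∀ z i j, DifferentiableOn ℂ (N z i j) (Metric.ball 0 1))
    (hW' : ∀ z i j, DifferentiableOn ℂ (W z i j) (Metric.ball 0 1)) {M : ℕ} {a : ℚ}
    (ha : (M : ℚ) / 3 = a) {c : ℂ} (hc : c ≠ 0) (e : ℤ) {d : ℕ} (hd : d ≠ 0)
    {lam : Fin (2 * n) → ℕ} (hlam : Antitone lam)
    (hlim : ∀ z, Tendsto (fun u => pform (fun i j => N z i j u) (fun i j => W z i j u) / u ^ M)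
      (𝓝[≠] 0) (𝓝 (c * (∏ j, mulVar z j) ^ e * altDet lam fun j => mulVar z j ^ d))) :
    IsLeadingTerm (P σ n) a
      (fun z => c * (∏ j, mulVar z j) ^ e * altDet lam fun j => mulVar z j ^ d) := by
  refine isLeadingTerm_of_tendsto (Q := fun z u => pform (fun i j => N z i j u) fun i j => W z i j u)
    ha (fun z τ => ?_) (fun z => differentiableOn_pform (hN' z) (hW' z)) hlim
    (exists_altDet_mulVar_ne_zero hd hc e hlam)
  rw [P_eq_pform]
  exact pform_congr (hN z τ) (hW z τ)

theorem isLeadingTerm_P_of_hasExpansion {σ : Label} {n s : ℕ} {num den : ℂ → ℂ → ℂ} {E : ℂ → ℂ}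
    (hE : ∀ t, E t⁻¹ = E t)
    (hnum : ∀ (z : Fin (2 * n) → ℂ) τ i j, numer σ z τ i j = E (mulVar z i / mulVar z j) *
      (((mulVar z i / mulVar z j)⁻¹ ^ s - (mulVar z i / mulVar z j) ^ s) *
        (num ((mulVar z i / mulVar z j) ^ 2) (nomePow τ (1 / 3)) *
          num ((mulVar z i / mulVar z j)⁻¹ ^ 2) (nomePow τ (1 / 3)))))
    (hden : ∀ (z : Fin (2 * n) → ℂ) τ i j, prefactor σ z τ i j = E (mulVar z i / mulVar z j) *
        (den ((mulVar z i / mulVar z j) ^ 2) (nomePow τ (1 / 3)) *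
          den ((mulVar z i / mulVar z j)⁻¹ ^ 2) (nomePow τ (1 / 3))))
    (dnum : ∀ y, DifferentiableOn ℂ (num y) (Metric.ball 0 1))
    (dden : ∀ y, DifferentiableOn ℂ (den y) (Metric.ball 0 1))
    (lden : ∀ y, Tendsto (den y) (𝓝[≠] 0) (𝓝 1)) {w m : ℕ → ℕ} {γ : ℕ → ℂ}
    (h : HasExpansion (fun t u => (t⁻¹ ^ s - t ^ s) *
      ((num (t ^ 2) u * (den (t ^ 2) u)⁻¹) * (num (t⁻¹ ^ 2) u * (den (t⁻¹ ^ 2) u)⁻¹))) w m γ)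
    (hw : StrictMono w) {a : ℚ} (ha : ((∑ k ∈ range n, w k : ℕ) : ℚ) / 3 = a) {c : ℂ} (hc : c ≠ 0)
    (e : ℤ) {d : ℕ} (hd : d ≠ 0) {lam : Fin (2 * n) → ℕ} (hlam : Antitone lam)
    (hL : ∀ x : Fin (2 * n) → ℂ, (∀ i, x i ≠ 0) →
      (∏ i, ∏ j ∈ Ioi i, E (x i / x j)) * ((∏ k ∈ range n, γ k) *
        (interleave (fun (k : Fin n) i => x i ^ m k) (fun k i => (x i)⁻¹ ^ m k)).det) =
        c * (∏ j, x j) ^ e * altDet lam fun j => x j ^ d) :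
    IsLeadingTerm (P σ n) a
      (fun z => c * (∏ j, mulVar z j) ^ e * altDet lam fun j => mulVar z j ^ d) := by
  refine isLeadingTerm_P_of_tendsto
    (fun z i j u => E (mulVar z i / mulVar z j) *
      (((mulVar z i / mulVar z j)⁻¹ ^ s - (mulVar z i / mulVar z j) ^ s) *
        (num ((mulVar z i / mulVar z j) ^ 2) u * num ((mulVar z i / mulVar z j)⁻¹ ^ 2) u)))
    (fun z i j u => E (mulVar z i / mulVar z j) *
        (den ((mulVar z i / mulVar z j) ^ 2) u * den ((mulVar z i / mulVar z j)⁻¹ ^ 2) u))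
    hnum hden (fun z i j => (((dnum _).mul (dnum _)).const_mul _).const_mul _)
    (fun z i j => ((dden _).mul (dden _)).const_mul _) ha hc e hd hlam fun z => ?_
  rw [← hL _ (mulVar_ne_zero z)]
  exact tendsto_pform_div_pow (fun y _ => lden y) h hw (fun i j => E (mulVar z i / mulVar z j))
    (fun i j => by rw [← hE, inv_div]) (mulVar z) (mulVar_ne_zero z)

/-! ### The theta functions as functions of the nome -/

/-- Removing the factor 1 - c, which does not involve u, leaves two halves exchanged by c ↦ 1/c.
This is the source of the shape A(t²) A(t^{-2}). -/
lemma theta_pow_eq_qp (c : ℂ) {b : ℕ} (hb : b ≠ 0) {u : ℂ} (hu : ‖u‖ < 1) :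
    theta c (u ^ b) = (1 - c) * (qp c b b u * qp c⁻¹ b b u) := by
  unfold theta qp
  rw [qPoch_shift c (norm_pow_lt_one hu hb), div_eq_inv_mul, mul_assoc]

lemma theta_mid_eq_qp (c : ℂ) (a : ℕ) {u : ℂ} (hu : u ≠ 0) :
    theta (u ^ a * c) (u ^ (2 * a)) = qp c a (2 * a) u * qp c⁻¹ a (2 * a) u := by
  have h : u ^ (2 * a) / (u ^ a * c) = c⁻¹ * u ^ a := by
    rw [two_mul, pow_add, mul_div_mul_left _ _ (pow_ne_zero a hu), div_eq_inv_mul]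
  unfold theta qp
  rw [h, mul_comm c]

lemma qp_mul_qp_neg (c : ℂ) (a : ℕ) {b : ℕ} (hb : b ≠ 0) {u : ℂ} (hu : ‖u‖ < 1) :
    qp c a b u * qp (-c) a b u = qp (c ^ 2) (2 * a) (2 * b) u := by
  have hq := norm_pow_lt_one hu hb
  unfold qp qPoch
  rw [← (multipliable_qPoch _ hq).tprod_mul (multipliable_qPoch _ hq)]
  refine tprod_congr fun j => ?_
  ring

lemma nomePow_eq_pow (τ : ℍ) (k : ℕ) {a : ℚ} (ha : a = k / 3) :
    nomePow τ a = nomePow τ (1 / 3) ^ k := by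
  rw [ha, nomePow, nomePow, ← Complex.exp_nat_mul]
  congr 1
  push_cast
  ring

/-- One half of the product `θ(y, -y, p y; p²)`, as a function of `u = p^{1/3}`. -/
noncomputable def numA (y u : ℂ) : ℂ := qp y 6 6 u * qp (-y) 6 6 u * qp y 3 6 u

/-- One half of the product `θ(y, p y, -p y; p²)`, as a function of `u = p^{1/3}`. -/
noncomputable def numB (y u : ℂ) : ℂ := qp y 6 6 u * qp y 3 6 u * qp (-y) 3 6 u

lemma differentiableOn_numA (y : ℂ) : DifferentiableOn ℂ (numA y) (Metric.ball 0 1) :=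
  ((differentiableOn_qp _ _ (by norm_num)).mul (differentiableOn_qp _ _ (by norm_num))).mul
    (differentiableOn_qp _ _ (by norm_num))

lemma differentiableOn_numB (y : ℂ) : DifferentiableOn ℂ (numB y) (Metric.ball 0 1) :=
  ((differentiableOn_qp _ _ (by norm_num)).mul (differentiableOn_qp _ _ (by norm_num))).mul
    (differentiableOn_qp _ _ (by norm_num))

lemma tendsto_numA (y : ℂ) : Tendsto (numA y) (𝓝[≠] 0) (𝓝 1) := by
  have := ((tendsto_qp y (a := 6) (b := 6) (by norm_num) (by norm_num)).mul
    (tendsto_qp (-y) (a := 6) (b := 6) (by norm_num) (by norm_num))).mul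
    (tendsto_qp y (a := 3) (b := 6) (by norm_num) (by norm_num))
  rw [mul_one, mul_one] at this
  exact this

lemma tripleA_eq (τ : ℍ) (y : ℂ) :
    tripleA τ y = (1 - y ^ 2) * (numA y (nomePow τ (1 / 3)) * numA y⁻¹ (nomePow τ (1 / 3))) := by
  have hu : ‖nomePow τ (1 / 3)‖ < 1 := norm_nomePow_lt_one τ (by norm_num)
  have hu0 := nomePow_ne_zero τ (1 / 3)
  rw [tripleA, nomePow_eq_pow τ 6 (by norm_num : (2 : ℚ) = (6 : ℕ) / 3),
    nomePow_eq_pow τ 3 (by norm_num : (1 : ℚ) = (3 : ℕ) / 3)]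
  rw [theta_pow_eq_qp y (by norm_num) hu, theta_pow_eq_qp (-y) (by norm_num) hu,
    theta_mid_eq_qp y 3 hu0, numA, numA, inv_neg]
  ring

lemma tripleB_eq (τ : ℍ) (y : ℂ) :
    tripleB τ y = (1 - y) * (numB y (nomePow τ (1 / 3)) * numB y⁻¹ (nomePow τ (1 / 3))) := by
  have hu : ‖nomePow τ (1 / 3)‖ < 1 := norm_nomePow_lt_one τ (by norm_num)
  have hu0 := nomePow_ne_zero τ (1 / 3)
  rw [tripleB, nomePow_eq_pow τ 6 (by norm_num : (2 : ℚ) = (6 : ℕ) / 3),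
    nomePow_eq_pow τ 3 (by norm_num : (1 : ℚ) = (3 : ℕ) / 3), ← mul_neg]
  rw [theta_pow_eq_qp y (by norm_num) hu, theta_mid_eq_qp y 3 hu0, theta_mid_eq_qp (-y) 3 hu0,
    numB, numB, inv_neg]
  ring

lemma div_sq_mul_tripleA (τ : ℍ) {a b : ℂ} (ha : a ≠ 0) (hb : b ≠ 0) :
    b ^ 2 / a ^ 2 * tripleA τ (a ^ 2 / b ^ 2) = ((a / b)⁻¹ ^ 2 - (a / b) ^ 2) *
      (numA ((a / b) ^ 2) (nomePow τ (1 / 3)) * numA ((a / b)⁻¹ ^ 2) (nomePow τ (1 / 3))) := by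
  rw [tripleA_eq, ← mul_assoc, ← div_pow a b, inv_pow (a / b) 2]
  congr 1
  field_simp

lemma div_mul_tripleB (τ : ℍ) {a b : ℂ} (ha : a ≠ 0) (hb : b ≠ 0) :
    b / a * tripleB τ (a ^ 2 / b ^ 2) = ((a / b)⁻¹ ^ 1 - (a / b) ^ 1) *
      (numB ((a / b) ^ 2) (nomePow τ (1 / 3)) * numB ((a / b)⁻¹ ^ 2) (nomePow τ (1 / 3))) := by
  rw [tripleB_eq, ← mul_assoc, ← div_pow a b, inv_pow (a / b) 2]
  congr 1
  field_simp

lemma theta_one_third (τ : ℍ) (a b : ℂ) :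
    theta (nomePow τ (1 / 3) * (a ^ 2 / b ^ 2)) (nomePow τ (2 / 3)) =
      qp ((a / b) ^ 2) 1 2 (nomePow τ (1 / 3)) * qp ((a / b)⁻¹ ^ 2) 1 2 (nomePow τ (1 / 3)) := by
  have := theta_mid_eq_qp ((a / b) ^ 2) 1 (nomePow_ne_zero τ (1 / 3))
  rw [pow_one, mul_one, ← nomePow_eq_pow τ 2 (by norm_num : (2 / 3 : ℚ) = (2 : ℕ) / 3)] at this
  rw [← div_pow, this, inv_pow]

lemma theta_three (τ : ℍ) (a b : ℂ) :
    theta (nomePow τ 3 * (a ^ 6 / b ^ 6)) (nomePow τ 6) =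
      qp (((a / b) ^ 2) ^ 3) 9 18 (nomePow τ (1 / 3)) *
        qp (((a / b)⁻¹ ^ 2) ^ 3) 9 18 (nomePow τ (1 / 3)) := by
  have := theta_mid_eq_qp ((a / b) ^ 6) 9 (nomePow_ne_zero τ (1 / 3))
  rw [nomePow_eq_pow τ 9 (by norm_num : (3 : ℚ) = (9 : ℕ) / 3),
    nomePow_eq_pow τ 18 (by norm_num : (6 : ℚ) = (18 : ℕ) / 3), ← div_pow, this, ← pow_mul,
    ← pow_mul, inv_pow]

end EllipticPfaffian

/-! ### Symbols of the theta quotients, and trisection for σ = 2 and σ = 4. -/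

namespace EllipticPfaffian

open Finset Filter Topology

/-! ### Symbols of the factors -/

lemma hasSymbolUpTo_qp_self {r : ℕ} (hr : r ≠ 0) (K : ℕ) {a b : ℕ} (hb : b ≠ 0) (ha : r ≤ a) :
    HasSymbolUpTo r K (fun y u => qp y a b u) (if a = r then 1 - PowerSeries.X else 1) :=
  (hasSymbolUpTo_qp hr K 1 one_ne_zero hb (by simpa using ha)).congr
    (fun y u _ => by rw [one_mul, pow_one]) (by simp)

lemma hasSymbolUpTo_qp_neg {r : ℕ} (hr : r ≠ 0) (K : ℕ) {a b : ℕ} (hb : b ≠ 0) (ha : r ≤ a) :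
    HasSymbolUpTo r K (fun y u => qp (-y) a b u) (if a = r then 1 + PowerSeries.X else 1) :=
  (hasSymbolUpTo_qp hr K (-1) one_ne_zero hb (by simpa using ha)).congr
    (fun y u _ => by rw [neg_one_mul, pow_one]) (by simp)

lemma hasSymbolUpTo_numA {r : ℕ} (hr : r ≠ 0) (hr' : r ≤ 3) (K : ℕ) :
    HasSymbolUpTo r K numA (if 3 = r then 1 - PowerSeries.X else 1) := by
  refine (((hasSymbolUpTo_qp_self hr K (a := 6) (b := 6) (by norm_num) (by omega)).mul hr
    (hasSymbolUpTo_qp_neg hr K (a := 6) (b := 6) (by norm_num) (by omega))).mul hr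
    (hasSymbolUpTo_qp_self hr K (a := 3) (b := 6) (by norm_num) (by omega))).congr
    (fun y u _ => rfl) ?_
  rw [if_neg (by omega), if_neg (by omega), one_mul, one_mul]

lemma hasSymbolUpTo_numB {r : ℕ} (hr : r ≠ 0) (hr' : r ≤ 3) (K : ℕ) :
    HasSymbolUpTo r K numB (if 3 = r then 1 - PowerSeries.X ^ 2 else 1) := by
  refine (((hasSymbolUpTo_qp_self hr K (a := 6) (b := 6) (by norm_num) (by omega)).mul hr
    (hasSymbolUpTo_qp_self hr K (a := 3) (b := 6) (by norm_num) (by omega))).mul hr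
    (hasSymbolUpTo_qp_neg hr K (a := 3) (b := 6) (by norm_num) (by omega))).congr
    (fun y u _ => rfl) ?_
  rw [if_neg (by omega), one_mul]
  split_ifs <;> ring

lemma hasSymbolUpTo_qp_cube (K : ℕ) :
    HasSymbolUpTo 3 K (fun y u => qp (y ^ 3) 9 18 u) (1 - PowerSeries.X ^ 3) :=
  (hasSymbolUpTo_qp (by norm_num) K 1 (k := 3) (a := 9) (b := 18) (by norm_num) (by norm_num)
    (by norm_num)).congr (fun y u _ => by rw [one_mul]) (by simp)

lemma one_mul_inv_one_sub_X : (1 : PowerSeries ℂ) * (1 - PowerSeries.X)⁻¹ =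
    PowerSeries.mk fun _ => 1 := by
  refine ((PowerSeries.eq_mul_inv_iff_mul_eq (by simp)).2 ?_).symm
  exact PowerSeries.mk_one_mul_one_sub_eq_one ℂ

lemma one_mul_inv_one_add_X : (1 : PowerSeries ℂ) * (1 + PowerSeries.X)⁻¹ =
    PowerSeries.mk fun k => (-1) ^ k := by
  refine ((PowerSeries.eq_mul_inv_iff_mul_eq (by simp)).2 ?_).symm
  ext k
  rcases k with _ | k
  · simp
  · simp [mul_add, PowerSeries.coeff_succ_mul_X, PowerSeries.coeff_one, pow_succ]

lemma one_sub_X_mul_inv_one_sub_X_cube :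
    (1 - PowerSeries.X : PowerSeries ℂ) * (1 - PowerSeries.X ^ 3)⁻¹ =
    PowerSeries.mk fun k => if k % 3 = 0 then 1 else if k % 3 = 1 then -1 else 0 := by
  refine ((PowerSeries.eq_mul_inv_iff_mul_eq (by simp)).2 ?_).symm
  ext k
  obtain rfl | rfl | rfl | ⟨l, rfl⟩ : k = 0 ∨ k = 1 ∨ k = 2 ∨ ∃ l, k = l + 3 := by
    rcases k with _ | _ | _ | l <;> simp
  all_goals simp [mul_sub, PowerSeries.coeff_mul_X_pow', PowerSeries.coeff_X, PowerSeries.coeff_one]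

lemma one_sub_X_sq_mul_inv_one_sub_X_cube :
    (1 - PowerSeries.X ^ 2 : PowerSeries ℂ) * (1 - PowerSeries.X ^ 3)⁻¹ =
    PowerSeries.mk fun k => if k % 3 = 0 then 1 else if k % 3 = 2 then -1 else 0 := by
  refine ((PowerSeries.eq_mul_inv_iff_mul_eq (by simp)).2 ?_).symm
  ext k
  obtain rfl | rfl | rfl | ⟨l, rfl⟩ : k = 0 ∨ k = 1 ∨ k = 2 ∨ ∃ l, k = l + 3 := by
    rcases k with _ | _ | _ | l <;> simp
  all_goals simp [mul_sub, PowerSeries.coeff_mul_X_pow', PowerSeries.coeff_X_pow,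
    PowerSeries.coeff_one]

lemma hasExpansion_mul_inv {r s : ℕ} (hr : r ≠ 0) (hs1 : 1 ≤ s) (hs2 : s ≤ 2)
    {A B : ℂ → ℂ → ℂ} {g h : PowerSeries ℂ} (hA : ∀ K, HasSymbolUpTo r K A g)
    (hB : ∀ K, HasSymbolUpTo r K B h) (hh : PowerSeries.constantCoeff h = 1) {c : ℕ → ℂ}
    (hc : g * h⁻¹ = PowerSeries.mk c) (hc0 : c 0 = 1) :
    HasExpansion (fun t u => (t⁻¹ ^ s - t ^ s) *
      ((A (t ^ 2) u * (B (t ^ 2) u)⁻¹) * (A (t⁻¹ ^ 2) u * (B (t⁻¹ ^ 2) u)⁻¹)))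
      (fun j => r * j) (fun j => 2 * j + s) (fun j => -c j) := by
  have := hasExpansion_of_symbol (A := fun y u => A y u * (B y u)⁻¹) hr hs1 hs2
    (fun K => (hA K).mul hr (HasSymbolUpTo.inv hr hB (by rw [hh]; exact one_ne_zero) K))
    (by rw [hc, ← PowerSeries.coeff_zero_eq_constantCoeff_apply, PowerSeries.coeff_mk, hc0])
  simpa only [hc, PowerSeries.coeff_mk] using this

/-! ### Trisection of the quotients of theta functions -/

lemma exists_cubic_root : ∃ ζ : ℂ, 1 + ζ + ζ ^ 2 = 0 := by
  obtain ⟨s, hs⟩ := IsAlgClosed.exists_eq_mul_self (discrim (1 : ℂ) 1 1)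
  obtain ⟨ζ, hζ⟩ := exists_quadratic_eq_zero one_ne_zero ⟨s, hs⟩
  exact ⟨ζ, by linear_combination hζ⟩

/-- With q = u^6 = p² and y = t², the factors containing py and -py combine into functions of y²,
which gives the product treated by `trisection_theta`. -/
lemma sub_mul_numB {t u : ℂ} (ht : t ≠ 0) (hu0 : u ≠ 0) (hu : ‖u‖ < 1) :
    (t⁻¹ ^ 1 - t ^ 1) * (numB (t ^ 2) u * numB (t⁻¹ ^ 2) u) =
      t⁻¹ * (theta (t ^ 2) ((u ^ 3) ^ 2) *
        theta ((u ^ 3) ^ 2 * (t ^ 2) ^ 2) (((u ^ 3) ^ 2) ^ 2)) := by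
  have h1 := theta_pow_eq_qp (t ^ 2) (b := 6) (by norm_num) hu
  have h2 := theta_mid_eq_qp ((t ^ 2) ^ 2) 6 hu0
  have h3 := qp_mul_qp_neg (t ^ 2) 3 (b := 6) (by norm_num) hu
  have h4 := qp_mul_qp_neg (t⁻¹ ^ 2) 3 (b := 6) (by norm_num) hu
  rw [← pow_mul u, ← pow_mul u, h1, h2, numB, numB, mul_assoc (qp (t ^ 2) 6 6 u),
    mul_assoc (qp (t⁻¹ ^ 2) 6 6 u), h3, h4, ← inv_pow (t ^ 2) 2, ← inv_pow t 2]
  have h5 : t⁻¹ ^ 1 - t ^ 1 = t⁻¹ * (1 - t ^ 2) := by field_simp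
  rw [h5]
  ring

/-- The same product arises with y = u³ t², since θ(q² t⁴; q²) differs from θ(t⁴; q²) only by an
elementary factor. -/
lemma sub_mul_numA {t u : ℂ} (ht : t ≠ 0) (hu0 : u ≠ 0) (hu : ‖u‖ < 1) :
    (t⁻¹ ^ 2 - t ^ 2) * (numA (t ^ 2) u * numA (t⁻¹ ^ 2) u) =
      -t ^ 2 * (theta (u ^ 3 * t ^ 2) ((u ^ 3) ^ 2) *
        theta ((u ^ 3) ^ 2 * (u ^ 3 * t ^ 2) ^ 2) (((u ^ 3) ^ 2) ^ 2)) := by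
  have h1 := theta_mid_eq_qp (t ^ 2) 3 hu0
  have h2 : theta (u ^ 12 * (t ^ 2) ^ 2) (u ^ 12) = (1 - (t⁻¹ ^ 2) ^ 2) *
      (qp ((t ^ 2) ^ 2) 12 12 u * qp ((t⁻¹ ^ 2) ^ 2) 12 12 u) := by
    have e1 : u ^ 12 / (u ^ 12 * (t ^ 2) ^ 2) = (t⁻¹ ^ 2) ^ 2 := by
      field_simp
    unfold theta qp
    rw [e1, qPoch_shift ((t⁻¹ ^ 2) ^ 2) (norm_pow_lt_one hu (by norm_num)), mul_comm (u ^ 12)]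
    ring
  have h3 := qp_mul_qp_neg (t ^ 2) 6 (b := 6) (by norm_num) hu
  have h4 := qp_mul_qp_neg (t⁻¹ ^ 2) 6 (b := 6) (by norm_num) hu
  rw [← pow_mul u, ← pow_mul u, h1, numA, numA, h3, h4,
    show u ^ (3 * 2) * (u ^ 3 * t ^ 2) ^ 2 = u ^ 12 * (t ^ 2) ^ 2 by ring, h2, ← inv_pow t 2]
  have h5 : t⁻¹ ^ 2 - t ^ 2 = -t ^ 2 * (1 - (t⁻¹ ^ 2) ^ 2) := by
    field_simp
    ring
  rw [h5]
  ring

/-- The quotient of a function whose trisection vanishes by a function of `t^6`. -/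
lemma trisect_mul_inv_cube {s : ℕ} {A : ℂ → ℂ → ℂ} {ζ : ℂ} (hζ : 1 + ζ + ζ ^ 2 = 0)
    (hA : ∀ t ≠ 0, ∀ u ≠ 0, ‖u‖ < 1 → (t⁻¹ ^ s - t ^ s) * (A (t ^ 2) u * A (t⁻¹ ^ 2) u) +
      ((ζ * t)⁻¹ ^ s - (ζ * t) ^ s) * (A ((ζ * t) ^ 2) u * A ((ζ * t)⁻¹ ^ 2) u) +
      ((ζ ^ 2 * t)⁻¹ ^ s - (ζ ^ 2 * t) ^ s) *
        (A ((ζ ^ 2 * t) ^ 2) u * A ((ζ ^ 2 * t)⁻¹ ^ 2) u) = 0) {f : ℂ → ℂ → ℂ}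
    (hf : ∀ t u, f t u = (t⁻¹ ^ s - t ^ s) * ((A (t ^ 2) u * (qp ((t ^ 2) ^ 3) 9 18 u)⁻¹) *
      (A (t⁻¹ ^ 2) u * (qp ((t⁻¹ ^ 2) ^ 3) 9 18 u)⁻¹))) :
    ∀ t ≠ 0, ∀ᶠ u in 𝓝[≠] (0 : ℂ), f t u + f (ζ * t) u + f (ζ ^ 2 * t) u = 0 := by
  have hζ3 : ζ ^ 3 = 1 := by linear_combination (ζ - 1) * hζ
  have hζ3' : ζ⁻¹ ^ 3 = 1 := by rw [inv_pow, hζ3, inv_one]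
  intro t ht
  have hlt : ∀ᶠ u in 𝓝[≠] (0 : ℂ), ‖u‖ < 1 := by
    refine Eventually.filter_mono nhdsWithin_le_nhds ?_
    filter_upwards [Metric.ball_mem_nhds (0 : ℂ) one_pos] with u hu using mem_ball_zero_iff.1 hu
  filter_upwards [hlt, self_mem_nhdsWithin] with u hu hu0
  have e : ∀ ξ : ℂ, ξ ^ 3 = 1 → ((ξ * t) ^ 2) ^ 3 = (t ^ 2) ^ 3 ∧
      ((ξ * t)⁻¹ ^ 2) ^ 3 = (t⁻¹ ^ 2) ^ 3 := by
    intro ξ hξ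
    have hξ' : ξ⁻¹ ^ 3 = 1 := by rw [inv_pow, hξ, inv_one]
    rw [mul_inv]
    exact ⟨by linear_combination (ξ ^ 3 + 1) * t ^ 6 * hξ,
      by linear_combination (ξ⁻¹ ^ 3 + 1) * t⁻¹ ^ 6 * hξ'⟩
  have hζ6 : (ζ ^ 2) ^ 3 = 1 := by rw [← pow_mul, mul_comm, pow_mul, hζ3, one_pow]
  rw [hf, hf, hf, (e ζ hζ3).1, (e ζ hζ3).2, (e _ hζ6).1, (e _ hζ6).2]
  linear_combination (qp ((t ^ 2) ^ 3) 9 18 u)⁻¹ * (qp ((t⁻¹ ^ 2) ^ 3) 9 18 u)⁻¹ * hA t ht u hu0 hu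

/-- Replacing t by ζt multiplies both y = t² and the outer factor t^{-1} by ω = ζ² = ζ^{-1}, which
are precisely the weights in `trisection_theta`. -/
lemma trisect_numB {ζ : ℂ} (hζ : 1 + ζ + ζ ^ 2 = 0) {t u : ℂ} (ht : t ≠ 0) (hu0 : u ≠ 0)
    (hu : ‖u‖ < 1) : (t⁻¹ ^ 1 - t ^ 1) * (numB (t ^ 2) u * numB (t⁻¹ ^ 2) u) +
      ((ζ * t)⁻¹ ^ 1 - (ζ * t) ^ 1) * (numB ((ζ * t) ^ 2) u * numB ((ζ * t)⁻¹ ^ 2) u) +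
      ((ζ ^ 2 * t)⁻¹ ^ 1 - (ζ ^ 2 * t) ^ 1) *
        (numB ((ζ ^ 2 * t) ^ 2) u * numB ((ζ ^ 2 * t)⁻¹ ^ 2) u) = 0 := by
  have hζ3 : ζ ^ 3 = 1 := by linear_combination (ζ - 1) * hζ
  have hζ0 : ζ ≠ 0 := by
    rintro rfl
    norm_num at hζ
  have hω : 1 + ζ ^ 2 + (ζ ^ 2) ^ 2 = 0 := by linear_combination (ζ ^ 2 - ζ + 1) * hζ
  have hinv : ζ⁻¹ = ζ ^ 2 := by
    field_simp
    exact hζ3.symm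
  rw [sub_mul_numB ht hu0 hu, sub_mul_numB (mul_ne_zero hζ0 ht) hu0 hu,
    sub_mul_numB (mul_ne_zero (pow_ne_zero 2 hζ0) ht) hu0 hu, mul_inv, mul_inv, ← inv_pow, hinv,
    mul_pow ζ t 2, mul_pow (ζ ^ 2) t 2]
  have := trisection_theta (pow_ne_zero 3 hu0) (norm_pow_lt_one hu (by norm_num : (3 : ℕ) ≠ 0))
    (pow_ne_zero 2 ht) hω
  linear_combination t⁻¹ * this

lemma trisect_numA {ζ : ℂ} (hζ : 1 + ζ + ζ ^ 2 = 0) {t u : ℂ} (ht : t ≠ 0) (hu0 : u ≠ 0)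
    (hu : ‖u‖ < 1) : (t⁻¹ ^ 2 - t ^ 2) * (numA (t ^ 2) u * numA (t⁻¹ ^ 2) u) +
      ((ζ * t)⁻¹ ^ 2 - (ζ * t) ^ 2) * (numA ((ζ * t) ^ 2) u * numA ((ζ * t)⁻¹ ^ 2) u) +
      ((ζ ^ 2 * t)⁻¹ ^ 2 - (ζ ^ 2 * t) ^ 2) *
        (numA ((ζ ^ 2 * t) ^ 2) u * numA ((ζ ^ 2 * t)⁻¹ ^ 2) u) = 0 := by
  have hζ0 : ζ ≠ 0 := by
    rintro rfl
    norm_num at hζ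
  have hω : 1 + ζ ^ 2 + (ζ ^ 2) ^ 2 = 0 := by linear_combination (ζ ^ 2 - ζ + 1) * hζ
  rw [sub_mul_numA ht hu0 hu, sub_mul_numA (mul_ne_zero hζ0 ht) hu0 hu,
    sub_mul_numA (mul_ne_zero (pow_ne_zero 2 hζ0) ht) hu0 hu,
    mul_pow ζ t 2, mul_pow (ζ ^ 2) t 2, mul_left_comm (u ^ 3), mul_left_comm (u ^ 3)]
  have := trisection_theta (pow_ne_zero 3 hu0) (norm_pow_lt_one hu (by norm_num : (3 : ℕ) ≠ 0))
    (mul_ne_zero (pow_ne_zero 3 hu0) (pow_ne_zero 2 ht)) hω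
  linear_combination (-t ^ 2) * this

/-- The coefficients of (1 - X²)/(1 - X³) have period 1, 0, -1, and j ≡ 1 mod 3 is exactly where 3 ∣
2j + 1. Trisection discards these j; the others are j = ⌊(3k+1)/2⌋ = 0, 2, 3, 5, …, with alternating
signs. -/
lemma hasExpansion_numB_cube : HasExpansion (fun t u => (t⁻¹ ^ 1 - t ^ 1) *
      ((numB (t ^ 2) u * (qp ((t ^ 2) ^ 3) 9 18 u)⁻¹) *
        (numB (t⁻¹ ^ 2) u * (qp ((t⁻¹ ^ 2) ^ 3) 9 18 u)⁻¹)))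
    (fun k => 3 * ((3 * k + 1) / 2)) (fun k => 2 * ((3 * k + 1) / 2) + 1)
    (fun k => -(-1) ^ k) := by
  obtain ⟨ζ, hζ⟩ := exists_cubic_root
  have h := hasExpansion_mul_inv (A := numB) (B := fun y u => qp (y ^ 3) 9 18 u) three_ne_zero
    le_rfl one_le_two (hasSymbolUpTo_numB three_ne_zero le_rfl) hasSymbolUpTo_qp_cube (by simp)
    one_sub_X_sq_mul_inv_one_sub_X_cube rfl
  have h' := h.trisect hζ (trisect_mul_inv_cube hζ
    (fun t ht u hu0 hu => trisect_numB hζ ht hu0 hu) fun t u => rfl)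
    (e := fun k => (3 * k + 1) / 2) (strictMono_nat_of_lt_succ fun k => by omega) fun k => by
      simp only [Set.mem_range]
      constructor
      · intro hk
        obtain ⟨q, rfl | rfl⟩ : ∃ q, k = 3 * q ∨ k = 3 * q + 2 := ⟨k / 3, by omega⟩
        · exact ⟨2 * q, by omega⟩
        · exact ⟨2 * q + 1, by omega⟩
      · rintro ⟨l, rfl⟩
        omega
  convert h' using 2 with k
  rcases Nat.even_or_odd' k with ⟨l, rfl | rfl⟩
  · rw [if_pos (by omega), pow_mul]
    simp
  · rw [if_neg (by omega), if_pos (by omega), pow_add, pow_mul]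
    simp

/-- Here the period is 1, -1, 0, and j ≡ 2 mod 3 is where 3 ∣ 2j + 2. The remaining indices are j =
⌊3k/2⌋ = 0, 1, 3, 4, …. -/
lemma hasExpansion_numA_cube : HasExpansion (fun t u => (t⁻¹ ^ 2 - t ^ 2) *
      ((numA (t ^ 2) u * (qp ((t ^ 2) ^ 3) 9 18 u)⁻¹) *
        (numA (t⁻¹ ^ 2) u * (qp ((t⁻¹ ^ 2) ^ 3) 9 18 u)⁻¹)))
    (fun k => 3 * (3 * k / 2)) (fun k => 2 * (3 * k / 2) + 2) (fun k => -(-1) ^ k) := by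
  obtain ⟨ζ, hζ⟩ := exists_cubic_root
  have h := hasExpansion_mul_inv (A := numA) (B := fun y u => qp (y ^ 3) 9 18 u) three_ne_zero
    one_le_two le_rfl (hasSymbolUpTo_numA three_ne_zero le_rfl) hasSymbolUpTo_qp_cube (by simp)
    one_sub_X_mul_inv_one_sub_X_cube rfl
  have h' := h.trisect hζ (trisect_mul_inv_cube hζ
    (fun t ht u hu0 hu => trisect_numA hζ ht hu0 hu) fun t u => rfl)
    (e := fun k => 3 * k / 2) (strictMono_nat_of_lt_succ fun k => by omega) fun k => by
      simp only [Set.mem_range]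
      constructor
      · intro hk
        obtain ⟨q, rfl | rfl⟩ : ∃ q, k = 3 * q ∨ k = 3 * q + 1 := ⟨k / 3, by omega⟩
        · exact ⟨2 * q, by omega⟩
        · exact ⟨2 * q + 1, by omega⟩
      · rintro ⟨l, rfl⟩
        omega
  convert h' using 2 with k
  rcases Nat.even_or_odd' k with ⟨l, rfl | rfl⟩
  · rw [if_pos (by omega), pow_mul]
    simp
  · rw [if_neg (by omega), if_pos (by omega), pow_add, pow_mul]
    simp

end EllipticPfaffian

/-! ### The leading term for each σ. -/

namespace EllipticPfaffian

open Finset Filter Topology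

/-! ### Products and sums over the indices -/

lemma prod_range_neg_neg_one_pow (n : ℕ) :
    ∏ k ∈ range n, (-(-1) ^ k : ℂ) = (-1) ^ ((n + 1) / 2) := by
  induction n with
  | zero => simp
  | succ n ih =>
    rw [prod_range_succ, ih]
    rcases Nat.even_or_odd' n with ⟨l, rfl | rfl⟩
    · rw [show (2 * l + 1 + 1) / 2 = l + 1 by omega, show (2 * l + 1) / 2 = l by omega, pow_mul]
      simp [pow_succ]
    · rw [show (2 * l + 1 + 1 + 1) / 2 = l + 1 by omega, show (2 * l + 1 + 1) / 2 = l + 1 by omega,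
        pow_add _ (2 * l), pow_mul]
      simp

lemma neg_one_pow_triangle (n : ℕ) : (-1 : ℂ) ^ (n * (n + 1) / 2) = (-1) ^ ((n + 1) / 2) := by
  rcases Nat.even_or_odd' n with ⟨l, rfl | rfl⟩
  · rw [show 2 * l * (2 * l + 1) / 2 = 2 * (l * l) + l by
      rw [mul_assoc, Nat.mul_div_cancel_left _ two_pos]; ring,
      show (2 * l + 1) / 2 = l by omega, pow_add, pow_mul]
    simp
  · rw [show (2 * l + 1) * (2 * l + 1 + 1) / 2 = 2 * (l * (l + 1)) + (l + 1) by
      rw [show (2 * l + 1) * (2 * l + 1 + 1) = 2 * (2 * (l * (l + 1)) + (l + 1)) by ring,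
        Nat.mul_div_cancel_left _ two_pos],
      show (2 * l + 1 + 1) / 2 = l + 1 by omega, pow_add, pow_mul]
    simp

lemma prod_pairs_mul {m : ℕ} (v : Fin m → ℂ) :
    ∏ i, ∏ j ∈ Ioi i, v i * v j = (∏ i, v i) ^ (m - 1) := by
  simp only [prod_mul_distrib, prod_const, Fin.card_Ioi]
  rw [prod_comm' (t' := univ) (s' := fun j => Iio j) (by simp)]
  simp only [prod_const, Fin.card_Iio]
  rw [← prod_mul_distrib, ← prod_pow]
  refine prod_congr rfl fun i _ => ?_
  rw [← pow_add]
  congr 1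
  have := i.2
  omega

lemma sum_range_cast (n : ℕ) : ((∑ k ∈ range n, k : ℕ) : ℚ) = n * (n - 1) / 2 := by
  induction n with
  | zero => simp
  | succ n ih =>
    rw [sum_range_succ, Nat.cast_add, ih]
    push_cast
    ring

lemma sum_range_two_mul (l : ℕ) (f : ℕ → ℕ) :
    ∑ k ∈ range (2 * l), f k = ∑ k ∈ range l, (f (2 * k) + f (2 * k + 1)) := by
  induction l with
  | zero => simp
  | succ l ih => rw [mul_add, mul_one, sum_range_succ, sum_range_succ, ih, sum_range_succ, add_assoc]

lemma antitone_doubleStaircase (n : ℕ) : Antitone (doubleStaircase n) := by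
  intro a b hab
  have := Fin.le_def.1 hab
  unfold doubleStaircase
  omega

lemma antitone_shiftedStaircase (n : ℕ) : Antitone (shiftedStaircase n) := by
  intro a b hab
  have := Fin.le_def.1 hab
  unfold shiftedStaircase
  omega

/-- Grouping consecutive terms removes the integer parts. -/
lemma sum_range_div_two_add (l : ℕ) :
    ((∑ k ∈ range (2 * l), (3 * k + 1) / 2 : ℕ) : ℚ) = l * (3 * l - 1) ∧
      ((∑ k ∈ range (2 * l), 3 * k / 2 : ℕ) : ℚ) = l * (3 * l - 2) := by
  simp only [sum_range_two_mul]
  induction l with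
  | zero => simp
  | succ l ih =>
    rw [sum_range_succ, sum_range_succ, Nat.cast_add (∑ k ∈ range l, _),
      Nat.cast_add (∑ k ∈ range l, _), ih.1, ih.2,
      show (3 * (2 * l) + 1) / 2 + (3 * (2 * l + 1) + 1) / 2 = 6 * l + 2 by omega,
      show 3 * (2 * l) / 2 + 3 * (2 * l + 1) / 2 = 6 * l + 1 by omega]
    push_cast
    constructor <;> ring

/-! ### The leading terms -/

lemma tendsto_qp_cube (y : ℂ) : Tendsto (fun u => qp (y ^ 3) 9 18 u) (𝓝[≠] 0) (𝓝 1) :=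
  tendsto_qp _ (by norm_num) (by norm_num)

lemma isLeadingTerm_zero (n : ℕ) : IsLeadingTerm (P .zero n) ((n : ℚ) * ((n : ℚ) - 1) / 6)
    (fun z => (-1) ^ n * (∏ j, mulVar z j) ^ (-2 * (n : ℤ)) *
      altDet (fun j : Fin (2 * n) => if (j : ℕ) < n then 1 else 0) (fun j => mulVar z j ^ 2)) := by
  refine isLeadingTerm_P_of_hasExpansion (s := 2) (num := numA) (den := fun y u => qp y 1 2 u)
    (E := fun _ => 1) (fun _ => rfl) (fun z τ i j => ?_) (fun z τ i j => ?_) differentiableOn_numA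
    (fun y => differentiableOn_qp _ _ two_ne_zero)
    (fun y => tendsto_qp _ one_ne_zero two_ne_zero)
    (hasExpansion_mul_inv one_ne_zero one_le_two le_rfl
      (hasSymbolUpTo_numA one_ne_zero (by norm_num))
      (fun K => hasSymbolUpTo_qp_self one_ne_zero K two_ne_zero le_rfl) (by simp)
      (by simpa using one_mul_inv_one_sub_X) rfl) (fun a b h => by simpa using h) ?_
    (pow_ne_zero n (neg_ne_zero.2 one_ne_zero)) _ two_ne_zero ?_ fun x hx => ?_
  · rw [one_mul, ← div_sq_mul_tripleA τ (mulVar_ne_zero z i) (mulVar_ne_zero z j)]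
    rfl
  · rw [one_mul, ← theta_one_third]
    rfl
  · simp only [one_mul, sum_range_cast]
    ring
  · intro a b hab
    have := Fin.le_def.1 hab
    simp only
    split_ifs <;> omega
  -- The exponents are ±2, ±4, …, ±2n. The gap at 0 shifts the upper half by one step, whence the
  -- partition (1^n, 0^n) and e_n.
  · rw [det_interleave_pow_rev x hx (fun k => 2 * k + 2) (2 * n)
      (fun j => if (j : ℕ) < n then 1 else 0)]
    · simp only [prod_const_one, one_mul, prod_const, card_range]
      rw [← mul_assoc]
      congr 3
    · intro j h
      rw [if_pos h]
      omega
    · intro j h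
      rw [if_neg h]
      omega

lemma isLeadingTerm_six (n : ℕ) (hn : 1 ≤ n) :
    IsLeadingTerm (P .six n) ((n : ℚ) * ((n : ℚ) - 1) / 6)
    (fun z => (-1) ^ n * (∏ j, mulVar z j) ^ (1 - 2 * (n : ℤ)) *
      altDet (fun _ : Fin (2 * n) => 0) (fun j => mulVar z j ^ 2)) := by
  refine isLeadingTerm_P_of_hasExpansion (s := 1) (num := numB) (den := fun y u => qp y 1 2 u)
    (E := fun _ => 1) (fun _ => rfl) (fun z τ i j => ?_) (fun z τ i j => ?_) differentiableOn_numB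
    (fun y => differentiableOn_qp _ _ two_ne_zero)
    (fun y => tendsto_qp _ one_ne_zero two_ne_zero)
    (hasExpansion_mul_inv one_ne_zero le_rfl one_le_two
      (hasSymbolUpTo_numB one_ne_zero (by norm_num))
      (fun K => hasSymbolUpTo_qp_self one_ne_zero K two_ne_zero le_rfl) (by simp)
      (by simpa using one_mul_inv_one_sub_X) rfl) (fun a b h => by simpa using h) ?_
    (pow_ne_zero n (neg_ne_zero.2 one_ne_zero)) _ two_ne_zero antitone_const fun x hx => ?_
  · rw [one_mul, ← div_mul_tripleB τ (mulVar_ne_zero z i) (mulVar_ne_zero z j)]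
    rfl
  · rw [one_mul, ← theta_one_third]
    rfl
  · simp only [one_mul, sum_range_cast]
    ring
  -- The exponents ±1, ±3, …, ±(2n-1) have no gap, so a plain Vandermonde product results.
  · rw [det_interleave_pow_rev x hx (fun k => 2 * k + 1) (2 * n - 1) (fun _ => 0)]
    · simp only [prod_const_one, one_mul, prod_const, card_range]
      rw [← mul_assoc]
      congr 3
      omega
    · intro j h
      omega
    · intro j h
      omega

lemma isLeadingTerm_three (n : ℕ) (hn : 1 ≤ n) :
    IsLeadingTerm (P .three n) ((n : ℚ) * ((n : ℚ) - 1) / 3)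
    (fun z => (-1) ^ (n * (n + 1) / 2) * (∏ j, mulVar z j) ^ (2 - 4 * (n : ℤ)) *
      altDet (fun _ : Fin (2 * n) => 0) (fun j => mulVar z j ^ 4)) := by
  -- The elementary factor of θ(-t²; p^{2/3}), made symmetric, is E(t) = t^{-1} + t. Dividing t^{-2}
  -- - t² by it reduces s from 2 to 1.
  refine isLeadingTerm_P_of_hasExpansion (s := 1) (num := numA) (den := fun y u => qp (-y) 2 2 u)
    (E := fun t => t⁻¹ + t) (fun _ => by rw [inv_inv, add_comm]) (fun z τ i j => ?_)
    (fun z τ i j => ?_) differentiableOn_numA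
    (fun y => differentiableOn_qp _ _ two_ne_zero)
    (fun y => tendsto_qp _ two_ne_zero two_ne_zero)
    (hasExpansion_mul_inv two_ne_zero le_rfl one_le_two
      (hasSymbolUpTo_numA two_ne_zero (by norm_num))
      (fun K => hasSymbolUpTo_qp_neg two_ne_zero K two_ne_zero le_rfl) (by simp)
      (by simpa using one_mul_inv_one_add_X) rfl) (fun a b h => by simpa using h) ?_
    (pow_ne_zero _ (neg_ne_zero.2 one_ne_zero)) _ four_ne_zero antitone_const fun x hx => ?_
  · rw [← mul_assoc, show ∀ t : ℂ, (t⁻¹ + t) * (t⁻¹ ^ 1 - t ^ 1) = t⁻¹ ^ 2 - t ^ 2 from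
      fun t => by ring, ← div_sq_mul_tripleA τ (mulVar_ne_zero z i) (mulVar_ne_zero z j)]
    rfl
  · have hi := mulVar_ne_zero z i
    have hj := mulVar_ne_zero z j
    have h := theta_pow_eq_qp (-(mulVar z i / mulVar z j) ^ 2) two_ne_zero
      (norm_nomePow_lt_one τ (by norm_num : (0 : ℚ) < 1 / 3))
    rw [← nomePow_eq_pow τ 2 (by norm_num : (2 / 3 : ℚ) = (2 : ℕ) / 3), inv_neg, ← inv_pow] at h
    simp only [prefactor]
    rw [← div_pow, h, ← mul_assoc]
    congr 1
    field_simp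
    ring
  · rw [← mul_sum, Nat.cast_mul, sum_range_cast]
    push_cast
    ring
  · rw [det_interleave_pow_rev x hx (fun k => 2 * k + 1) (2 * n - 1) (fun _ => 0)]
    · rw [prod_range_neg_neg_one_pow, neg_one_pow_triangle, ← Delta_eq_altDet, ← Delta_eq_altDet]
      -- The product of the factors E supplies ∏(x_i² + x_j²), which turns Δ(x²) into Δ(x⁴).
      have h1 : ∏ i, ∏ j ∈ Ioi i, ((x i / x j)⁻¹ + x i / x j) =
          ((∏ i, x i) ^ (2 * n - 1))⁻¹ * ∏ i, ∏ j ∈ Ioi i, (x i ^ 2 + x j ^ 2) := by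
        rw [← prod_pairs_mul, ← prod_inv_distrib, ← prod_mul_distrib]
        refine prod_congr rfl fun i _ => ?_
        rw [← prod_inv_distrib, ← prod_mul_distrib]
        refine prod_congr rfl fun j _ => ?_
        have hi := hx i
        have hj := hx j
        field_simp
        ring
      have h2 : Delta (fun i => x i ^ 4) =
          (∏ i, ∏ j ∈ Ioi i, (x i ^ 2 + x j ^ 2)) * Delta fun i => x i ^ 2 := by
        unfold Delta
        simp only [← prod_mul_distrib]
        refine prod_congr rfl fun i _ => prod_congr rfl fun j _ => ?_
        ring
      have hX : ∏ i, x i ≠ 0 := prod_ne_zero_iff.2 fun i _ => hx i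
      have h3 : (∏ i, x i) ^ (2 - 4 * (n : ℤ)) =
          ((∏ i, x i) ^ (2 * n - 1))⁻¹ * (∏ i, x i) ^ (-((2 * n - 1 : ℕ) : ℤ)) := by
        rw [← zpow_natCast, ← zpow_neg, ← zpow_add₀ hX]
        congr 1
        omega
      rw [h1, h2, h3]
      ring
    · intro j h
      omega
    · intro j h
      omega

lemma isLeadingTerm_two {n d : ℕ} {a : ℚ} {e : ℤ} {lam : Fin (2 * n) → ℕ} (hlam : Antitone lam)
    (ha : ((∑ k ∈ range n, (3 * k + 1) / 2 : ℕ) : ℚ) = a) (he : e = -(d : ℤ))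
    (h1 : ∀ j : Fin (2 * n), (j : ℕ) < n →
      2 * ((3 * (n - 1 - j) + 1) / 2) + 1 + d = 2 * (lam j + (2 * n - 1 - j)))
    (h2 : ∀ j : Fin (2 * n), ¬ (j : ℕ) < n →
      2 * ((3 * (j - n) + 1) / 2) + 1 + 2 * (lam j + (2 * n - 1 - j)) = d) :
    IsLeadingTerm (P .two n) a (fun z => (-1) ^ ((n + 1) / 2) * (∏ j, mulVar z j) ^ e *
      altDet lam (fun j => mulVar z j ^ 2)) := by
  refine isLeadingTerm_P_of_hasExpansion (s := 1) (num := numB)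
    (den := fun y u => qp (y ^ 3) 9 18 u)
    (E := fun _ => 1) (fun _ => rfl) (fun z τ i j => ?_) (fun z τ i j => ?_) differentiableOn_numB
    (fun y => differentiableOn_qp _ _ (by norm_num)) tendsto_qp_cube hasExpansion_numB_cube
    (strictMono_nat_of_lt_succ fun k => by omega) ?_
    (pow_ne_zero _ (neg_ne_zero.2 one_ne_zero)) _ two_ne_zero hlam fun x hx => ?_
  · rw [one_mul, ← div_mul_tripleB τ (mulVar_ne_zero z i) (mulVar_ne_zero z j)]
    rfl
  · rw [one_mul, ← theta_three]
    rfl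
  · rw [← mul_sum, Nat.cast_mul, ha]
    push_cast
    ring
  · rw [det_interleave_pow_rev x hx (fun k => 2 * ((3 * k + 1) / 2) + 1) d lam h1 h2, he,
      prod_range_neg_neg_one_pow]
    simp only [prod_const_one, one_mul]
    ring

lemma isLeadingTerm_four {n d : ℕ} {a : ℚ} {e : ℤ} {lam : Fin (2 * n) → ℕ} (hlam : Antitone lam)
    (ha : ((∑ k ∈ range n, 3 * k / 2 : ℕ) : ℚ) = a) (he : e = -(d : ℤ))
    (h1 : ∀ j : Fin (2 * n), (j : ℕ) < n →
      2 * (3 * (n - 1 - j) / 2) + 2 + d = 2 * (lam j + (2 * n - 1 - j)))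
    (h2 : ∀ j : Fin (2 * n), ¬ (j : ℕ) < n →
      2 * (3 * (j - n) / 2) + 2 + 2 * (lam j + (2 * n - 1 - j)) = d) :
    IsLeadingTerm (P .four n) a (fun z => (-1) ^ ((n + 1) / 2) * (∏ j, mulVar z j) ^ e *
      altDet lam (fun j => mulVar z j ^ 2)) := by
  refine isLeadingTerm_P_of_hasExpansion (s := 2) (num := numA)
    (den := fun y u => qp (y ^ 3) 9 18 u)
    (E := fun _ => 1) (fun _ => rfl) (fun z τ i j => ?_) (fun z τ i j => ?_) differentiableOn_numA
    (fun y => differentiableOn_qp _ _ (by norm_num)) tendsto_qp_cube hasExpansion_numA_cube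
    (strictMono_nat_of_lt_succ fun k => by omega) ?_
    (pow_ne_zero _ (neg_ne_zero.2 one_ne_zero)) _ two_ne_zero hlam fun x hx => ?_
  · rw [one_mul, ← div_sq_mul_tripleA τ (mulVar_ne_zero z i) (mulVar_ne_zero z j)]
    rfl
  · rw [one_mul, ← theta_three]
    rfl
  · rw [← mul_sum, Nat.cast_mul, ha]
    push_cast
    ring
  · rw [det_interleave_pow_rev x hx (fun k => 2 * (3 * k / 2) + 2) d lam h1 h2, he,
      prod_range_neg_neg_one_pow]
    simp only [prod_const_one, one_mul]
    ring

/-- In y = x⁴ the columns of `pform_sub_add` have exponents 3k + 1 and 3k. Listed decreasingly and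
compared with 2n - 1 - j, they give the double staircase. -/
lemma pform_sub_add_pow {n : ℕ} (x : Fin (2 * n) → ℂ) :
    pform (fun i j => x i ^ 4 - x j ^ 4) (fun i j => x i ^ 6 + x j ^ 6) =
      altDet (doubleStaircase n) fun j => x j ^ 4 := by
  rw [pform_sub_add (fun i => x i ^ 6) (fun i => x i ^ 4), ← det_interleave_comp _ _ Fin.revPerm,
    altDet]
  congr 1
  ext i j
  obtain ⟨k, rfl⟩ := (posEquiv n).surjective j
  rcases k with k | k
  · rw [posEquiv_inl, interleave_evenPos, Matrix.of_apply]
    simp only [← pow_mul, ← pow_add, Fin.revPerm_apply, Fin.val_rev, doubleStaircase, evenPos_val]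
    congr 1
    omega
  · rw [posEquiv_inr, interleave_oddPos, Matrix.of_apply]
    simp only [← pow_mul, Fin.revPerm_apply, Fin.val_rev, doubleStaircase, oddPos_val]
    congr 1
    omega

lemma isLeadingTerm_one (n : ℕ) (hn : 1 ≤ n) : IsLeadingTerm (P .one n) 0
    (fun z => (-1) ^ n * (∏ j, mulVar z j) ^ (4 - 6 * (n : ℤ)) *
      altDet (doubleStaircase n) (fun j => mulVar z j ^ 4)) := by
  refine isLeadingTerm_P_of_tendsto (M := 0)
    (fun z i j u => ((mulVar z i / mulVar z j)⁻¹ ^ 2 - (mulVar z i / mulVar z j) ^ 2) *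
        (numA ((mulVar z i / mulVar z j) ^ 2) u * numA ((mulVar z i / mulVar z j)⁻¹ ^ 2) u))
    (fun z i j u => ((mulVar z i / mulVar z j)⁻¹ ^ 3 + (mulVar z i / mulVar z j) ^ 3) *
        (qp (-(mulVar z i / mulVar z j) ^ 6) 18 18 u *
          qp (-(mulVar z i / mulVar z j)⁻¹ ^ 6) 18 18 u))
    (fun z τ i j => ?_) (fun z τ i j => ?_)
    (fun z i j => ((differentiableOn_numA _).mul (differentiableOn_numA _)).const_mul _)
    (fun z i j => ((differentiableOn_qp _ _ (by norm_num)).mul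
      (differentiableOn_qp _ _ (by norm_num))).const_mul _) (by norm_num)
    (pow_ne_zero _ (neg_ne_zero.2 one_ne_zero)) _ four_ne_zero (antitone_doubleStaircase n)
    fun z => ?_
  · rw [← div_sq_mul_tripleA τ (mulVar_ne_zero z i) (mulVar_ne_zero z j)]
    rfl
  · have hi := mulVar_ne_zero z i
    have hj := mulVar_ne_zero z j
    have h := theta_pow_eq_qp (-(mulVar z i / mulVar z j) ^ 6) (b := 18) (by norm_num)
      (norm_nomePow_lt_one τ (by norm_num : (0 : ℚ) < 1 / 3))
    rw [← nomePow_eq_pow τ 18 (by norm_num : (6 : ℚ) = (18 : ℕ) / 3), inv_neg, ← inv_pow] at h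
    simp only [prefactor]
    rw [← div_pow _ _ 6, h, ← mul_assoc]
    congr 1
    field_simp
    ring
  · set x := mulVar z with hx'
    have hx : ∀ i, x i ≠ 0 := mulVar_ne_zero z
    have hX : ∏ i, x i ≠ 0 := prod_ne_zero_iff.2 fun i _ => hx i
    have h0 : pform (fun i j => (x i / x j)⁻¹ ^ 2 - (x i / x j) ^ 2)
        (fun i j => (x i / x j)⁻¹ ^ 3 + (x i / x j) ^ 3) =
        (-1) ^ n * (∏ j, x j) ^ (4 - 6 * (n : ℤ)) *
          altDet (doubleStaircase n) (fun j => x j ^ 4) := by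
      -- Clearing denominators gives X^{-3(2n-1)} from the pairs and X from the factor x_i x_j of
      -- each entry, in total X^{4-6n}.
      have e1 := pform_mul_mul (fun i j => (x i)⁻¹ ^ 3 * (x j)⁻¹ ^ 3)
        (fun i j => x i * x j * (-1 * (x i ^ 4 - x j ^ 4))) (fun i j => x i ^ 6 + x j ^ 6)
        (fun i j => mul_comm _ _)
      rw [pform_mul_left x (fun i j => -1 * (x i ^ 4 - x j ^ 4)) fun i j => x i ^ 6 + x j ^ 6,
        pform_const_mul_left, pform_sub_add_pow, prod_pairs_mul] at e1
      have e2 : (∏ j, x j) ^ (4 - 6 * (n : ℤ)) =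
          (∏ i, (x i)⁻¹ ^ 3) ^ (2 * n - 1) * ∏ j, x j := by
        rw [prod_pow, prod_inv_distrib, ← pow_mul, inv_pow, ← zpow_natCast, ← zpow_neg]
        nth_rewrite 3 [← zpow_one (∏ j, x j)]
        rw [← zpow_add₀ hX]
        congr 1
        omega
      rw [e2, pform_congr (N' := fun i j => (x i)⁻¹ ^ 3 * (x j)⁻¹ ^ 3 *
        (x i * x j * (-1 * (x i ^ 4 - x j ^ 4)))) (W' := fun i j => (x i)⁻¹ ^ 3 * (x j)⁻¹ ^ 3 *
        (x i ^ 6 + x j ^ 6)) _ _, e1]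
      · ring
      · intro i j
        have hi := hx i
        have hj := hx j
        field_simp
        ring
      · intro i j
        have hi := hx i
        have hj := hx j
        field_simp
        ring
    simp only [pow_zero, div_one]
    rw [← h0]
    refine tendsto_pform (N := fun u i j => _) (W := fun u i j => _) (fun i j _ => ?_)
      (fun i j _ => ?_)
    · simpa only [mul_one] using ((tendsto_numA _).mul (tendsto_numA _)).const_mul _
    · simpa only [mul_one] using ((tendsto_qp _ (by norm_num) (by norm_num)).mul
        (tendsto_qp _ (by norm_num) (by norm_num))).const_mul _

end EllipticPfaffian

/-! ### Assembly of the cases, with the parity of n resolved for σ = 2 and σ = 4. -/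

theorem mainTheorem8 (n : ℕ) (hn : 1 ≤ n) :
    EllipticPfaffian.IsLeadingTerm (EllipticPfaffian.P .zero n)
      ((n : ℚ) * ((n : ℚ) - 1) / 6)
      (fun z => (-1) ^ n * (∏ j, EllipticPfaffian.mulVar z j) ^ (-2 * (n : ℤ)) *
        EllipticPfaffian.Delta (fun j => EllipticPfaffian.mulVar z j ^ 2) *
        MvPolynomial.eval (fun j => EllipticPfaffian.mulVar z j ^ 2)
          (MvPolynomial.esymm (Fin (2 * n)) ℂ n)) ∧
    EllipticPfaffian.IsLeadingTerm (EllipticPfaffian.P .one n) 0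
      (fun z => (-1) ^ n * (∏ j, EllipticPfaffian.mulVar z j) ^ (4 - 6 * (n : ℤ)) *
        EllipticPfaffian.Delta (fun j => EllipticPfaffian.mulVar z j ^ 4) *
        MvPolynomial.eval (fun j => EllipticPfaffian.mulVar z j ^ 4)
          (EllipticPfaffian.schur (EllipticPfaffian.doubleStaircase n))) ∧
    (Odd n → EllipticPfaffian.IsLeadingTerm (EllipticPfaffian.P .two n)
      (((n : ℚ) - 1) * (3 * (n : ℚ) + 1) / 4)
      (fun z => (-1) ^ ((n + 1) / 2) * (∏ j, EllipticPfaffian.mulVar z j) ^ (2 - 3 * (n : ℤ)) *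
        EllipticPfaffian.Delta (fun j => EllipticPfaffian.mulVar z j ^ 2) *
        MvPolynomial.eval (fun j => EllipticPfaffian.mulVar z j ^ 2)
          (EllipticPfaffian.schur (EllipticPfaffian.doubleStaircase n)))) ∧
    (Even n → EllipticPfaffian.IsLeadingTerm (EllipticPfaffian.P .two n)
      ((n : ℚ) * (3 * (n : ℚ) - 2) / 4)
      (fun z => (-1) ^ (n / 2) * (∏ j, EllipticPfaffian.mulVar z j) ^ (1 - 3 * (n : ℤ)) *
        EllipticPfaffian.Delta (fun j => EllipticPfaffian.mulVar z j ^ 2) *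
        MvPolynomial.eval (fun j => EllipticPfaffian.mulVar z j ^ 2)
          (EllipticPfaffian.schur (EllipticPfaffian.shiftedStaircase n)))) ∧
    EllipticPfaffian.IsLeadingTerm (EllipticPfaffian.P .three n)
      ((n : ℚ) * ((n : ℚ) - 1) / 3)
      (fun z => (-1) ^ (n * (n + 1) / 2) *
        (∏ j, EllipticPfaffian.mulVar z j) ^ (2 - 4 * (n : ℤ)) *
        EllipticPfaffian.Delta (fun j => EllipticPfaffian.mulVar z j ^ 4)) ∧
    (Odd n → EllipticPfaffian.IsLeadingTerm (EllipticPfaffian.P .four n)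
      (((n : ℚ) - 1) * (3 * (n : ℚ) - 1) / 4)
      (fun z => (-1) ^ ((n + 1) / 2) * (∏ j, EllipticPfaffian.mulVar z j) ^ (1 - 3 * (n : ℤ)) *
        EllipticPfaffian.Delta (fun j => EllipticPfaffian.mulVar z j ^ 2) *
        MvPolynomial.eval (fun j => EllipticPfaffian.mulVar z j ^ 2)
          (EllipticPfaffian.schur (EllipticPfaffian.shiftedStaircase n)))) ∧
    (Even n → EllipticPfaffian.IsLeadingTerm (EllipticPfaffian.P .four n)
      ((n : ℚ) * (3 * (n : ℚ) - 4) / 4)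
      (fun z => (-1) ^ (n / 2) * (∏ j, EllipticPfaffian.mulVar z j) ^ (2 - 3 * (n : ℤ)) *
        EllipticPfaffian.Delta (fun j => EllipticPfaffian.mulVar z j ^ 2) *
        MvPolynomial.eval (fun j => EllipticPfaffian.mulVar z j ^ 2)
          (EllipticPfaffian.schur (EllipticPfaffian.doubleStaircase n)))) ∧
    EllipticPfaffian.IsLeadingTerm (EllipticPfaffian.P .six n)
      ((n : ℚ) * ((n : ℚ) - 1) / 6)
      (fun z => (-1) ^ n * (∏ j, EllipticPfaffian.mulVar z j) ^ (1 - 2 * (n : ℤ)) *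
        EllipticPfaffian.Delta (fun j => EllipticPfaffian.mulVar z j ^ 2)) := by
  open EllipticPfaffian in
  refine ⟨?_, ?_, fun h => ?_, fun h => ?_, ?_, fun h => ?_, fun h => ?_, ?_⟩
  · simpa only [mul_assoc, Delta_mul_eval_esymm _ n (by omega : n ≤ 2 * n)]
      using isLeadingTerm_zero n
  · simpa only [mul_assoc, Delta_mul_eval_schur] using isLeadingTerm_one n hn
  · obtain ⟨l, rfl⟩ := h
    simp only [mul_assoc, Delta_mul_eval_schur]
    simp only [← mul_assoc]
    -- Here, and in the three similar cases, d is the largest exponent m_{n-1}, so that the smallest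
    -- exponent becomes 0. It equals 3n - 2 or 3n - 1 according to σ and the parity of n.
    refine isLeadingTerm_two (d := 3 * (2 * l + 1) - 2) (antitone_doubleStaircase _) ?_ (by omega)
      (fun j hj => ?_) fun j hj => ?_
    · rw [Finset.sum_range_succ, Nat.cast_add, (sum_range_div_two_add l).1,
        show (3 * (2 * l) + 1) / 2 = 3 * l by omega]
      push_cast
      ring
    · unfold doubleStaircase
      omega
    · unfold doubleStaircase
      omega
  · obtain ⟨l, rfl⟩ := h.two_dvd
    simp only [mul_assoc, Delta_mul_eval_schur]
    simp only [← mul_assoc]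
    -- For even n the two forms n/2 and (n+1)/2 of the sign exponent agree under integer division.
    rw [show 2 * l / 2 = (2 * l + 1) / 2 by omega]
    refine isLeadingTerm_two (d := 3 * (2 * l) - 1) (antitone_shiftedStaircase _) ?_ (by omega)
      (fun j hj => ?_) fun j hj => ?_
    · rw [(sum_range_div_two_add l).1]
      push_cast
      ring
    · unfold shiftedStaircase
      omega
    · unfold shiftedStaircase
      omega
  · simpa only [Delta_eq_altDet] using isLeadingTerm_three n hn
  · obtain ⟨l, rfl⟩ := h
    simp only [mul_assoc, Delta_mul_eval_schur]
    simp only [← mul_assoc]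
    refine isLeadingTerm_four (d := 3 * (2 * l + 1) - 1) (antitone_shiftedStaircase _) ?_ (by omega)
      (fun j hj => ?_) fun j hj => ?_
    · rw [Finset.sum_range_succ, Nat.cast_add, (sum_range_div_two_add l).2,
        show 3 * (2 * l) / 2 = 3 * l by omega]
      push_cast
      ring
    · unfold shiftedStaircase
      omega
    · unfold shiftedStaircase
      omega
  · obtain ⟨l, rfl⟩ := h.two_dvd
    simp only [mul_assoc, Delta_mul_eval_schur]
    simp only [← mul_assoc]
    rw [show 2 * l / 2 = (2 * l + 1) / 2 by omega]
    refine isLeadingTerm_four (d := 3 * (2 * l) - 2) (antitone_doubleStaircase _) ?_ (by omega)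
      (fun j hj => ?_) fun j hj => ?_
    · rw [(sum_range_div_two_add l).2]
      push_cast
      ring
    · unfold doubleStaircase
      omega
    · unfold doubleStaircase
      omega
  · simpa only [Delta_eq_altDet] using isLeadingTerm_six n hn
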